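/- **Proposition (Non-asymptotic BvM for GLMs).** *Setting.* Let $d,k,n\ge 1$, let $X_1,\dots,X_n\in\mathbb R^{d\times k}$ and let $\mu$ be a Borel measure on $\mathbb R^k$. Put $\psi(\omega)=\log\int e^{\omega^\top y}\,\mu(dy)$ and $\Omega=\{\omega\in\mathbb R^k:\int e^{\omega^\top y}\mu(dy)<\infty\}$, and consider the full exponential family $p(y\mid\omega)=\exp(\omega^\top y-\psi(\omega))$, $\omega\in\Omega$, of densities with respect to $\mu$. Assume that it is regular ($\Omega$ is open) and minimal ($\mu$ is not concentrated on an affine hyperplane). Let $\Theta=\{\theta\in\mathbb R^d: X_i^\top\theta\in\Omega,\ i=1,\dots,n\}$, let $\theta^*\in\Theta$, and let $Y_1,\dots,Y_n$ be independent with $Y_i\sim p(\cdot\mid X_i^\top\theta^*)\,d\mu$. Let $$\ell(\theta)=\frac1n\sum_{i=1}^n\big[\psi(X_i^\top\theta)-Y_i^\top X_i^\top\theta\big],\qquad F^*=\frac1n\sum_{i=1}^nX_i\nabla^2\psi(X_i^\top\theta^*)X_i^\top .$$ Let the prior be a measurable function $\pi_0\ge0$ on $\Theta$ which is integrable on $\Theta$,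 or bounded on $\Theta$ (it may then be improper), and let $\pi$ be the posterior, i.e. the probability measure on $\Theta$ with density proportional to $e^{-n\ell(\theta)}\pi_0(\theta)$. Write $|u|_{F^*}=(u^\top F^*u)^{1/2}$, and $\|v\|_{F^*}=\sup_{|u|_{F^*}=1}v^\top u$ for $v\in\mathbb R^d$. For $s\ge0$ let $$\mathcal U^*(s)=\{\theta\in\mathbb R^d:|\theta-\theta^*|_{F^*}\le s\sqrt{d/n}\},\qquad \delta^*_{01}(s)=\sup_{\theta\in\mathcal U^*(s)}\|\nabla\log\pi_0(\theta)\|_{F^*},$$ $$\delta_3^*(s)=\sup_{\theta\in\mathcal U^*(s),\,u\ne0}\frac{\frac1n\sum_i\langle\nabla^3\psi(X_i^\top\theta),(X_i^\top u)^{\otimes3}\rangle}{\big(\frac1n\sum_i\langle\nabla^2\psi(X_i^\top\theta^*),(X_i^\top u)^{\otimes2}\rangle\big)^{3/2}},\qquad M_0^*=\frac1d\log\sup_{\theta\in\Theta}\frac{\pi_0(\theta)}{\pi_0(\theta^*)},$$ with the convention $\delta^*_{01}(s)=\infty$ if $\pi_0$ is not $C^1$ or not strictly positive on $\mathcal U^*(s)$;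 $M_0^*=\infty$ is allowed. *Claim.* There is an absolute constant $C>0$ such that the following holds in every such setting. Suppose that the $kn$ columns of the matrices $X_1,\dots,X_n$ together span $\mathbb R^d$, and that for some $s\ge12$ $$\mathcal U^*(2s)\subset\Theta,\qquad 2s\,\delta_3^*(2s)\sqrt{d/n}\le\tfrac14,\qquad \delta_{01}^*(2s)\le\sqrt{nd}/6 .$$ Then there is an event of probability at least $1-\exp(-ds^2/10)$ with respect to the distribution of $(Y_1,\dots,Y_n)$ on which $\ell$ has a unique minimizer $\hat\theta$ over $\Theta$ (the MLE), the posterior $\pi$ is well defined, and $$\mathrm{TV}\big(\pi,\ \mathcal N(\hat\theta,(nF^*)^{-1})\big)\le C\Big(\frac{\delta^*_{01}(2s)}{\sqrt n}+s\,\delta^*_3(2s)\frac{d}{\sqrt n}+e^{d(M_0^*-(s/12)^2)}\Big),$$ where $\mathrm{TV}(P,Q)=\sup_A|P(A)-Q(A)|$. -/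

import Mathlib

open MeasureTheory ProbabilityTheory
open scoped ENNReal RealInnerProductSpace Matrix

noncomputable section

/-! ### Exponential families in canonical form -/

/-- The natural parameter space `{ω | ∫ exp(ωᵀy) μ(dy) < ∞}` of the exponential family with base
measure `μ` on `ℝᵏ`. -/
def naturalSpace {k : ℕ} (μ : Measure (EuclideanSpace ℝ (Fin k))) :
    Set (EuclideanSpace ℝ (Fin k)) :=
  {ω | ∫⁻ y, ENNReal.ofReal (Real.exp ⟪ω, y⟫) ∂μ < ∞}

/-- The log-partition function `ψ(ω) = log ∫ exp(ωᵀy) μ(dy)`. -/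
def logPartition {k : ℕ} (μ : Measure (EuclideanSpace ℝ (Fin k)))
    (ω : EuclideanSpace ℝ (Fin k)) : ℝ :=
  Real.log (∫ y, Real.exp ⟪ω, y⟫ ∂μ)

/-- The member of the family with natural parameter `ω`: the measure with density
`exp(ωᵀy - ψ(ω))` with respect to `μ`. -/
def expFamily {k : ℕ} (μ : Measure (EuclideanSpace ℝ (Fin k)))
    (ω : EuclideanSpace ℝ (Fin k)) : Measure (EuclideanSpace ℝ (Fin k)) :=
  μ.withDensity fun y => ENNReal.ofReal (Real.exp (⟪ω, y⟫ - logPartition μ ω))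

/-- The full family (parametrised by all of `naturalSpace μ`) is regular, i.e. its natural
parameter space is open, and minimal, i.e. `μ` is not concentrated on an affine hyperplane.
(The other half of minimality, that the parameter space is not contained in an affine hyperplane,
is automatic for a nonempty open parameter space.) -/
structure IsRegularMinimal {k : ℕ} (μ : Measure (EuclideanSpace ℝ (Fin k))) : Prop where
  isOpen_naturalSpace : IsOpen (naturalSpace μ)
  minimal : ∀ (a : EuclideanSpace ℝ (Fin k)) (c : ℝ), a ≠ 0 → ¬ ∀ᵐ y ∂μ, ⟪a, y⟫ = c

/-- The Hessian matrix of a function on `ℝᵏ`. -/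
def hessianMatrix {k : ℕ} (f : EuclideanSpace ℝ (Fin k) → ℝ) (ω : EuclideanSpace ℝ (Fin k)) :
    Matrix (Fin k) (Fin k) ℝ :=
  Matrix.of fun i j =>
    iteratedFDeriv ℝ 2 f ω ![EuclideanSpace.single i 1, EuclideanSpace.single j 1]

/-! ### Weighted norms and total variation -/

/-- `|u|_A = |A^{1/2} u|`, i.e. `(uᵀ A u)^{1/2}`, for a positive definite matrix `A`. -/
def weightedNorm {d : ℕ} (A : Matrix (Fin d) (Fin d) ℝ) (u : EuclideanSpace ℝ (Fin d)) : ℝ :=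
  √(u.ofLp ⬝ᵥ (A *ᵥ u.ofLp))

/-- The `A`-weighted operator norm `‖L‖_A = sup {L u : |u|_A = 1}` of a linear functional. The
supremum is taken in `[0,∞]`; negative values of `L u` do not matter, as `L (-u) = - L u`. -/
def weightedDualNorm {d : ℕ} (A : Matrix (Fin d) (Fin d) ℝ)
    (L : EuclideanSpace ℝ (Fin d) →L[ℝ] ℝ) : ℝ≥0∞ :=
  ⨆ (u : EuclideanSpace ℝ (Fin d)) (_ : weightedNorm A u = 1), ENNReal.ofReal (L u)

/-- Total variation distance `sup_A |P(A) - Q(A)|`, over measurable sets `A`. -/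
def tvDistance {α : Type*} [MeasurableSpace α] (P Q : Measure α) : ℝ≥0∞ :=
  ⨆ (A : Set α) (_ : MeasurableSet A), ENNReal.ofReal |P.real A - Q.real A|

/-! ### Generalized linear models -/

/-- The data of a generalized linear model with `n` samples, parameter in `ℝᵈ` and `k`-variate
labels: the base measure of the exponential family and the feature matrices `X₁, …, Xₙ`. -/
structure GLM (d k n : ℕ) where
  base : Measure (EuclideanSpace ℝ (Fin k))
  X : Fin n → Matrix (Fin d) (Fin k) ℝ

namespace GLM

variable {d k n : ℕ} (M : GLM d k n)

/-- The natural parameter `Xᵢᵀ θ` of the `i`-th label. -/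
def predictor (i : Fin n) (θ : EuclideanSpace ℝ (Fin d)) : EuclideanSpace ℝ (Fin k) :=
  WithLp.toLp 2 ((M.X i)ᵀ *ᵥ θ.ofLp)

/-- The parameter domain `Θ = {θ | Xᵢᵀ θ ∈ Ω for all i}`. -/
def paramSpace : Set (EuclideanSpace ℝ (Fin d)) :=
  {θ | ∀ i, M.predictor i θ ∈ naturalSpace M.base}

/-- All `k n` columns of the matrices `X₁, …, Xₙ` together span `ℝᵈ`. -/
def ColumnsSpan : Prop :=
  Submodule.span ℝ (Set.range fun p : Fin n × Fin k => (M.X p.1).col p.2) = ⊤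

/-- The joint law of the independent labels `Yᵢ ∼ p(· | Xᵢᵀ θ) dμ`. -/
def labelLaw (θ : EuclideanSpace ℝ (Fin d)) : Measure (Fin n → EuclideanSpace ℝ (Fin k)) :=
  Measure.pi fun i => expFamily M.base (M.predictor i θ)

/-- The normalized negative log likelihood `ℓ(θ) = n⁻¹ ∑ᵢ (ψ(Xᵢᵀθ) - Yᵢᵀ Xᵢᵀ θ)`. -/
def negLogLik (Y : Fin n → EuclideanSpace ℝ (Fin k)) (θ : EuclideanSpace ℝ (Fin d)) : ℝ :=
  (n : ℝ)⁻¹ * ∑ i, (logPartition M.base (M.predictor i θ) - ⟪Y i, M.predictor i θ⟫)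

/-- `θhat` is a maximum likelihood estimator, i.e. a minimizer of `ℓ` over `Θ`. -/
def IsMLE (Y : Fin n → EuclideanSpace ℝ (Fin k)) (θhat : EuclideanSpace ℝ (Fin d)) : Prop :=
  θhat ∈ M.paramSpace ∧ ∀ θ ∈ M.paramSpace, M.negLogLik Y θhat ≤ M.negLogLik Y θ

/-- The Fisher information `F* = n⁻¹ ∑ᵢ Xᵢ ∇²ψ(Xᵢᵀ θ*) Xᵢᵀ`. -/
def fisher (θstar : EuclideanSpace ℝ (Fin d)) : Matrix (Fin d) (Fin d) ℝ :=
  (n : ℝ)⁻¹ •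
    ∑ i, M.X i * hessianMatrix (logPartition M.base) (M.predictor i θstar) * (M.X i)ᵀ

/-- The local neighborhood `U*(s) = {θ | |θ - θ*|_{F*} ≤ s √(d/n)}`. -/
def nbhd (θstar : EuclideanSpace ℝ (Fin d)) (s : ℝ) : Set (EuclideanSpace ℝ (Fin d)) :=
  {θ | weightedNorm (M.fisher θstar) (θ - θstar) ≤ s * √((d : ℝ) / n)}

/-- `δ*₃(s)`: the supremum over `θ ∈ U*(s)` and `u ≠ 0` of
`(n⁻¹ ∑ᵢ ⟨∇³ψ(Xᵢᵀθ), (Xᵢᵀu)^{⊗3}⟩) / (n⁻¹ ∑ᵢ ⟨∇²ψ(Xᵢᵀθ*), (Xᵢᵀu)^{⊗2}⟩)^{3/2}`.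
The supremum is taken in `[0,∞]`; negative values do not matter, as the ratio is odd in `u`. -/
def delta3 (θstar : EuclideanSpace ℝ (Fin d)) (s : ℝ) : ℝ≥0∞ :=
  ⨆ (θ : EuclideanSpace ℝ (Fin d)) (_ : θ ∈ M.nbhd θstar s)
    (u : EuclideanSpace ℝ (Fin d)) (_ : u ≠ 0),
    ENNReal.ofReal
      (((n : ℝ)⁻¹ * ∑ i, iteratedFDeriv ℝ 3 (logPartition M.base) (M.predictor i θ)
          (fun _ => M.predictor i u)) /
        ((n : ℝ)⁻¹ * ∑ i, iteratedFDeriv ℝ 2 (logPartition M.base) (M.predictor i θstar)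
          (fun _ => M.predictor i u)) ^ (3 / 2 : ℝ))

open Classical in
/-- `δ*₀₁(s) = sup_{θ ∈ U*(s)} ‖∇ log π(θ)‖_{F*}`, with the convention that it is `∞` if the prior
`π` is not `C¹` or not strictly positive on `U*(s)`. The derivative is the one within the set
`U*(s)`; it is the usual derivative wherever that exists. -/
def delta01 (prior : EuclideanSpace ℝ (Fin d) → ℝ) (θstar : EuclideanSpace ℝ (Fin d)) (s : ℝ) :
    ℝ≥0∞ :=
  if ContDiffOn ℝ 1 prior (M.nbhd θstar s) ∧ ∀ θ ∈ M.nbhd θstar s, 0 < prior θ then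
    ⨆ (θ : EuclideanSpace ℝ (Fin d)) (_ : θ ∈ M.nbhd θstar s),
      weightedDualNorm (M.fisher θstar)
        (fderivWithin ℝ (fun θ' => Real.log (prior θ')) (M.nbhd θstar s) θ)
  else ∞

/-- `M₀* = d⁻¹ log sup_{θ ∈ Θ} π(θ)/π(θ*)`, which is `∞` if the prior is unbounded on `Θ`. -/
def M0 (prior : EuclideanSpace ℝ (Fin d) → ℝ) (θstar : EuclideanSpace ℝ (Fin d)) : EReal :=
  (((d : ℝ)⁻¹ : ℝ) : EReal) *
    ENNReal.log (⨆ (θ : EuclideanSpace ℝ (Fin d)) (_ : θ ∈ M.paramSpace),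
      ENNReal.ofReal (prior θ / prior θstar))

/-- The measure with density `exp(-n ℓ(θ)) π(θ)` on `Θ`. -/
def unnormalizedPosterior (prior : EuclideanSpace ℝ (Fin d) → ℝ)
    (Y : Fin n → EuclideanSpace ℝ (Fin k)) : Measure (EuclideanSpace ℝ (Fin d)) :=
  (volume.restrict M.paramSpace).withDensity fun θ =>
    ENNReal.ofReal (Real.exp (-(n : ℝ) * M.negLogLik Y θ) * prior θ)

/-- The posterior: the probability measure on `Θ` with density proportional to
`exp(-n ℓ(θ)) π(θ)`. -/
def posterior (prior : EuclideanSpace ℝ (Fin d) → ℝ)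
    (Y : Fin n → EuclideanSpace ℝ (Fin k)) : Measure (EuclideanSpace ℝ (Fin d)) :=
  (M.unnormalizedPosterior prior Y Set.univ)⁻¹ • M.unnormalizedPosterior prior Y

end GLM

end

/-! ### A Poincaré inequality for the standard Gaussian measure -/

/-! Whitening. Put `θ = θ* + A x` with `A = (nF*)^{-1/2}`. Up to an additive constant, `nℓ` becomes
`K(x) - ⟪b, x⟫`. Here `K` is deterministic and convex, its Hessian at the origin is the identity,
and its third derivative is at most `τ = δ₃*/√n` on the ball of radius `2s√d`. All randomness sits
in the vector `b`. The Gaussian of the claim becomes a standard Gaussian centered at the minimizer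
`xhat`.

The event. For an exponential family the log moment generating function of `b - ∇K(0)` at `t` is
`K(t) - K(0) - K'(0)t`. Since `2s√d τ ≤ 1/4`, Taylor's formula bounds it by `13/24 ‖t‖²` on that
ball. Integrating the moment generating function against a truncated Gaussian in `t` gives `‖b -
∇K(0)‖ < 0.7 s√d` with the required probability (`measure_norm_ge_le`). Then `K - ⟪b, ·⟫` is larger
on the sphere of radius `1.5 s√d` than at the origin, so there is a minimizer inside, which
convexity makes global (`WhitenedLoss.exists_minimizer`). The ball of radius `s√d/2` around it still
lies in the controlled region.

Total variation. On that ball the posterior density relative to the standard Gaussian is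
proportional to `exp f` with `‖∇f(y)‖ ≤ a + ε‖y‖`, where `a = δ₀₁*/√n` and `ε` is of order `s√d τ`.
Put `h = exp(f/2) χ` with a smooth cutoff `χ`. A Hellinger argument bounds the total variation
distance by twice the square root of the relative variance of `h`, and the Gaussian Poincaré
inequality bounds this variance by the energy of `h`, which is of order `a² + ε²d` plus a term from
the annulus where `χ` varies (`NearlyGaussian.gaussian_comparison`). The square root yields the
first two error terms, with no dimensional factor on `a`.

The remaining mass. Outside the ball, convexity makes the loss increment grow at least linearly in
`‖y‖`, while the prior is at most `exp(d M₀*)` times its value at `θ*`; this produces the last error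
term (`WhitenedLoss.tail_le`). If `a` or `sτd` is not small, the bound exceeds 1 for a large
constant and there is nothing to show. -/

/-- Cauchy–Schwarz against the constant function, by expanding the integral of the squared deviation
of `g` from its mean. -/
lemma sq_intervalIntegral_le {g : ℝ → ℝ} (hg : Continuous g) {L : ℝ} (hL : 0 < L) :
    (∫ t in (0 : ℝ)..L, g t) ^ 2 ≤ L * ∫ t in (0 : ℝ)..L, g t ^ 2 := by
  set m := (∫ t in (0 : ℝ)..L, g t) / L with hm
  have h1 : 0 ≤ ∫ t in (0 : ℝ)..L, (g t - m) ^ 2 :=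
    intervalIntegral.integral_nonneg hL.le fun t _ => sq_nonneg _
  have h2 : ∫ t in (0 : ℝ)..L, (g t - m) ^ 2
      = (∫ t in (0 : ℝ)..L, g t ^ 2) - 2 * m * (∫ t in (0 : ℝ)..L, g t) + L * m ^ 2 := by
    have : ∀ t, (g t - m) ^ 2 = g t ^ 2 - 2 * m * g t + m ^ 2 := fun t => by ring
    simp_rw [this]
    rw [intervalIntegral.integral_add, intervalIntegral.integral_sub,
      intervalIntegral.integral_const_mul]
    · simp
    all_goals exact Continuous.intervalIntegrable (by fun_prop) _ _
  have h3 : (∫ t in (0 : ℝ)..L, g t) = m * L := by rw [hm]; field_simp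
  rw [h2, h3] at h1
  rw [h3]
  nlinarith

section Poincare

variable {d : ℕ}

/-- The quarter circle `cos t • x + sin t • y` joins `x` to `y`. Its point and its velocity are the
two components of a rotation of `(x, y)`, which is what makes this path useful for Gaussian pairs.
-/
lemma sq_sub_le_integral_rotation {h : EuclideanSpace ℝ (Fin d) → ℝ} (hh : ContDiff ℝ 1 h)
    (x y : EuclideanSpace ℝ (Fin d)) :
    (h y - h x) ^ 2 ≤ Real.pi / 2 * ∫ t in (0 : ℝ)..(Real.pi / 2),
      (fderiv ℝ h (Real.cos t • x + Real.sin t • y) (-Real.sin t • x + Real.cos t • y)) ^ 2 := by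
  have hc : Continuous (fun t : ℝ =>
      fderiv ℝ h (Real.cos t • x + Real.sin t • y) (-Real.sin t • x + Real.cos t • y)) := by
    have := hh.continuous_fderiv one_ne_zero
    exact (this.comp (by fun_prop)).clm_apply (by fun_prop)
  have hd : ∀ t : ℝ, HasDerivAt (fun t : ℝ => h (Real.cos t • x + Real.sin t • y))
      (fderiv ℝ h (Real.cos t • x + Real.sin t • y) (-Real.sin t • x + Real.cos t • y)) t := by
    intro t
    have h1 : HasFDerivAt h (fderiv ℝ h (Real.cos t • x + Real.sin t • y))
        (Real.cos t • x + Real.sin t • y) :=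
      (hh.differentiable one_ne_zero _).hasFDerivAt
    have h2 : HasDerivAt (fun t : ℝ => Real.cos t • x + Real.sin t • y)
        (-Real.sin t • x + Real.cos t • y) t :=
      ((Real.hasDerivAt_cos t).smul_const x).add ((Real.hasDerivAt_sin t).smul_const y)
    exact h1.comp_hasDerivAt t h2
  have := intervalIntegral.integral_eq_sub_of_hasDerivAt (a := 0) (b := Real.pi / 2)
    (fun t _ => hd t) (hc.intervalIntegrable _ _)
  have e : h y - h x = ∫ t in (0 : ℝ)..(Real.pi / 2),
      fderiv ℝ h (Real.cos t • x + Real.sin t • y) (-Real.sin t • x + Real.cos t • y) := by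
    rw [this]; simp
  rw [e]
  exact sq_intervalIntegral_le hc (by positivity)

/-- Under the standard Gaussian measure `L` is centered with variance `‖L‖ ^ 2`. -/
lemma lintegral_sq_dual_stdGaussian (L : StrongDual ℝ (EuclideanSpace ℝ (Fin d))) :
    ∫⁻ y, ENNReal.ofReal (L y ^ 2) ∂(stdGaussian (EuclideanSpace ℝ (Fin d)))
      = ENNReal.ofReal (‖L‖ ^ 2) := by
  have h2 : MemLp L 2 (stdGaussian (EuclideanSpace ℝ (Fin d))) :=
    L.comp_memLp' IsGaussian.memLp_two_id
  rw [← variance_dual_stdGaussian L, variance_of_integral_eq_zero h2.aemeasurable (by simp),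
    ofReal_integral_eq_lintegral_ofReal h2.integrable_sq (ae_of_all _ fun _ => sq_nonneg _)]

/-- The Gaussian Poincaré inequality for differences, by Pisier's rotation argument. -/
theorem lintegral_sq_sub_stdGaussian_le {h : EuclideanSpace ℝ (Fin d) → ℝ} (hh : ContDiff ℝ 1 h) :
    ∫⁻ p, ENNReal.ofReal ((h p.2 - h p.1) ^ 2)
        ∂((stdGaussian (EuclideanSpace ℝ (Fin d))).prod (stdGaussian (EuclideanSpace ℝ (Fin d))))
      ≤ ENNReal.ofReal (Real.pi ^ 2 / 4) *
        ∫⁻ x, ENNReal.ofReal (‖fderiv ℝ h x‖ ^ 2)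
          ∂(stdGaussian (EuclideanSpace ℝ (Fin d))) := by
  set γ := stdGaussian (EuclideanSpace ℝ (Fin d))
  have hcd := hh.continuous_fderiv one_ne_zero
  have hpt : ∀ p : EuclideanSpace ℝ (Fin d) × EuclideanSpace ℝ (Fin d),
      ENNReal.ofReal ((h p.2 - h p.1) ^ 2) ≤ ENNReal.ofReal (Real.pi / 2) *
        ∫⁻ t in Set.Ioc 0 (Real.pi / 2), ENNReal.ofReal
          ((fderiv ℝ h (Real.cos t • p.1 + Real.sin t • p.2)
            (-Real.sin t • p.1 + Real.cos t • p.2)) ^ 2) := by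
    intro p
    have hc : Continuous (fun t : ℝ => (fderiv ℝ h (Real.cos t • p.1 + Real.sin t • p.2)
        (-Real.sin t • p.1 + Real.cos t • p.2)) ^ 2) :=
      ((hcd.comp (by fun_prop)).clm_apply (by fun_prop)).pow 2
    rw [← ofReal_integral_eq_lintegral_ofReal
      ((hc.integrableOn_Icc).mono_set Set.Ioc_subset_Icc_self)
      (ae_of_all _ fun _ => sq_nonneg _), ← ENNReal.ofReal_mul (by positivity),
      ← intervalIntegral.integral_of_le (by positivity)]
    exact ENNReal.ofReal_le_ofReal (sq_sub_le_integral_rotation hh p.1 p.2)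
  -- The product of two standard Gaussians is rotation invariant, so position and velocity on the
  -- path are again independent standard Gaussians. Integrating out the velocity leaves the squared
  -- norm of the derivative, for every `t`.
  have hrot : ∀ t : ℝ, ∫⁻ p, ENNReal.ofReal
      ((fderiv ℝ h (Real.cos t • p.1 + Real.sin t • p.2)
            (-Real.sin t • p.1 + Real.cos t • p.2)) ^ 2) ∂(γ.prod γ)
      = ∫⁻ x, ENNReal.ofReal (‖fderiv ℝ h x‖ ^ 2) ∂γ := by
    intro t
    have hc : Continuous (fun p : EuclideanSpace ℝ (Fin d) × EuclideanSpace ℝ (Fin d) =>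
        ENNReal.ofReal ((fderiv ℝ h p.1 p.2) ^ 2)) :=
      ENNReal.continuous_ofReal.comp
        (((hcd.comp continuous_fst).clm_apply continuous_snd).pow 2)
    have hm := IsGaussian.map_rotation_eq_self (μ := γ) (by simp [γ]) t
    calc _ = ∫⁻ p, ENNReal.ofReal ((fderiv ℝ h p.1 p.2) ^ 2)
          ∂((γ.prod γ).map (ContinuousLinearMap.rotation t)) := by
          rw [lintegral_map hc.measurable (by fun_prop)]
          simp [ContinuousLinearMap.rotation_apply]
      _ = ∫⁻ x, ∫⁻ y, ENNReal.ofReal ((fderiv ℝ h x y) ^ 2) ∂γ ∂γ := by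
          rw [hm, lintegral_prod _ hc.measurable.aemeasurable]
      _ = _ := by simp_rw [γ, lintegral_sq_dual_stdGaussian]
  have hjm : Measurable (fun q : (EuclideanSpace ℝ (Fin d) × EuclideanSpace ℝ (Fin d)) × ℝ =>
      ENNReal.ofReal ((fderiv ℝ h (Real.cos q.2 • q.1.1 + Real.sin q.2 • q.1.2)
            (-Real.sin q.2 • q.1.1 + Real.cos q.2 • q.1.2)) ^ 2)) := by
    refine Continuous.measurable ?_
    exact ENNReal.continuous_ofReal.comp
        (((hcd.comp (by fun_prop)).clm_apply (by fun_prop)).pow 2)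
  calc _ ≤ ∫⁻ p, (ENNReal.ofReal (Real.pi / 2) *
        ∫⁻ t in Set.Ioc 0 (Real.pi / 2), ENNReal.ofReal
          ((fderiv ℝ h (Real.cos t • p.1 + Real.sin t • p.2)
            (-Real.sin t • p.1 + Real.cos t • p.2)) ^ 2)) ∂(γ.prod γ) := lintegral_mono hpt
    _ = ENNReal.ofReal (Real.pi / 2) * ∫⁻ t in Set.Ioc 0 (Real.pi / 2), ∫⁻ p, ENNReal.ofReal
          ((fderiv ℝ h (Real.cos t • p.1 + Real.sin t • p.2)
            (-Real.sin t • p.1 + Real.cos t • p.2)) ^ 2) ∂(γ.prod γ) := by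
        rw [lintegral_const_mul' _ _ ENNReal.ofReal_ne_top, lintegral_lintegral_swap]
        exact hjm.aemeasurable
    _ = _ := by
        simp_rw [hrot]
        rw [lintegral_const, Measure.restrict_apply_univ, Real.volume_Ioc, sub_zero, mul_comm (lintegral _ _),
          ← mul_assoc, ← ENNReal.ofReal_mul (by positivity)]
        congr 2
        ring

/-- Two independent copies differ in mean square by twice the variance; this halves the constant `π²
/ 4` in the Poincaré inequality. -/
lemma integral_sq_sub_prod {α : Type*} [MeasurableSpace α] (μ : Measure α)
    [IsProbabilityMeasure μ] {h : α → ℝ} (i1 : Integrable h μ)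
    (i2 : Integrable (fun x => h x ^ 2) μ) :
    Integrable (fun p : α × α => (h p.2 - h p.1) ^ 2) (μ.prod μ) ∧
    ∫ p, (h p.2 - h p.1) ^ 2 ∂(μ.prod μ)
        = 2 * ((∫ x, h x ^ 2 ∂μ) - (∫ x, h x ∂μ) ^ 2) := by
  have j1 : Integrable (fun p : α × α => h p.2 ^ 2) (μ.prod μ) := i2.comp_snd _
  have j2 : Integrable (fun p : α × α => h p.1 ^ 2) (μ.prod μ) := i2.comp_fst _
  have j3 : Integrable (fun p : α × α => h p.1 * h p.2) (μ.prod μ) := i1.mul_prod i1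
  have e : ∀ p : α × α,
      (h p.2 - h p.1) ^ 2 = h p.2 ^ 2 + h p.1 ^ 2 - 2 * (h p.1 * h p.2) := fun p => by ring
  have k1 : ∫ p : α × α, h p.2 ^ 2 ∂(μ.prod μ) = ∫ x, h x ^ 2 ∂μ := by
    simpa using integral_fun_snd (μ := μ) (ν := μ) (fun x => h x ^ 2)
  have k2 : ∫ p : α × α, h p.1 ^ 2 ∂(μ.prod μ) = ∫ x, h x ^ 2 ∂μ := by
    simpa using integral_fun_fst (μ := μ) (ν := μ) (fun x => h x ^ 2)
  simp_rw [e]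
  refine ⟨(j1.add j2).sub (j3.const_mul 2), ?_⟩
  have j12 : Integrable (fun p : α × α => h p.2 ^ 2 + h p.1 ^ 2) (μ.prod μ) := j1.add j2
  rw [integral_sub j12 (j3.const_mul 2), integral_add j1 j2, integral_const_mul,
    k1, k2, integral_prod_mul]
  ring

/-- The Gaussian Poincaré inequality. -/
theorem variance_stdGaussian_le {h : EuclideanSpace ℝ (Fin d) → ℝ} (hh : ContDiff ℝ 1 h)
    (hs : HasCompactSupport h) :
    (∫ x, h x ^ 2 ∂(stdGaussian (EuclideanSpace ℝ (Fin d))))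
        - (∫ x, h x ∂(stdGaussian (EuclideanSpace ℝ (Fin d)))) ^ 2
      ≤ Real.pi ^ 2 / 8 *
        ∫ x, ‖fderiv ℝ h x‖ ^ 2 ∂(stdGaussian (EuclideanSpace ℝ (Fin d))) := by
  have hcd := hh.continuous_fderiv one_ne_zero
  obtain ⟨γ, hγ⟩ : ∃ γ, γ = stdGaussian (EuclideanSpace ℝ (Fin d)) := ⟨_, rfl⟩
  have : IsProbabilityMeasure γ := hγ ▸ inferInstance
  have key := lintegral_sq_sub_stdGaussian_le hh
  rw [← hγ] at key ⊢
  have i1 : Integrable h γ := hh.continuous.integrable_of_hasCompactSupport hs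
  have s2 : HasCompactSupport fun x => h x ^ 2 := by
    simp only [pow_two]
    exact hs.mul_right
  have s3 : HasCompactSupport fun x => ‖fderiv ℝ h x‖ ^ 2 := by
    simp only [pow_two]
    exact (hs.fderiv ℝ).norm.mul_right
  have i2 : Integrable (fun x => h x ^ 2) γ :=
    (hh.continuous.pow 2).integrable_of_hasCompactSupport s2
  have i3 : Integrable (fun x => ‖fderiv ℝ h x‖ ^ 2) γ :=
    (hcd.norm.pow 2).integrable_of_hasCompactSupport s3
  obtain ⟨j, hI⟩ := integral_sq_sub_prod _ i1 i2
  rw [← ofReal_integral_eq_lintegral_ofReal j (ae_of_all _ fun _ => sq_nonneg _),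
    ← ofReal_integral_eq_lintegral_ofReal i3 (ae_of_all _ fun _ => sq_nonneg _),
    ← ENNReal.ofReal_mul (by positivity), hI, ENNReal.ofReal_le_ofReal_iff
      (mul_nonneg (by positivity) (integral_nonneg fun _ => sq_nonneg _))] at key
  linarith

end Poincare

/-! ### Gaussian integrals and the Hellinger bound for the total variation distance -/

section GaussianIntegrals

variable {d : ℕ}

lemma integral_exp_neg_mul_sq_norm {b : ℝ} (hb : 0 < b) :
    ∫ y : EuclideanSpace ℝ (Fin d), Real.exp (-b * ‖y‖ ^ 2) = (Real.pi / b) ^ (d / 2 : ℝ) := by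
  simpa using GaussianFourier.integral_rexp_neg_mul_sq_norm (V := EuclideanSpace ℝ (Fin d)) hb

lemma integrable_exp_neg_mul_sq_norm {b : ℝ} (hb : 0 < b) :
    Integrable fun y : EuclideanSpace ℝ (Fin d) => Real.exp (-b * ‖y‖ ^ 2) := by
  -- The integral of a non-integrable function is 0 by convention, whereas the closed formula is
  -- positive.
  by_contra h
  have h1 := integral_undef h
  rw [integral_exp_neg_mul_sq_norm hb] at h1
  have : 0 < (Real.pi / b) ^ (d / 2 : ℝ) := by positivity
  linarith

lemma rpow_half_le_exp {x : ℝ} (hx : 0 < x) (d : ℕ) :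
    x ^ (d / 2 : ℝ) ≤ Real.exp ((x - 1) / 2 * d) := by
  rw [Real.rpow_def_of_pos hx]
  apply Real.exp_le_exp.2
  have := Real.log_le_sub_one_of_pos hx
  have hd : (0 : ℝ) ≤ d := by positivity
  nlinarith

/-- Used throughout to trade one Gaussian normalization for another at the cost of a factor
exponential in `d`, by `log x ≤ x - 1`. -/
lemma gaussian_ratio_le {b c : ℝ} (hb : 0 < b) (hc : 0 < c) (d : ℕ) :
    (Real.pi / c) ^ (d / 2 : ℝ) ≤ Real.exp ((b / c - 1) / 2 * d) * (Real.pi / b) ^ (d / 2 : ℝ) := by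
  have h : Real.pi / c = b / c * (Real.pi / b) := by field_simp
  rw [h, Real.mul_rpow (by positivity) (by positivity)]
  gcongr
  exact rpow_half_le_exp (by positivity) d

/-- A centered Gaussian weight has at least half of its mass in a ball of squared radius `κ d`. -/
lemma half_le_setIntegral_exp_neg_mul_sq (hd : 0 < d) {b κ : ℝ} (hb : 0 < b) (hκ : 4 ≤ b * κ) :
    (1 / 2) * (Real.pi / b) ^ (d / 2 : ℝ) ≤
      ∫ y in {y : EuclideanSpace ℝ (Fin d) | ‖y‖ ^ 2 ≤ κ * d}, Real.exp (-b * ‖y‖ ^ 2) := by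
  have hms : MeasurableSet {y : EuclideanSpace ℝ (Fin d) | ‖y‖ ^ 2 ≤ κ * d} :=
    measurableSet_le (by fun_prop) (by fun_prop)
  have i1 := integrable_exp_neg_mul_sq_norm (d := d) hb
  have i2 := integrable_exp_neg_mul_sq_norm (d := d) (half_pos hb)
  have hd1 : (1 : ℝ) ≤ d := by exact_mod_cast hd
  -- Outside the ball half of the exponent is at least `bκd/2`, so the subtracted term dominates
  -- there. Its total mass is at most `exp(-bκd/2 + d/2) ≤ exp(-1) ≤ 1/2` of the full mass.
  have key : ∫ y : EuclideanSpace ℝ (Fin d), (Real.exp (-b * ‖y‖ ^ 2)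
        - Real.exp (-(b * κ / 2 * d)) * Real.exp (-(b / 2) * ‖y‖ ^ 2))
      ≤ ∫ y : EuclideanSpace ℝ (Fin d), Set.indicator {y | ‖y‖ ^ 2 ≤ κ * d}
          (fun y => Real.exp (-b * ‖y‖ ^ 2)) y := by
    refine integral_mono (i1.sub (i2.const_mul _)) (i1.indicator hms) fun y => ?_
    by_cases hy : ‖y‖ ^ 2 ≤ κ * d
    · rw [Set.indicator_of_mem (by exact hy)]
      have : 0 < Real.exp (-(b * κ / 2 * d)) * Real.exp (-(b / 2) * ‖y‖ ^ 2) := by positivity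
      linarith
    · rw [Set.indicator_of_notMem (by exact hy), ← Real.exp_add, sub_nonpos, Real.exp_le_exp]
      push Not at hy
      nlinarith
  rw [integral_indicator hms, integral_sub i1 (i2.const_mul _), integral_const_mul,
    integral_exp_neg_mul_sq_norm hb, integral_exp_neg_mul_sq_norm (half_pos hb)] at key
  refine le_trans ?_ key
  have h2 := gaussian_ratio_le hb (half_pos hb) d
  have h3 : Real.exp (-(b * κ / 2 * d)) * (Real.pi / (b / 2)) ^ (d / 2 : ℝ)
      ≤ 1 / 2 * (Real.pi / b) ^ (d / 2 : ℝ) := by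
    calc _ ≤ Real.exp (-(b * κ / 2 * d)) * (Real.exp ((b / (b / 2) - 1) / 2 * d) *
            (Real.pi / b) ^ (d / 2 : ℝ)) := by gcongr
      _ = Real.exp (-(b * κ / 2 * d) + (b / (b / 2) - 1) / 2 * d)
            * (Real.pi / b) ^ (d / 2 : ℝ) := by rw [Real.exp_add]; ring
      _ ≤ _ := by
        gcongr
        have : b / (b / 2) = 2 := by field_simp
        rw [this]
        calc _ ≤ Real.exp (-1) := Real.exp_le_exp.2 (by nlinarith)
          _ ≤ _ := by
            rw [Real.exp_neg]
            rw [one_div]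
            gcongr
            have := Real.add_one_le_exp 1
            linarith
  linarith

/-- The density of the standard Gaussian measure. -/
theorem stdGaussian_eq_withDensity :
    stdGaussian (EuclideanSpace ℝ (Fin d)) = volume.withDensity fun y =>
      ENNReal.ofReal (((2 * Real.pi) ^ (d / 2 : ℝ))⁻¹ * Real.exp (-(1 / 2) * ‖y‖ ^ 2)) := by
  have hc : 0 < (2 * Real.pi) ^ (d / 2 : ℝ) := by positivity
  have hi : Integrable fun y : EuclideanSpace ℝ (Fin d) =>
      ((2 * Real.pi) ^ (d / 2 : ℝ))⁻¹ * Real.exp (-(1 / 2) * ‖y‖ ^ 2) :=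
    (integrable_exp_neg_mul_sq_norm (by norm_num)).const_mul _
  have : IsFiniteMeasure ((volume : Measure (EuclideanSpace ℝ (Fin d))).withDensity fun y =>
      ENNReal.ofReal (((2 * Real.pi) ^ (d / 2 : ℝ))⁻¹ * Real.exp (-(1 / 2) * ‖y‖ ^ 2))) :=
    isFiniteMeasure_withDensity_ofReal hi.2
  apply Measure.ext_of_charFun
  ext t
  rw [charFun_stdGaussian, charFun_apply,
    integral_withDensity_eq_integral_toReal_smul (by fun_prop) (by simp)]
  have h1 := GaussianFourier.integral_cexp_neg_mul_sq_norm_add (V := EuclideanSpace ℝ (Fin d))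
    (b := (1 / 2 : ℂ)) (by norm_num) Complex.I t
  have h2 : ∀ y : EuclideanSpace ℝ (Fin d),
      (ENNReal.ofReal (((2 * Real.pi) ^ (d / 2 : ℝ))⁻¹ * Real.exp (-(1 / 2) * ‖y‖ ^ 2))).toReal •
        Complex.exp (⟪y, t⟫ * Complex.I)
      = ((((2 * Real.pi) ^ (d / 2 : ℝ))⁻¹ : ℝ) : ℂ) *
        Complex.exp (-(1 / 2) * ‖y‖ ^ 2 + Complex.I * ⟪t, y⟫) := by
    intro y
    rw [ENNReal.toReal_ofReal (by positivity), Complex.exp_add, Complex.real_smul,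
      real_inner_comm]
    push_cast
    rw [mul_comm Complex.I]
    ring
  simp_rw [h2]
  rw [integral_const_mul, h1]
  have h3 : (Real.pi / (1 / 2 : ℂ)) ^ ((Module.finrank ℝ (EuclideanSpace ℝ (Fin d)) : ℂ) / 2)
      = (((2 * Real.pi) ^ (d / 2 : ℝ) : ℝ) : ℂ) := by
    rw [Complex.ofReal_cpow (by positivity)]
    simp [mul_comm]
  rw [h3, ← mul_assoc, ← Complex.ofReal_mul, inv_mul_cancel₀ hc.ne', Complex.ofReal_one, one_mul,
    Complex.I_sq]
  congr 1
  ring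

lemma integral_stdGaussian (g : EuclideanSpace ℝ (Fin d) → ℝ) :
    ∫ y, g y ∂(stdGaussian (EuclideanSpace ℝ (Fin d)))
      = ((2 * Real.pi) ^ (d / 2 : ℝ))⁻¹ * ∫ y, Real.exp (-(1 / 2) * ‖y‖ ^ 2) * g y := by
  rw [stdGaussian_eq_withDensity,
    integral_withDensity_eq_integral_toReal_smul (by fun_prop) (by simp), ← integral_const_mul]
  congr 1
  ext y
  rw [ENNReal.toReal_ofReal (by positivity), smul_eq_mul]
  ring

lemma setIntegral_stdGaussian (g : EuclideanSpace ℝ (Fin d) → ℝ)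
    {A : Set (EuclideanSpace ℝ (Fin d))} (hA : MeasurableSet A) :
    ∫ y in A, g y ∂(stdGaussian (EuclideanSpace ℝ (Fin d)))
      = ((2 * Real.pi) ^ (d / 2 : ℝ))⁻¹ * ∫ y in A, Real.exp (-(1 / 2) * ‖y‖ ^ 2) * g y := by
  rw [← integral_indicator hA, integral_stdGaussian, ← integral_indicator hA]
  congr 2
  ext y
  by_cases hy : y ∈ A <;> simp [hy]

end GaussianIntegrals

section Hellinger

variable {α : Type*} [MeasurableSpace α]

/-- The quadratic polynomial `∫ (t f + g)²` in `t` is nonnegative, so its discriminant is at most 0.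
-/
lemma sq_integral_mul_le {μ : Measure α} {f g : α → ℝ} (hf : Integrable (fun x => f x ^ 2) μ)
    (hg : Integrable (fun x => g x ^ 2) μ) (hfg : Integrable (fun x => f x * g x) μ) :
    (∫ x, f x * g x ∂μ) ^ 2 ≤ (∫ x, f x ^ 2 ∂μ) * ∫ x, g x ^ 2 ∂μ := by
  have h : ∀ t : ℝ, 0 ≤ (∫ x, f x ^ 2 ∂μ) * (t * t) + (2 * ∫ x, f x * g x ∂μ) * t
      + ∫ x, g x ^ 2 ∂μ := by
    intro t
    have h1 : 0 ≤ ∫ x, (t * f x + g x) ^ 2 ∂μ := integral_nonneg fun _ => sq_nonneg _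
    have e : ∀ x, (t * f x + g x) ^ 2 = (t * t) * f x ^ 2 + (2 * t) * (f x * g x) + g x ^ 2 :=
      fun x => by ring
    simp_rw [e] at h1
    have i1 : Integrable (fun x => (t * t) * f x ^ 2 + (2 * t) * (f x * g x)) μ :=
      (hf.const_mul _).add (hfg.const_mul _)
    rw [integral_add i1 hg, integral_add (hf.const_mul _) (hfg.const_mul _), integral_const_mul,
      integral_const_mul] at h1
    linarith
  have := discrim_le_zero h
  rw [discrim] at this
  linarith

/-- If `h²` is a density up to the constant `∫ h²`, then the total variation distance to the base
measure is controlled by the relative variance of `h`. -/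
theorem abs_setIntegral_sq_div_sub_le (γ : Measure α) [IsProbabilityMeasure γ] {h : α → ℝ}
    (i1 : Integrable h γ) (i2 : Integrable (fun x => h x ^ 2) γ) (hN : 0 < ∫ x, h x ^ 2 ∂γ)
    (A : Set α) :
    |(∫ x in A, h x ^ 2 ∂γ) / (∫ x, h x ^ 2 ∂γ) - γ.real A| ≤
      2 * √(((∫ x, h x ^ 2 ∂γ) - (∫ x, h x ∂γ) ^ 2) / ∫ x, h x ^ 2 ∂γ) := by
  set N := ∫ x, h x ^ 2 ∂γ with hNdef
  set m := ∫ x, h x ∂γ with hm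
  set r := √N with hr
  have hr0 : 0 < r := Real.sqrt_pos.2 hN
  have hr2 : r ^ 2 = N := Real.sq_sqrt hN.le
  have em : ∀ x, (h x - r) ^ 2 = h x ^ 2 - 2 * r * h x + r ^ 2 := fun x => by ring
  have ep : ∀ x, (h x + r) ^ 2 = h x ^ 2 + 2 * r * h x + r ^ 2 := fun x => by ring
  have e1 : ∀ x, (h x - r) * (h x + r) = h x ^ 2 - r ^ 2 := fun x => by ring
  have j1 : Integrable (fun x => h x ^ 2 - 2 * r * h x) γ := i2.sub (i1.const_mul _)
  have j2 : Integrable (fun x => h x ^ 2 + 2 * r * h x) γ := i2.add (i1.const_mul _)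
  have im : Integrable (fun x => (h x - r) ^ 2) γ := by
    simp_rw [em]; exact j1.add (integrable_const _)
  have ip : Integrable (fun x => (h x + r) ^ 2) γ := by
    simp_rw [ep]; exact j2.add (integrable_const _)
  have i11 : Integrable (fun x => (h x - r) * (h x + r)) γ := by
    simp_rw [e1]; exact i2.sub (integrable_const _)
  -- Here `h² - N = (h - r)(h + r)` with `r = √N`. The full integrals of `(h ∓ r)²` are `2r(r ∓ m)`,
  -- and their product is `4N(N - m²)`, that is `4N` times the variance.
  have cs := sq_integral_mul_le im.integrableOn ip.integrableOn (i11.integrableOn (s := A))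
  have bm : ∫ x in A, (h x - r) ^ 2 ∂γ ≤ 2 * r * (r - m) := by
    refine (setIntegral_le_integral im (ae_of_all _ fun _ => sq_nonneg _)).trans (le_of_eq ?_)
    simp_rw [em]
    rw [integral_add j1 (integrable_const _), integral_sub i2 (i1.const_mul _),
      integral_const_mul, ← hNdef, ← hm, ← hr2]
    simp
    ring
  have bp : ∫ x in A, (h x + r) ^ 2 ∂γ ≤ 2 * r * (r + m) := by
    refine (setIntegral_le_integral ip (ae_of_all _ fun _ => sq_nonneg _)).trans (le_of_eq ?_)
    simp_rw [ep]
    rw [integral_add j2 (integrable_const _), integral_add i2 (i1.const_mul _),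
      integral_const_mul, ← hNdef, ← hm, ← hr2]
    simp
    ring
  have e2 : ∫ x in A, (h x - r) * (h x + r) ∂γ = (∫ x in A, h x ^ 2 ∂γ) - N * γ.real A := by
    simp_rw [e1]
    rw [integral_sub i2.integrableOn (integrable_const _), hr2]
    simp [mul_comm]
  have n1 : 0 ≤ ∫ x in A, (h x - r) ^ 2 ∂γ := integral_nonneg fun _ => sq_nonneg _
  have n2 : 0 ≤ ∫ x in A, (h x + r) ^ 2 ∂γ := integral_nonneg fun _ => sq_nonneg _
  rw [e2] at cs
  have cs2 : ((∫ x in A, h x ^ 2 ∂γ) - N * γ.real A) ^ 2 ≤ 4 * N * (N - m ^ 2) := by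
    calc _ ≤ _ := cs
      _ ≤ (2 * r * (r - m)) * (2 * r * (r + m)) := mul_le_mul bm bp n2 (n1.trans bm)
      _ = _ := by rw [← hr2]; ring
  have e3 : (∫ x in A, h x ^ 2 ∂γ) / N - γ.real A
      = ((∫ x in A, h x ^ 2 ∂γ) - N * γ.real A) / N := by field_simp
  rw [e3]
  apply abs_le_of_sq_le_sq _ (by positivity)
  have hv : 0 ≤ (N - m ^ 2) / N := by
    have : 0 ≤ 4 * N * (N - m ^ 2) := (sq_nonneg _).trans cs2
    have := nonneg_of_mul_nonneg_right this (by positivity)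
    positivity
  rw [mul_pow, Real.sq_sqrt hv, div_pow, div_le_iff₀ (by positivity)]
  calc _ ≤ _ := cs2
    _ = _ := by field_simp; ring

end Hellinger

/-! ### Comparison of a nearly Gaussian weight with the standard Gaussian measure -/

section Cutoff

/-- Smooth radial cutoff functions with a gradient bound that is uniform in the dimension. -/
lemma exists_cutoff : ∃ K : ℝ, 0 < K ∧ ∀ (d : ℕ) (R : ℝ), 0 < R →
    ∃ χ : EuclideanSpace ℝ (Fin d) → ℝ, ContDiff ℝ 1 χ ∧ (∀ y, 0 ≤ χ y) ∧ (∀ y, χ y ≤ 1) ∧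
      (∀ y, ‖y‖ ^ 2 ≤ R ^ 2 / 2 → χ y = 1) ∧ (∀ y, 3 / 4 * R ^ 2 ≤ ‖y‖ ^ 2 → χ y = 0) ∧
      (∀ y, ‖fderiv ℝ χ y‖ ≤ K / R) ∧ (∀ y, ‖y‖ ^ 2 < R ^ 2 / 2 → fderiv ℝ χ y = 0) := by
  have hη : ContDiff ℝ 1 Real.smoothTransition := Real.smoothTransition.contDiff
  -- For `‖y‖ ≤ R` the argument `3 - 4‖y‖²/R²` of the transition function stays in `[-1, 3]`; its
  -- gradient there has norm at most `8/R`, whence the factor 8 below.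
  obtain ⟨K, hK⟩ := (isCompact_Icc (a := (-1 : ℝ)) (b := 3)).exists_bound_of_continuousOn
    (hη.continuous_deriv le_rfl).continuousOn
  refine ⟨8 * (|K| + 1), by positivity, fun d R hR => ?_⟩
  set χ : EuclideanSpace ℝ (Fin d) → ℝ :=
    fun y => Real.smoothTransition (3 - 4 / R ^ 2 * ‖y‖ ^ 2) with hχ
  have hcont : ContDiff ℝ 1 χ :=
    hη.comp (contDiff_const.sub (contDiff_const.mul (contDiff_norm_sq ℝ)))
  have h1 : ∀ y, ‖y‖ ^ 2 ≤ R ^ 2 / 2 → χ y = 1 := fun y hy => by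
    apply Real.smoothTransition.one_of_one_le
    have : 4 / R ^ 2 * ‖y‖ ^ 2 ≤ 4 / R ^ 2 * (R ^ 2 / 2) := by gcongr
    have e : 4 / R ^ 2 * (R ^ 2 / 2) = 2 := by field_simp; norm_num
    linarith
  have h0 : ∀ y, 3 / 4 * R ^ 2 ≤ ‖y‖ ^ 2 → χ y = 0 := fun y hy => by
    apply Real.smoothTransition.zero_of_nonpos
    have : 4 / R ^ 2 * (3 / 4 * R ^ 2) ≤ 4 / R ^ 2 * ‖y‖ ^ 2 := by gcongr
    have e : 4 / R ^ 2 * (3 / 4 * R ^ 2) = 3 := by field_simp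
    linarith
  refine ⟨χ, hcont, fun y => Real.smoothTransition.nonneg _,
    fun y => Real.smoothTransition.le_one _, h1, h0, fun y => ?_, fun y hy => ?_⟩
  · by_cases hy : ‖y‖ ^ 2 ≤ R ^ 2
    · have b2 : ‖y‖ ≤ R := (sq_le_sq₀ (norm_nonneg y) hR.le).1 hy
      have hd : HasFDerivAt χ (deriv Real.smoothTransition (3 - 4 / R ^ 2 * ‖y‖ ^ 2) •
          (-((4 / R ^ 2) • ((2 : ℕ) • innerSL ℝ y)) : EuclideanSpace ℝ (Fin d) →L[ℝ] ℝ)) y := by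
        have e1 := (hη.differentiable one_ne_zero (3 - 4 / R ^ 2 * ‖y‖ ^ 2)).hasDerivAt
        have e2 := ((hasStrictFDerivAt_norm_sq y).hasFDerivAt.const_mul (4 / R ^ 2)).const_sub 3
        exact e1.comp_hasFDerivAt y e2
      rw [hd.fderiv, norm_smul, norm_neg, norm_smul, ← Nat.cast_smul_eq_nsmul ℝ, norm_smul,
        innerSL_apply_norm]
      have b1 : ‖deriv Real.smoothTransition (3 - 4 / R ^ 2 * ‖y‖ ^ 2)‖ ≤ |K| + 1 := by
        refine (hK _ ⟨?_, ?_⟩).trans (by linarith [le_abs_self K])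
        · have : 4 / R ^ 2 * ‖y‖ ^ 2 ≤ 4 / R ^ 2 * (R ^ 2) := by gcongr
          have e : 4 / R ^ 2 * (R ^ 2) = 4 := by field_simp
          linarith
        · have : 0 ≤ 4 / R ^ 2 * ‖y‖ ^ 2 := by positivity
          linarith
      calc _ ≤ (|K| + 1) * (4 / R ^ 2 * (2 * R)) := by
            simp only [Nat.cast_ofNat, Real.norm_ofNat, norm_div, norm_pow]
            rw [Real.norm_of_nonneg hR.le]
            gcongr
        _ = _ := by field_simp; norm_num
    · push Not at hy
      have : χ =ᶠ[nhds y] fun _ => 0 := by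
        have : ∀ᶠ z in nhds y, R ^ 2 < ‖z‖ ^ 2 :=
          continuousAt_const.eventually_lt (by fun_prop) hy
        filter_upwards [this] with z hz
        exact h0 z (by nlinarith)
      rw [this.fderiv_eq]
      simp
      positivity
  · have : χ =ᶠ[nhds y] fun _ => 1 := by
      have : ∀ᶠ z in nhds y, ‖z‖ ^ 2 < R ^ 2 / 2 :=
        ContinuousAt.eventually_lt (by fun_prop) continuousAt_const hy
      filter_upwards [this] with z hz
      exact h1 z hz.le
    rw [this.fderiv_eq]
    simp

variable {d : ℕ}

open Classical in
/-- The function `exp (f / 2)` on the ball of radius `R`, multiplied by the cutoff `χ`. -/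
noncomputable def cutoffExp (f χ : EuclideanSpace ℝ (Fin d) → ℝ) (R : ℝ)
    (y : EuclideanSpace ℝ (Fin d)) : ℝ :=
  if y ∈ Metric.ball (0 : EuclideanSpace ℝ (Fin d)) R then Real.exp (f y / 2) * χ y else 0

variable {f χ : EuclideanSpace ℝ (Fin d) → ℝ} {R : ℝ}

/-- The cutoff already vanishes where `‖y‖² ≥ 3R²/4`, so the truncation in `cutoffExp` creates no
jump on the sphere of radius `R`. -/
lemma cutoffExp_eventuallyEq_zero (hR : 0 < R)
    (h0 : ∀ y, 3 / 4 * R ^ 2 ≤ ‖y‖ ^ 2 → χ y = 0) {y : EuclideanSpace ℝ (Fin d)}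
    (hy : y ∉ Metric.ball (0 : EuclideanSpace ℝ (Fin d)) R) :
    cutoffExp f χ R =ᶠ[nhds y] fun _ => 0 := by
  have h1 : 3 / 4 * R ^ 2 < ‖y‖ ^ 2 := by
    simp at hy
    nlinarith
  have : ∀ᶠ z in nhds y, 3 / 4 * R ^ 2 < ‖z‖ ^ 2 :=
    continuousAt_const.eventually_lt (by fun_prop) h1
  filter_upwards [this] with z hz
  simp [cutoffExp, h0 z hz.le]

lemma cutoffExp_eventuallyEq {y : EuclideanSpace ℝ (Fin d)}
    (hy : y ∈ Metric.ball (0 : EuclideanSpace ℝ (Fin d)) R) :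
    cutoffExp f χ R =ᶠ[nhds y] fun z => Real.exp (f z / 2) * χ z := by
  filter_upwards [Metric.isOpen_ball.mem_nhds hy] with z hz
  rw [cutoffExp, if_pos hz]

lemma contDiff_cutoffExp (hR : 0 < R) (hχ : ContDiff ℝ 1 χ)
    (h0 : ∀ y, 3 / 4 * R ^ 2 ≤ ‖y‖ ^ 2 → χ y = 0)
    (hf : ContDiffOn ℝ 1 f (Metric.ball 0 R)) : ContDiff ℝ 1 (cutoffExp f χ R) := by
  rw [contDiff_iff_contDiffAt]
  intro y
  by_cases hy : y ∈ Metric.ball (0 : EuclideanSpace ℝ (Fin d)) R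
  · refine ContDiffAt.congr_of_eventuallyEq ?_ (cutoffExp_eventuallyEq hy)
    have hfy : ContDiffAt ℝ 1 f y := hf.contDiffAt (Metric.isOpen_ball.mem_nhds hy)
    exact ((hfy.div_const 2).exp).mul hχ.contDiffAt
  · exact contDiffAt_const.congr_of_eventuallyEq (cutoffExp_eventuallyEq_zero hR h0 hy)

lemma hasCompactSupport_cutoffExp :
    HasCompactSupport (cutoffExp f χ R) := by
  refine HasCompactSupport.intro (isCompact_closedBall 0 R) fun y hy => ?_
  rw [cutoffExp, if_neg]
  exact fun h => hy (Metric.ball_subset_closedBall h)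

/-- Product rule for `exp(f/2) χ`, followed by `(u + v)² ≤ 2u² + 2v²`. -/
lemma norm_fderiv_cutoffExp_sq_le (hχ : ContDiff ℝ 1 χ)
    (hf : ContDiffOn ℝ 1 f (Metric.ball 0 R)) {y : EuclideanSpace ℝ (Fin d)}
    (hy : y ∈ Metric.ball (0 : EuclideanSpace ℝ (Fin d)) R) :
    ‖fderiv ℝ (cutoffExp f χ R) y‖ ^ 2 ≤
      Real.exp (f y) * (‖fderiv ℝ f y‖ ^ 2 / 2 * χ y ^ 2 + 2 * ‖fderiv ℝ χ y‖ ^ 2) := by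
  have hfy : DifferentiableAt ℝ f y :=
    (hf.contDiffAt (Metric.isOpen_ball.mem_nhds hy)).differentiableAt one_ne_zero
  have hd : HasFDerivAt (fun z => Real.exp (f z / 2) * χ z)
      (Real.exp (f y / 2) • fderiv ℝ χ y +
        χ y • (Real.exp (f y / 2) • ((2 : ℝ)⁻¹ • fderiv ℝ f y))) y := by
    have h1 : HasFDerivAt (fun z => f z / 2) ((2 : ℝ)⁻¹ • fderiv ℝ f y) y := by
      simpa [div_eq_inv_mul] using hfy.hasFDerivAt.const_mul (2 : ℝ)⁻¹
    exact h1.exp.mul (hχ.differentiable one_ne_zero y).hasFDerivAt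
  rw [(cutoffExp_eventuallyEq hy).fderiv_eq, hd.fderiv]
  have hn : ‖Real.exp (f y / 2) • fderiv ℝ χ y +
        χ y • (Real.exp (f y / 2) • ((2 : ℝ)⁻¹ • fderiv ℝ f y))‖
      ≤ Real.exp (f y / 2) * (‖fderiv ℝ χ y‖ + |χ y| * ‖fderiv ℝ f y‖ / 2) := by
    refine (norm_add_le _ _).trans (le_of_eq ?_)
    simp only [norm_smul, Real.norm_eq_abs, abs_inv, Real.abs_exp, Nat.abs_ofNat]
    ring
  have he : Real.exp (f y / 2) ^ 2 = Real.exp (f y) := by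
    rw [← Real.exp_nat_mul]
    congr 1
    push_cast
    ring
  calc _ ≤ (Real.exp (f y / 2) * (‖fderiv ℝ χ y‖ + |χ y| * ‖fderiv ℝ f y‖ / 2)) ^ 2 := by gcongr
    _ = Real.exp (f y) * (‖fderiv ℝ χ y‖ + |χ y| * ‖fderiv ℝ f y‖ / 2) ^ 2 := by
      rw [mul_pow, he]
    _ ≤ _ := by
      gcongr
      have := sq_nonneg (‖fderiv ℝ χ y‖ - |χ y| * ‖fderiv ℝ f y‖ / 2)
      have h2 : |χ y| ^ 2 = χ y ^ 2 := sq_abs _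
      nlinarith

end Cutoff

/-! ### Mass, second moment and annulus bounds for nearly Gaussian weights. -/

section NearlyGaussian

variable {d : ℕ}

/-- The weight `W` is of the form `exp (f - |y|² / 2)` on the ball of radius `s √d / 2`, with a
small Lipschitz perturbation `f`. -/
structure NearlyGaussian (s a ε : ℝ) (f W : EuclideanSpace ℝ (Fin d) → ℝ) : Prop where
  dim_pos : 0 < d
  s_ge : 12 ≤ s
  a_nonneg : 0 ≤ a
  a_le : a ≤ 1 / 100
  ε_nonneg : 0 ≤ ε
  ε_le : ε * √d ≤ 1 / 100
  contDiffOn : ContDiffOn ℝ 1 f (Metric.ball 0 (s * √d / 2))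
  map_zero : f 0 = 0
  norm_fderiv_le : ∀ y ∈ Metric.ball (0 : EuclideanSpace ℝ (Fin d)) (s * √d / 2),
    ‖fderiv ℝ f y‖ ≤ a + ε * ‖y‖
  eq_exp : ∀ y ∈ Metric.ball (0 : EuclideanSpace ℝ (Fin d)) (s * √d / 2),
    W y = Real.exp (f y - ‖y‖ ^ 2 / 2)
  nonneg : ∀ y, 0 ≤ W y
  integrable : Integrable W

namespace NearlyGaussian

variable {s a ε : ℝ} {f W : EuclideanSpace ℝ (Fin d) → ℝ}

lemma radius_pos (H : NearlyGaussian s a ε f W) : 0 < s * √d / 2 := by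
  have := H.dim_pos
  have := H.s_ge
  have : 0 < √(d : ℝ) := Real.sqrt_pos.2 (by exact_mod_cast H.dim_pos)
  positivity

lemma one_le_dim (H : NearlyGaussian s a ε f W) : (1 : ℝ) ≤ d := by
  exact_mod_cast H.dim_pos

lemma radius_sq (s : ℝ) (d : ℕ) : (s * √d / 2) ^ 2 = s ^ 2 * d / 4 := by
  rw [div_pow, mul_pow, Real.sq_sqrt (by positivity)]
  norm_num

/-- The mean value inequality on the ball of radius `‖y‖` gives `|f y| ≤ (a + ε‖y‖)‖y‖`; then `‖y‖ ≤
(1 + ‖y‖²)/2` and `1 ≤ d`. Hence `W` lies between multiples of the Gaussian weights with exponents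
`97/200` and `103/200`. -/
lemma abs_le (H : NearlyGaussian s a ε f W) {y : EuclideanSpace ℝ (Fin d)}
    (hy : y ∈ Metric.ball (0 : EuclideanSpace ℝ (Fin d)) (s * √d / 2)) :
    |f y| ≤ d / 200 + 3 / 200 * ‖y‖ ^ 2 := by
  have hsub : Metric.closedBall (0 : EuclideanSpace ℝ (Fin d)) ‖y‖ ⊆
      Metric.ball 0 (s * √d / 2) := Metric.closedBall_subset_ball (by simpa using hy)
  have h1 := Convex.norm_image_sub_le_of_norm_fderiv_le (𝕜 := ℝ) (f := f) (C := a + ε * ‖y‖)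
    (s := Metric.closedBall 0 ‖y‖) (x := 0) (y := y)
    (fun x hx => (H.contDiffOn.contDiffAt
      (Metric.isOpen_ball.mem_nhds (hsub hx))).differentiableAt one_ne_zero)
    (fun x hx => (H.norm_fderiv_le x (hsub hx)).trans (by
      have := H.ε_nonneg
      have hx' : ‖x‖ ≤ ‖y‖ := by simpa using hx
      gcongr)) (convex_closedBall _ _) (by simp) (by simp)
  rw [H.map_zero, sub_zero, sub_zero, Real.norm_eq_abs] at h1
  have hε : ε ≤ 1 / 100 := by
    have : (1 : ℝ) ≤ √d := Real.one_le_sqrt.2 H.one_le_dim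
    have h2 := H.ε_le
    nlinarith [H.ε_nonneg]
  have h3 : ε * ‖y‖ ^ 2 ≤ 1 / 100 * ‖y‖ ^ 2 := by gcongr
  have h4 : a * ‖y‖ ≤ 1 / 100 * ‖y‖ := by
    gcongr
    exact H.a_le
  nlinarith [sq_nonneg (‖y‖ - 1), H.one_le_dim]

lemma le_exp (H : NearlyGaussian s a ε f W) {y : EuclideanSpace ℝ (Fin d)}
    (hy : y ∈ Metric.ball (0 : EuclideanSpace ℝ (Fin d)) (s * √d / 2)) :
    W y ≤ Real.exp (d / 200) * Real.exp (-(97 / 200) * ‖y‖ ^ 2) := by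
  rw [H.eq_exp y hy, ← Real.exp_add, Real.exp_le_exp]
  have := (_root_.abs_le.1 (H.abs_le hy)).2
  linarith

lemma exp_le (H : NearlyGaussian s a ε f W) {y : EuclideanSpace ℝ (Fin d)}
    (hy : y ∈ Metric.ball (0 : EuclideanSpace ℝ (Fin d)) (s * √d / 2)) :
    Real.exp (-(d / 200)) * Real.exp (-(103 / 200) * ‖y‖ ^ 2) ≤ W y := by
  rw [H.eq_exp y hy, ← Real.exp_add, Real.exp_le_exp]
  have := (_root_.abs_le.1 (H.abs_le hy)).1
  linarith

end NearlyGaussian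

/-- A lower bound for the mass of a nearly Gaussian weight. -/
noncomputable def nearlyGaussianMass (d : ℕ) : ℝ :=
  1 / 2 * Real.exp (-(d / 200)) * (Real.pi / (103 / 200)) ^ (d / 2 : ℝ)

lemma nearlyGaussianMass_pos (d : ℕ) : 0 < nearlyGaussianMass d := by
  unfold nearlyGaussianMass
  positivity

/-- Every error mass is measured against `nearlyGaussianMass`. The rate `71/100` collects the two
factors `exp(d/200)` and the factor `2 ≤ exp(7d/10)`. -/
lemma exp_mul_integral_le_nearlyGaussianMass (hd : (1 : ℝ) ≤ d) {c : ℝ} (hc : 0 < c) :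
    Real.exp (d / 200) * (Real.pi / c) ^ (d / 2 : ℝ) ≤
      Real.exp (((103 / 200 / c - 1) / 2 + 71 / 100) * d) * nearlyGaussianMass d := by
  have h1 := gaussian_ratio_le (b := 103 / 200) (by norm_num) hc d
  have h2 : (2 : ℝ) ≤ Real.exp (7 / 10 * d) := by
    have : Real.log 2 ≤ 7 / 10 * d := by linarith [Real.log_two_lt_d9]
    exact (Real.log_le_iff_le_exp (by norm_num)).1 this
  calc _ ≤ Real.exp (d / 200) * (Real.exp ((103 / 200 / c - 1) / 2 * d) *
        (Real.pi / (103 / 200)) ^ (d / 2 : ℝ)) := by gcongr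
    _ = Real.exp (d / 200 + (103 / 200 / c - 1) / 2 * d + d / 200) *
        (Real.exp (-(d / 200)) * (Real.pi / (103 / 200)) ^ (d / 2 : ℝ)) := by
      rw [Real.exp_add, Real.exp_add, Real.exp_neg]
      field_simp
    _ = Real.exp (d / 200 + (103 / 200 / c - 1) / 2 * d + d / 200) *
        (2 * nearlyGaussianMass d) := by unfold nearlyGaussianMass; ring
    _ ≤ Real.exp (d / 200 + (103 / 200 / c - 1) / 2 * d + d / 200) *
        (Real.exp (7 / 10 * d) * nearlyGaussianMass d) := by
      have := nearlyGaussianMass_pos d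
      gcongr
    _ = _ := by
      rw [← mul_assoc, ← Real.exp_add]
      congr 2
      ring

namespace NearlyGaussian

variable {s a ε : ℝ} {f W χ : EuclideanSpace ℝ (Fin d) → ℝ}

/-- The ball `‖y‖² ≤ 8d` suffices: it lies where `χ = 1`, since `s²d/8 ≥ 18d`, and it carries half
of the Gaussian mass, since `8 · 103/200 ≥ 4`. -/
lemma mass_le (H : NearlyGaussian s a ε f W) (hχm : Measurable χ) (hχ0 : ∀ y, 0 ≤ χ y)
    (hχ1 : ∀ y, χ y ≤ 1)
    (hχ : ∀ y, ‖y‖ ^ 2 ≤ (s * √d / 2) ^ 2 / 2 → χ y = 1) :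
    nearlyGaussianMass d ≤ ∫ y, W y * χ y ^ 2 := by
  have hms : MeasurableSet {y : EuclideanSpace ℝ (Fin d) | ‖y‖ ^ 2 ≤ 8 * d} :=
    measurableSet_le (by fun_prop) (by fun_prop)
  have h1 := half_le_setIntegral_exp_neg_mul_sq H.dim_pos (b := 103 / 200) (κ := 8)
    (by norm_num) (by norm_num)
  have hint : Integrable fun y => W y * χ y ^ 2 :=
    H.integrable.mul_bdd (c := 1) (by fun_prop) (ae_of_all _ fun y => by
      rw [Real.norm_of_nonneg (by positivity)]
      exact pow_le_one₀ (hχ0 y) (hχ1 y))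
  calc nearlyGaussianMass d ≤ Real.exp (-(d / 200)) *
        ∫ y in {y : EuclideanSpace ℝ (Fin d) | ‖y‖ ^ 2 ≤ 8 * d},
          Real.exp (-(103 / 200) * ‖y‖ ^ 2) := by
        unfold nearlyGaussianMass
        calc _ = Real.exp (-(d / 200)) * (1 / 2 * (Real.pi / (103 / 200)) ^ (d / 2 : ℝ)) := by ring
          _ ≤ _ := by gcongr
    _ = ∫ y in {y : EuclideanSpace ℝ (Fin d) | ‖y‖ ^ 2 ≤ 8 * d},
          Real.exp (-(d / 200)) * Real.exp (-(103 / 200) * ‖y‖ ^ 2) := by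
        rw [integral_const_mul]
    _ ≤ ∫ y in {y : EuclideanSpace ℝ (Fin d) | ‖y‖ ^ 2 ≤ 8 * d}, W y * χ y ^ 2 := by
        refine setIntegral_mono_on
          ((integrable_exp_neg_mul_sq_norm (by norm_num)).const_mul _).integrableOn
          hint.integrableOn hms fun y hy => ?_
        have hy' : ‖y‖ ^ 2 ≤ 8 * d := hy
        have hs : 144 ≤ s ^ 2 := by nlinarith [H.s_ge]
        have hd := H.one_le_dim
        have h2 := radius_sq s d
        have h3 : ‖y‖ ^ 2 ≤ (s * √d / 2) ^ 2 / 2 := by rw [h2]; nlinarith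
        have h4 : y ∈ Metric.ball (0 : EuclideanSpace ℝ (Fin d)) (s * √d / 2) := by
          rw [mem_ball_zero_iff]
          apply lt_of_pow_lt_pow_left₀ 2 H.radius_pos.le
          have := sq_pos_of_pos H.radius_pos
          linarith
        rw [hχ y h3, one_pow, mul_one]
        exact H.exp_le h4
    _ ≤ _ := setIntegral_le_integral hint
        (ae_of_all _ fun y => mul_nonneg (H.nonneg y) (sq_nonneg _))

/-- Integrates the elementary inequality `x ≤ d + exp(x - d)` at `x = ‖y‖²/8`. The exponential
lowers the Gaussian exponent from `97/200` to `9/25`, and the factor `exp(-d)` pays for the larger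
normalization. The result is `8(d + 1) ≤ 16d`. -/
lemma second_moment_le (H : NearlyGaussian s a ε f W) (hχm : Measurable χ) (hχ0 : ∀ y, 0 ≤ χ y)
    (hχ1 : ∀ y, χ y ≤ 1) (hχ : ∀ y, ‖y‖ ^ 2 ≤ (s * √d / 2) ^ 2 / 2 → χ y = 1)
    (hχs : ∀ y, 3 / 4 * (s * √d / 2) ^ 2 ≤ ‖y‖ ^ 2 → χ y = 0) :
    Integrable (fun y => ‖y‖ ^ 2 * (W y * χ y ^ 2)) ∧
    ∫ y, ‖y‖ ^ 2 * (W y * χ y ^ 2) ≤ 16 * d * ∫ y, W y * χ y ^ 2 := by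
  have hd := H.one_le_dim
  have hmass := H.mass_le hχm hχ0 hχ1 hχ
  have hint : Integrable fun y => W y * χ y ^ 2 :=
    H.integrable.mul_bdd (c := 1) (by fun_prop) (ae_of_all _ fun y => by
      rw [Real.norm_of_nonneg (by positivity)]
      exact pow_le_one₀ (hχ0 y) (hχ1 y))
  have hnn : ∀ y, 0 ≤ W y * χ y ^ 2 := fun y => mul_nonneg (H.nonneg y) (sq_nonneg _)
  have hb : ∀ y, ‖y‖ ^ 2 * (W y * χ y ^ 2) ≤ 8 * (d * (W y * χ y ^ 2) +
      Real.exp (-d) * (Real.exp (d / 200) * Real.exp (-(9 / 25) * ‖y‖ ^ 2))) := by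
    intro y
    have hx : ‖y‖ ^ 2 / 8 ≤ d + Real.exp (-d) * Real.exp (‖y‖ ^ 2 / 8) := by
      rw [← Real.exp_add]
      have := Real.add_one_le_exp (-d + ‖y‖ ^ 2 / 8)
      linarith
    have hw : Real.exp (‖y‖ ^ 2 / 8) * (W y * χ y ^ 2) ≤
        Real.exp (d / 200) * Real.exp (-(9 / 25) * ‖y‖ ^ 2) := by
      by_cases hy : y ∈ Metric.ball (0 : EuclideanSpace ℝ (Fin d)) (s * √d / 2)
      · have h1 : W y * χ y ^ 2 ≤ W y :=
          mul_le_of_le_one_right (H.nonneg y) (pow_le_one₀ (hχ0 y) (hχ1 y))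
        calc _ ≤ Real.exp (‖y‖ ^ 2 / 8) *
              (Real.exp (d / 200) * Real.exp (-(97 / 200) * ‖y‖ ^ 2)) := by
              exact mul_le_mul_of_nonneg_left (h1.trans (H.le_exp hy)) (Real.exp_pos _).le
          _ = _ := by
              rw [← Real.exp_add, ← Real.exp_add, ← Real.exp_add]
              congr 1
              ring
      · rw [hχs y]
        · simp only [ne_eq, OfNat.ofNat_ne_zero, not_false_eq_true, zero_pow, mul_zero]
          positivity
        · have := H.radius_pos
          simp only [mem_ball_zero_iff, not_lt] at hy
          nlinarith
    have h2 := mul_le_mul_of_nonneg_right hx (hnn y)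
    have h3 := mul_le_mul_of_nonneg_left hw (Real.exp_pos (-(d : ℝ))).le
    linarith
  have ig := ((integrable_exp_neg_mul_sq_norm (d := d) (b := 9 / 25) (by norm_num)).const_mul
    (Real.exp (d / 200))).const_mul (Real.exp (-(d : ℝ)))
  have iR : Integrable fun y => 8 * (d * (W y * χ y ^ 2) +
      Real.exp (-d) * (Real.exp (d / 200) * Real.exp (-(9 / 25) * ‖y‖ ^ 2))) :=
    ((hint.const_mul _).add ig).const_mul _
  have iL : Integrable (fun y => ‖y‖ ^ 2 * (W y * χ y ^ 2)) := by
    refine iR.mono' (((continuous_norm.pow 2).aestronglyMeasurable).mul hint.1)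
      (ae_of_all _ fun y => ?_)
    rw [Real.norm_of_nonneg (mul_nonneg (sq_nonneg _) (hnn y))]
    exact hb y
  refine ⟨iL, (integral_mono iL iR hb).trans ?_⟩
  rw [integral_const_mul, integral_add (hint.const_mul _) ig, integral_const_mul,
    integral_const_mul, integral_const_mul, integral_exp_neg_mul_sq_norm (by norm_num)]
  have h5 := exp_mul_integral_le_nearlyGaussianMass hd (c := 9 / 25) (by norm_num)
  have h6 : Real.exp (-d) * (Real.exp (d / 200) * (Real.pi / (9 / 25)) ^ (d / 2 : ℝ))
      ≤ nearlyGaussianMass d := by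
    calc _ ≤ Real.exp (-d) * (Real.exp (((103 / 200 / (9 / 25) - 1) / 2 + 71 / 100) * d)
          * nearlyGaussianMass d) := by gcongr
      _ = Real.exp (-d + ((103 / 200 / (9 / 25) - 1) / 2 + 71 / 100) * d)
          * nearlyGaussianMass d := by rw [Real.exp_add]; ring
      _ ≤ 1 * nearlyGaussianMass d := by
        have := nearlyGaussianMass_pos d
        gcongr
        rw [Real.exp_le_one_iff]
        norm_num
        linarith
      _ = _ := one_mul _
  have h7 : (0 : ℝ) ≤ ∫ y, W y * χ y ^ 2 := integral_nonneg hnn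
  nlinarith

/-- Split `97/200 = 1/4 + 47/200`. The second part, with `‖y‖² ≥ s²d/8`, gives the decay `47/1600
s²d`; the first keeps the weight integrable. The rate is twice `d(s/12)²` because a square root is
taken of the energy later. -/
lemma annulus_le (H : NearlyGaussian s a ε f W) :
    ∫ y in Metric.ball (0 : EuclideanSpace ℝ (Fin d)) (s * √d / 2) ∩
        {y | (s * √d / 2) ^ 2 / 2 ≤ ‖y‖ ^ 2}, W y
      ≤ Real.exp (-(2 * d * (s / 12) ^ 2)) * nearlyGaussianMass d := by
  have hd := H.one_le_dim
  have hms : MeasurableSet (Metric.ball (0 : EuclideanSpace ℝ (Fin d)) (s * √d / 2) ∩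
        {y | (s * √d / 2) ^ 2 / 2 ≤ ‖y‖ ^ 2}) :=
    measurableSet_ball.inter (measurableSet_le (by fun_prop) (by fun_prop))
  have ig := ((integrable_exp_neg_mul_sq_norm (d := d) (b := 1 / 4) (by norm_num)).const_mul
    (Real.exp (d / 200))).const_mul (Real.exp (-(47 / 1600 * s ^ 2 * d)))
  calc _ ≤ ∫ y in Metric.ball (0 : EuclideanSpace ℝ (Fin d)) (s * √d / 2) ∩
        {y | (s * √d / 2) ^ 2 / 2 ≤ ‖y‖ ^ 2}, Real.exp (-(47 / 1600 * s ^ 2 * d)) *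
          (Real.exp (d / 200) * Real.exp (-(1 / 4) * ‖y‖ ^ 2)) := by
        refine setIntegral_mono_on H.integrable.integrableOn ig.integrableOn hms
          fun y hy => (H.le_exp hy.1).trans ?_
        rw [← Real.exp_add, ← Real.exp_add, ← Real.exp_add, Real.exp_le_exp]
        have h1 : (s * √d / 2) ^ 2 / 2 ≤ ‖y‖ ^ 2 := hy.2
        rw [radius_sq] at h1
        linarith
    _ ≤ ∫ y : EuclideanSpace ℝ (Fin d), Real.exp (-(47 / 1600 * s ^ 2 * d)) *
          (Real.exp (d / 200) * Real.exp (-(1 / 4) * ‖y‖ ^ 2)) :=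
        setIntegral_le_integral ig (ae_of_all _ fun y => by positivity)
    _ = Real.exp (-(47 / 1600 * s ^ 2 * d)) *
          (Real.exp (d / 200) * (Real.pi / (1 / 4)) ^ (d / 2 : ℝ)) := by
        rw [integral_const_mul, integral_const_mul,
          integral_exp_neg_mul_sq_norm (b := 1 / 4) (by norm_num)]
    _ ≤ Real.exp (-(47 / 1600 * s ^ 2 * d)) *
          (Real.exp (((103 / 200 / (1 / 4) - 1) / 2 + 71 / 100) * d) * nearlyGaussianMass d) := by
        exact mul_le_mul_of_nonneg_left
          (exp_mul_integral_le_nearlyGaussianMass (c := 1 / 4) hd (by norm_num))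
          (Real.exp_pos _).le
    _ = Real.exp (-(47 / 1600 * s ^ 2 * d) + ((103 / 200 / (1 / 4) - 1) / 2 + 71 / 100) * d) *
          nearlyGaussianMass d := by rw [Real.exp_add]; ring
    _ ≤ _ := by
        have := nearlyGaussianMass_pos d
        gcongr
        have hs : 144 ≤ s ^ 2 := by nlinarith [H.s_ge]
        have h2 : (47 / 1600 - 2 / 144) * s ^ 2 ≥ (103 / 200 / (1 / 4) - 1) / 2 + 71 / 100 := by
          norm_num
          linarith
        have h3 := mul_le_mul_of_nonneg_right h2 (by linarith : (0 : ℝ) ≤ d)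
        linarith

end NearlyGaussian

end NearlyGaussian

section NearlyGaussian

variable {d : ℕ}

/-- Effect of removing mass and renormalizing: a set loses no more than the whole space does, so its
normalized mass changes by at most the relative loss. -/
lemma abs_div_sub_div_le {N N' A A' : ℝ} (hN' : 0 < N') (hA' : 0 ≤ A') (h1 : A' ≤ A)
    (h2 : A' ≤ N') (h3 : A - A' ≤ N - N') : |A / N - A' / N'| ≤ (N - N') / N' := by
  have hNN : N' ≤ N := by linarith
  have hN : 0 < N := by linarith
  have e : A / N - A' / N' = ((A - A') * N' - A' * (N - N')) / (N * N') := by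
    field_simp
    ring
  rw [e, abs_div, abs_of_pos (mul_pos hN hN'), div_le_div_iff₀ (mul_pos hN hN') hN']
  have h4 : |(A - A') * N' - A' * (N - N')| ≤ (N - N') * N' := by
    rw [abs_le]
    constructor
    · nlinarith [mul_nonneg (sub_nonneg.2 h1) hN'.le,
        mul_le_mul_of_nonneg_right h2 (sub_nonneg.2 hNN)]
    · nlinarith [mul_le_mul_of_nonneg_right h3 hN'.le, mul_nonneg hA' (sub_nonneg.2 hNN)]
  have h5 : (N - N') * N' ≤ (N - N') * N := mul_le_mul_of_nonneg_left hNN (by linarith)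
  nlinarith

namespace NearlyGaussian

variable {s a ε : ℝ} {f W χ : EuclideanSpace ℝ (Fin d) → ℝ}

/-- Up to normalization, the square of `cutoffExp` is the density of the cut-off weight with respect
to the standard Gaussian measure. -/
lemma exp_mul_cutoffExp_sq (H : NearlyGaussian s a ε f W)
    (hχs : ∀ y, 3 / 4 * (s * √d / 2) ^ 2 ≤ ‖y‖ ^ 2 → χ y = 0) (y : EuclideanSpace ℝ (Fin d)) :
    Real.exp (-(1 / 2) * ‖y‖ ^ 2) * cutoffExp f χ (s * √d / 2) y ^ 2 = W y * χ y ^ 2 := by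
  by_cases hy : y ∈ Metric.ball (0 : EuclideanSpace ℝ (Fin d)) (s * √d / 2)
  · rw [cutoffExp, if_pos hy, H.eq_exp y hy, mul_pow, ← mul_assoc, ← Real.exp_nat_mul,
      ← Real.exp_add]
    congr 2
    push_cast
    ring
  · have := H.radius_pos
    rw [cutoffExp, if_neg hy, hχs y]
    · simp
    · simp only [mem_ball_zero_iff, not_lt] at hy
      nlinarith

/-- The Dirichlet energy of the cutoff square root of the density. -/
lemma energy_le (H : NearlyGaussian s a ε f W) (hχc : ContDiff ℝ 1 χ) (hχ0 : ∀ y, 0 ≤ χ y)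
    (hχ1 : ∀ y, χ y ≤ 1) (hχ : ∀ y, ‖y‖ ^ 2 ≤ (s * √d / 2) ^ 2 / 2 → χ y = 1)
    (hχs : ∀ y, 3 / 4 * (s * √d / 2) ^ 2 ≤ ‖y‖ ^ 2 → χ y = 0) {K : ℝ}
    (hK : ∀ y, ‖fderiv ℝ χ y‖ ≤ K / (s * √d / 2))
    (hK0 : ∀ y, ‖y‖ ^ 2 < (s * √d / 2) ^ 2 / 2 → fderiv ℝ χ y = 0) :
    ∫ y, Real.exp (-(1 / 2) * ‖y‖ ^ 2) * ‖fderiv ℝ (cutoffExp f χ (s * √d / 2)) y‖ ^ 2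
      ≤ (a ^ 2 + 16 * ε ^ 2 * d + K ^ 2 * Real.exp (-(2 * d * (s / 12) ^ 2))) *
        ∫ y, W y * χ y ^ 2 := by
  have hd := H.one_le_dim
  have hR := H.radius_pos
  have hmass := H.mass_le hχc.continuous.measurable hχ0 hχ1 hχ
  obtain ⟨i2, h2⟩ := H.second_moment_le hχc.continuous.measurable hχ0 hχ1 hχ hχs
  have hann := H.annulus_le
  set S := Metric.ball (0 : EuclideanSpace ℝ (Fin d)) (s * √d / 2) ∩
        {y | (s * √d / 2) ^ 2 / 2 ≤ ‖y‖ ^ 2} with hS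
  have hms : MeasurableSet S :=
    measurableSet_ball.inter (measurableSet_le (by fun_prop) (by fun_prop))
  have hχm : Measurable χ := hχc.continuous.measurable
  have hint : Integrable fun y => W y * χ y ^ 2 :=
    H.integrable.mul_bdd (c := 1) (by fun_prop) (ae_of_all _ fun y => by
      rw [Real.norm_of_nonneg (by positivity)]
      exact pow_le_one₀ (hχ0 y) (hχ1 y))
  have hR1 : 1 ≤ (s * √d / 2) := by
    have : (1 : ℝ) ≤ √d := Real.one_le_sqrt.2 H.one_le_dim
    nlinarith [H.s_ge]
  have hR6 : 2 ≤ (s * √d / 2) ^ 2 := by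
    rw [radius_sq]
    nlinarith [H.s_ge, mul_self_nonneg (s - 12)]
  -- The gradient of `f` contributes `a²` and `ε²‖y‖²`, the latter controlled by the second moment.
  -- The gradient of `χ` lives on the annulus `S`, where `2K²/R² ≤ K²`.
  have hpt : ∀ y, Real.exp (-(1 / 2) * ‖y‖ ^ 2) *
        ‖fderiv ℝ (cutoffExp f χ (s * √d / 2)) y‖ ^ 2 ≤
      a ^ 2 * (W y * χ y ^ 2) + ε ^ 2 * (‖y‖ ^ 2 * (W y * χ y ^ 2)) +
        S.indicator (fun y => K ^ 2 * W y) y := by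
    intro y
    have hnn : 0 ≤ W y * χ y ^ 2 := mul_nonneg (H.nonneg y) (sq_nonneg _)
    have hSn : 0 ≤ S.indicator (fun y => K ^ 2 * W y) y :=
      Set.indicator_nonneg (fun y _ => mul_nonneg (sq_nonneg _) (H.nonneg y)) y
    by_cases hy : y ∈ Metric.ball (0 : EuclideanSpace ℝ (Fin d)) (s * √d / 2)
    · have h3 := norm_fderiv_cutoffExp_sq_le hχc H.contDiffOn hy
      have h4 : ‖fderiv ℝ f y‖ ^ 2 / 2 ≤ a ^ 2 + ε ^ 2 * ‖y‖ ^ 2 := by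
        have h5 := pow_le_pow_left₀ (norm_nonneg _) (H.norm_fderiv_le y hy) 2
        nlinarith [sq_nonneg (a - ε * ‖y‖)]
      have hWe : Real.exp (-(1 / 2) * ‖y‖ ^ 2) * Real.exp (f y) = W y := by
        rw [H.eq_exp y hy, ← Real.exp_add]
        congr 1
        ring
      have hcut : W y * (2 * ‖fderiv ℝ χ y‖ ^ 2) ≤ S.indicator (fun y => K ^ 2 * W y) y := by
        by_cases hyS : (s * √d / 2) ^ 2 / 2 ≤ ‖y‖ ^ 2
        · rw [Set.indicator_of_mem (show y ∈ S from ⟨hy, hyS⟩), mul_comm (K ^ 2)]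
          refine mul_le_mul_of_nonneg_left ?_ (H.nonneg y)
          have h6 := pow_le_pow_left₀ (norm_nonneg _) (hK y) 2
          rw [div_pow] at h6
          have h7 : K ^ 2 / (s * √d / 2) ^ 2 ≤ K ^ 2 / 2 := by gcongr
          linarith
        · rw [hK0 y (not_le.1 hyS)]
          simpa using hSn
      calc _ ≤ Real.exp (-(1 / 2) * ‖y‖ ^ 2) * (Real.exp (f y) *
            (‖fderiv ℝ f y‖ ^ 2 / 2 * χ y ^ 2 + 2 * ‖fderiv ℝ χ y‖ ^ 2)) := by gcongr
        _ = ‖fderiv ℝ f y‖ ^ 2 / 2 * (W y * χ y ^ 2) + W y * (2 * ‖fderiv ℝ χ y‖ ^ 2) := by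
          rw [← mul_assoc, hWe]; ring
        _ ≤ (a ^ 2 + ε ^ 2 * ‖y‖ ^ 2) * (W y * χ y ^ 2) +
            S.indicator (fun y => K ^ 2 * W y) y :=
          add_le_add (mul_le_mul_of_nonneg_right h4 hnn) hcut
        _ = _ := by ring
    · have : fderiv ℝ (cutoffExp f χ (s * √d / 2)) y = 0 := by
        rw [(cutoffExp_eventuallyEq_zero hR hχs hy).fderiv_eq]
        simp
      rw [this]
      simp only [norm_zero, ne_eq, OfNat.ofNat_ne_zero, not_false_eq_true, zero_pow, mul_zero]
      positivity
  have iS : Integrable (S.indicator (fun y => K ^ 2 * W y)) :=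
    (H.integrable.const_mul _).indicator hms
  have i12 : Integrable fun y => a ^ 2 * (W y * χ y ^ 2) + ε ^ 2 * (‖y‖ ^ 2 * (W y * χ y ^ 2)) :=
    (hint.const_mul _).add (i2.const_mul _)
  have hle : ∫ y, Real.exp (-(1 / 2) * ‖y‖ ^ 2) *
        ‖fderiv ℝ (cutoffExp f χ (s * √d / 2)) y‖ ^ 2 ≤
      ∫ y, (a ^ 2 * (W y * χ y ^ 2) + ε ^ 2 * (‖y‖ ^ 2 * (W y * χ y ^ 2)) +
        S.indicator (fun y => K ^ 2 * W y) y) :=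
    integral_mono_of_nonneg (ae_of_all _ fun y => by positivity) (i12.add iS) (ae_of_all _ hpt)
  refine hle.trans ?_
  rw [integral_add i12 iS, integral_add (hint.const_mul _) (i2.const_mul _), integral_const_mul,
    integral_const_mul, integral_indicator hms, integral_const_mul]
  have h8 : ε ^ 2 * ∫ y, ‖y‖ ^ 2 * (W y * χ y ^ 2) ≤
      ε ^ 2 * (16 * d * ∫ y, W y * χ y ^ 2) := by gcongr
  have h9 : K ^ 2 * ∫ y in S, W y ≤
      K ^ 2 * (Real.exp (-(2 * d * (s / 12) ^ 2)) * ∫ y, W y * χ y ^ 2) := by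
    gcongr
    exact hann.trans (by gcongr)
  linarith

/-- Comparison of the cutoff weight with the Gaussian measure. -/
lemma gaussian_comparison (H : NearlyGaussian s a ε f W) (hχc : ContDiff ℝ 1 χ)
    (hχ0 : ∀ y, 0 ≤ χ y)
    (hχ1 : ∀ y, χ y ≤ 1) (hχ : ∀ y, ‖y‖ ^ 2 ≤ (s * √d / 2) ^ 2 / 2 → χ y = 1)
    (hχs : ∀ y, 3 / 4 * (s * √d / 2) ^ 2 ≤ ‖y‖ ^ 2 → χ y = 0) {K : ℝ} (hKpos : 0 ≤ K)
    (hχK : ∀ y, ‖fderiv ℝ χ y‖ ≤ K / (s * √d / 2))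
    (hχK0 : ∀ y, ‖y‖ ^ 2 < (s * √d / 2) ^ 2 / 2 → fderiv ℝ χ y = 0)
    {A : Set (EuclideanSpace ℝ (Fin d))} (hA : MeasurableSet A) :
    |(∫ y in A, W y * χ y ^ 2) / (∫ y, W y * χ y ^ 2) -
      (stdGaussian (EuclideanSpace ℝ (Fin d))).real A|
      ≤ 3 * (a + 4 * (ε * √d) + K * Real.exp (-(d * (s / 12) ^ 2))) := by
  have hd := H.one_le_dim
  have hR := H.radius_pos
  have hχm : Measurable χ := hχc.continuous.measurable
  have hmass := H.mass_le hχm hχ0 hχ1 hχ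
  have hN'pos : 0 < ∫ y, W y * χ y ^ 2 := (nearlyGaussianMass_pos d).trans_le hmass
  have hq2 : Real.exp (-(2 * d * (s / 12) ^ 2)) = Real.exp (-(d * (s / 12) ^ 2)) ^ 2 := by
    rw [← Real.exp_nat_mul]
    congr 1
    push_cast
    ring
  have hen := H.energy_le hχc hχ0 hχ1 hχ hχs hχK hχK0
  have hpt := H.exp_mul_cutoffExp_sq hχs
  have hc : ContDiff ℝ 1 (cutoffExp f χ (s * √d / 2)) :=
    contDiff_cutoffExp hR hχc hχs H.contDiffOn
  have hcs : HasCompactSupport (cutoffExp f χ (s * √d / 2)) := hasCompactSupport_cutoffExp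
  have ha := H.a_nonneg
  have hεd : 0 ≤ ε * √d := mul_nonneg H.ε_nonneg (Real.sqrt_nonneg _)
  rw [hq2] at hen
  have hq0 := (Real.exp_pos (-(d * (s / 12) ^ 2)))
  generalize Real.exp (-(d * (s / 12) ^ 2)) = q at hen hq0 ⊢
  generalize cutoffExp f χ (s * √d / 2) = h at hen hpt hc hcs
  have e1 : ∫ y, h y ^ 2 ∂(stdGaussian (EuclideanSpace ℝ (Fin d)))
      = ((2 * Real.pi) ^ (d / 2 : ℝ))⁻¹ * ∫ y, W y * χ y ^ 2 := by
    rw [integral_stdGaussian]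
    simp_rw [hpt]
  have e2 : ∫ y in A, h y ^ 2 ∂(stdGaussian (EuclideanSpace ℝ (Fin d)))
      = ((2 * Real.pi) ^ (d / 2 : ℝ))⁻¹ * ∫ y in A, W y * χ y ^ 2 := by
    rw [setIntegral_stdGaussian _ hA]
    simp_rw [hpt]
  have e3 := integral_stdGaussian (fun y => ‖fderiv ℝ h y‖ ^ 2)
  have hvar := variance_stdGaussian_le hc hcs
  have hcpos : 0 < ((2 * Real.pi) ^ (d / 2 : ℝ))⁻¹ := by positivity
  generalize ((2 * Real.pi) ^ (d / 2 : ℝ))⁻¹ = c at e1 e2 e3 hcpos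
  obtain ⟨γ, hγ⟩ : ∃ γ, γ = stdGaussian (EuclideanSpace ℝ (Fin d)) := ⟨_, rfl⟩
  have : IsProbabilityMeasure γ := hγ ▸ inferInstance
  rw [← hγ] at e1 e2 e3 hvar ⊢
  generalize (∫ y, W y * χ y ^ 2) = N' at *
  have hcs2 : HasCompactSupport fun x => h x ^ 2 := by
    simp only [pow_two]
    exact hcs.mul_right
  have i1 : Integrable h γ := hc.continuous.integrable_of_hasCompactSupport hcs
  have i2 : Integrable (fun x => h x ^ 2) γ :=
    (hc.continuous.pow 2).integrable_of_hasCompactSupport hcs2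
  have key := abs_setIntegral_sq_div_sub_le γ i1 i2 (by rw [e1]; positivity) A
  rw [e1, e3] at hvar
  rw [e1, e2, mul_div_mul_left _ _ hcpos.ne'] at key
  refine key.trans ?_
  have hpi : Real.pi ^ 2 / 8 ≤ 2 := by
    have := Real.pi_lt_four
    nlinarith [Real.pi_pos]
  -- Poincaré with `π²/8 ≤ 2`; the Gaussian normalization `c` occurs on both sides and cancels.
  have hv2 : (c * N' - (∫ x, h x ∂γ) ^ 2) / (c * N')
      ≤ 2 * (a ^ 2 + 16 * ε ^ 2 * d + K ^ 2 * q ^ 2) := by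
    rw [div_le_iff₀ (by positivity)]
    refine hvar.trans ?_
    calc _ ≤ 2 * (c * ((a ^ 2 + 16 * ε ^ 2 * d + K ^ 2 * q ^ 2) * N')) := by
          gcongr
      _ = _ := by ring
  have hv3 : 2 * (a ^ 2 + 16 * ε ^ 2 * d + K ^ 2 * q ^ 2)
      ≤ (3 / 2 * (a + 4 * (ε * √d) + K * q)) ^ 2 := by
    have h1 : 16 * ε ^ 2 * d = (4 * (ε * √d)) ^ 2 := by
      rw [mul_pow, mul_pow, Real.sq_sqrt (by positivity)]
      ring
    rw [h1]
    have hKq : 0 ≤ K * q := by positivity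
    nlinarith [mul_nonneg ha hεd, mul_nonneg ha hKq, mul_nonneg hεd hKq, sq_nonneg a,
      sq_nonneg (ε * √d), sq_nonneg (K * q)]
  have hv4 : √((c * N' - (∫ x, h x ∂γ) ^ 2) / (c * N'))
      ≤ 3 / 2 * (a + 4 * (ε * √d) + K * q) :=
    Real.sqrt_le_iff.2 ⟨by positivity, hv2.trans hv3⟩
  linarith

end NearlyGaussian

/-- A nearly Gaussian weight is close in total variation to the standard Gaussian measure. -/
theorem exists_nearlyGaussian_tv_le : ∃ C : ℝ, 0 < C ∧
    ∀ (d : ℕ) (s a ε T : ℝ) (f W : EuclideanSpace ℝ (Fin d) → ℝ), NearlyGaussian s a ε f W →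
      (∫ y in (Metric.ball (0 : EuclideanSpace ℝ (Fin d)) (s * √d / 2))ᶜ, W y
        ≤ T * nearlyGaussianMass d) →
      0 < ∫ y, W y ∧ ∀ A : Set (EuclideanSpace ℝ (Fin d)), MeasurableSet A →
        |(∫ y in A, W y) / (∫ y, W y) - (stdGaussian (EuclideanSpace ℝ (Fin d))).real A|
          ≤ C * (a + ε * √d + Real.exp (-(d * (s / 12) ^ 2)) + T) := by
  obtain ⟨K, hKpos, hcut⟩ := exists_cutoff
  -- The Gaussian comparison costs `3(a + 4ε√d + Kq)` and the removal of the cutoff costs `q + T`.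
  refine ⟨12 + 3 * K + 1, by positivity, fun d s a ε T f W H hT => ?_⟩
  have hd := H.one_le_dim
  have hR := H.radius_pos
  obtain ⟨χ, hχc, hχ0, hχ1, hχ, hχs, hχK, hχK0⟩ := hcut d (s * √d / 2) hR
  have hχm : Measurable χ := hχc.continuous.measurable
  have hmass := H.mass_le hχm hχ0 hχ1 hχ
  have hmpos := nearlyGaussianMass_pos d
  have hint : Integrable fun y => W y * χ y ^ 2 :=
    H.integrable.mul_bdd (c := 1) (by fun_prop) (ae_of_all _ fun y => by
      rw [Real.norm_of_nonneg (by positivity)]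
      exact pow_le_one₀ (hχ0 y) (hχ1 y))
  have hnn : ∀ y, 0 ≤ W y * χ y ^ 2 := fun y => mul_nonneg (H.nonneg y) (sq_nonneg _)
  have hle : ∀ y, W y * χ y ^ 2 ≤ W y := fun y =>
    mul_le_of_le_one_right (H.nonneg y) (pow_le_one₀ (hχ0 y) (hχ1 y))
  set N' := ∫ y, W y * χ y ^ 2 with hN'
  set N := ∫ y, W y with hN
  have hN'pos : 0 < N' := hmpos.trans_le hmass
  have hNN : N' ≤ N := integral_mono hint H.integrable hle
  set q := Real.exp (-(d * (s / 12) ^ 2)) with hq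
  have hq0 : 0 < q := Real.exp_pos _
  have hq2 : Real.exp (-(2 * d * (s / 12) ^ 2)) = q ^ 2 := by
    rw [hq, ← Real.exp_nat_mul]
    congr 1
    push_cast
    ring
  have hq1 : q ≤ 1 := Real.exp_le_one_iff.2 (by
    have : 0 ≤ d * (s / 12) ^ 2 := by positivity
    linarith)
  have hT0 : 0 ≤ T := by
    have : 0 ≤ T * nearlyGaussianMass d :=
      (setIntegral_nonneg measurableSet_ball.compl fun y _ => H.nonneg y).trans hT
    exact nonneg_of_mul_nonneg_left this hmpos
  have hεd : 0 ≤ ε * √d := mul_nonneg H.ε_nonneg (Real.sqrt_nonneg _)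
  refine ⟨hN'pos.trans_le hNN, fun A hA => ?_⟩
  -- the part of the mass that is removed by the cutoff
  have hdiff : N - N' ≤ (q ^ 2 + T) * N' := by
    set S := Metric.ball (0 : EuclideanSpace ℝ (Fin d)) (s * √d / 2) ∩
        {y | (s * √d / 2) ^ 2 / 2 ≤ ‖y‖ ^ 2} with hS
    have hms : MeasurableSet S :=
      measurableSet_ball.inter (measurableSet_le (by fun_prop) (by fun_prop))
    set B := (Metric.ball (0 : EuclideanSpace ℝ (Fin d)) (s * √d / 2))ᶜ with hB
    have hBm : MeasurableSet B := measurableSet_ball.compl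
    have iS := H.integrable.indicator hms
    have iB := H.integrable.indicator hBm
    have h1 : ∫ y, (W y - W y * χ y ^ 2) ≤ ∫ y, (S.indicator W y + B.indicator W y) := by
      refine integral_mono (H.integrable.sub hint) (iS.add iB) fun y => ?_
      have n1 : 0 ≤ S.indicator W y := Set.indicator_nonneg (fun y _ => H.nonneg y) y
      have n2 : 0 ≤ B.indicator W y := Set.indicator_nonneg (fun y _ => H.nonneg y) y
      have n3 := hnn y
      by_cases hyB : y ∈ B
      · have : B.indicator W y = W y := Set.indicator_of_mem hyB _
        linarith
      · by_cases hyS : (s * √d / 2) ^ 2 / 2 ≤ ‖y‖ ^ 2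
        · have : S.indicator W y = W y := Set.indicator_of_mem (show y ∈ S from ⟨not_not.1 hyB, hyS⟩) _
          linarith
        · have : χ y = 1 := hχ y (not_le.1 hyS).le
          rw [this]
          linarith
    rw [integral_sub H.integrable hint, integral_add iS iB, integral_indicator hms,
      integral_indicator hBm] at h1
    have h2 := H.annulus_le
    rw [hq2] at h2
    have h3 : (q ^ 2 + T) * nearlyGaussianMass d ≤ (q ^ 2 + T) * N' := by gcongr
    linarith
  have hcompare : |(∫ y in A, W y) / N - (∫ y in A, W y * χ y ^ 2) / N'| ≤ q + T := by
    refine (abs_div_sub_div_le hN'pos (integral_nonneg hnn)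
      (integral_mono hint.integrableOn H.integrable.integrableOn hle)
      (setIntegral_le_integral hint (ae_of_all _ hnn)) ?_).trans ?_
    · rw [← integral_sub H.integrable.integrableOn hint.integrableOn,
        ← integral_sub H.integrable hint]
      exact setIntegral_le_integral (H.integrable.sub hint)
        (ae_of_all _ fun y => sub_nonneg.2 (hle y))
    · rw [div_le_iff₀ hN'pos]
      refine hdiff.trans ?_
      gcongr
      nlinarith
  -- comparison of the cutoff weight with the Gaussian measure
  have hgauss := H.gaussian_comparison hχc hχ0 hχ1 hχ hχs hKpos.le hχK hχK0 hA
  rw [← hN', ← hq] at hgauss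
  have htri := abs_sub_le ((∫ y in A, W y) / N) ((∫ y in A, W y * χ y ^ 2) / N')
    ((stdGaussian (EuclideanSpace ℝ (Fin d))).real A)
  have ha := H.a_nonneg
  nlinarith [mul_nonneg hKpos.le ha, mul_nonneg hKpos.le hεd, mul_nonneg hKpos.le hT0]

end NearlyGaussian

/-! ### Concentration of the norm of a locally sub-Gaussian vector -/

section Concentration

variable {d : ℕ}

/-- The shift `(r/b) z/‖z‖` maximizes `r⟪z, t⟫/‖z‖ - b‖t‖²/2`, so completing the square gives the
claim with `z` shortened to length `r`. Points within distance `r/b` of the shift satisfy `⟪z, t⟫ ≥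
0`, so the true length of `z` only helps. -/
lemma exp_shift_lower {b r : ℝ} (hb : 0 < b) (hr : 0 < r) {z t : EuclideanSpace ℝ (Fin d)}
    (hz : r ≤ ‖z‖) (ht : ‖t - (r / b / ‖z‖) • z‖ ≤ r / b) :
    Real.exp (r ^ 2 / (2 * b)) * Real.exp (-(b / 2) * ‖t - (r / b / ‖z‖) • z‖ ^ 2)
      ≤ Real.exp ⟪z, t⟫ * Real.exp (-(b / 2) * ‖t‖ ^ 2) := by
  rw [← Real.exp_add, ← Real.exp_add, Real.exp_le_exp]
  have hz0 : 0 < ‖z‖ := hr.trans_le hz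
  have h1 : ‖t - (r / b / ‖z‖) • z‖ ^ 2 = ‖t‖ ^ 2 - 2 * (r / b / ‖z‖) * ⟪z, t⟫ + (r / b) ^ 2 := by
    rw [norm_sub_sq_real, real_inner_smul_right, norm_smul, real_inner_comm, Real.norm_of_nonneg
      (by positivity), div_mul_cancel₀ _ hz0.ne']
    ring
  have h2 : 0 ≤ ⟪z, t⟫ := by
    have h3 : ‖t - (r / b / ‖z‖) • z‖ ^ 2 ≤ (r / b) ^ 2 := by gcongr
    rw [h1] at h3
    by_contra hneg
    push Not at hneg
    have : 0 < 2 * (r / b / ‖z‖) * (-⟪z, t⟫) := by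
      have : 0 < -⟪z, t⟫ := by linarith
      positivity
    nlinarith [sq_nonneg ‖t‖]
  rw [h1]
  have h4 : r / ‖z‖ * ⟪z, t⟫ ≤ ⟪z, t⟫ :=
    mul_le_of_le_one_left h2 ((div_le_one hz0).2 hz)
  have e : r ^ 2 / (2 * b) + -(b / 2) * (‖t‖ ^ 2 - 2 * (r / b / ‖z‖) * ⟪z, t⟫ + (r / b) ^ 2)
      = r / ‖z‖ * ⟪z, t⟫ + -(b / 2) * ‖t‖ ^ 2 := by
    field_simp
    ring
  linarith

/-- Apply `exp_shift_lower` with `b = 13/6`, where the shift has length `6r/13`. The set `‖y‖² ≤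
48d/13` carries half of the mass of the weight with exponent `13/12`. It lies in the ball of radius
`2√d ≤ 6r/13`, so its translate stays in the ball of radius `ρ`. -/
lemma lintegral_exp_inner_lower (hd : 0 < d) {r ρ : ℝ} (hr : 2 * √d ≤ 6 / 13 * r)
    (hρ : r ≤ ρ) {z : EuclideanSpace ℝ (Fin d)} (hz : r ≤ ‖z‖) :
    ENNReal.ofReal (Real.exp (3 / 13 * r ^ 2) * (1 / 2 * (Real.pi / (13 / 12)) ^ (d / 2 : ℝ)))
      ≤ ∫⁻ t in Metric.closedBall (0 : EuclideanSpace ℝ (Fin d)) ρ,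
        ENNReal.ofReal (Real.exp ⟪z, t⟫ * Real.exp (-(13 / 12) * ‖t‖ ^ 2)) := by
  have hd0 : 0 < √(d : ℝ) := Real.sqrt_pos.2 (by exact_mod_cast hd)
  have hr0 : 0 < r := by linarith
  have hz0 : 0 < ‖z‖ := hr0.trans_le hz
  set t₀ := (r / (13 / 6) / ‖z‖) • z with ht₀
  have ht₀n : ‖t₀‖ = 6 / 13 * r := by
    rw [ht₀, norm_smul, Real.norm_of_nonneg (by positivity), div_mul_cancel₀ _ hz0.ne']
    ring
  set S : Set (EuclideanSpace ℝ (Fin d)) := {y | ‖y‖ ^ 2 ≤ 48 / 13 * d} with hS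
  have hSm : MeasurableSet S := measurableSet_le (by fun_prop) (by fun_prop)
  have hSn : ∀ y ∈ S, ‖y‖ ≤ 2 * √d := fun y hy => by
    apply le_of_sq_le_sq _ (by positivity)
    rw [mul_pow, Real.sq_sqrt (by positivity)]
    have : ‖y‖ ^ 2 ≤ 48 / 13 * d := hy
    have : (0 : ℝ) ≤ d := by positivity
    linarith
  have h1 := half_le_setIntegral_exp_neg_mul_sq hd (b := 13 / 12) (κ := 48 / 13)
    (by norm_num) (by norm_num)
  have hi := integrable_exp_neg_mul_sq_norm (d := d) (b := 13 / 12) (by norm_num)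
  calc _ ≤ ENNReal.ofReal (Real.exp (3 / 13 * r ^ 2) *
        ∫ y in S, Real.exp (-(13 / 12) * ‖y‖ ^ 2)) := by gcongr
    _ = ∫⁻ y in S, ENNReal.ofReal (Real.exp (3 / 13 * r ^ 2) *
          Real.exp (-(13 / 12) * ‖y‖ ^ 2)) := by
        rw [← integral_const_mul, ofReal_integral_eq_lintegral_ofReal
          (hi.const_mul _).integrableOn (ae_of_all _ fun y => by positivity)]
    _ ≤ ∫⁻ y, (Metric.closedBall (0 : EuclideanSpace ℝ (Fin d)) ρ).indicator (fun t =>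
        ENNReal.ofReal (Real.exp ⟪z, t⟫ * Real.exp (-(13 / 12) * ‖t‖ ^ 2))) (y + t₀) := by
        rw [← lintegral_indicator hSm]
        refine lintegral_mono fun y => ?_
        by_cases hy : y ∈ S
        · have hyn := hSn y hy
          rw [Set.indicator_of_mem hy, Set.indicator_of_mem]
          · apply ENNReal.ofReal_le_ofReal
            have h2 := exp_shift_lower (b := 13 / 6) (by norm_num) hr0 (t := y + t₀) hz
              (by rw [← ht₀, add_sub_cancel_right]; linarith)
            rw [← ht₀, add_sub_cancel_right] at h2
            convert h2 using 3
            · ring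
            · norm_num
            · norm_num
          · rw [mem_closedBall_zero_iff]
            refine (norm_add_le _ _).trans ?_
            rw [ht₀n]
            linarith
        · rw [Set.indicator_of_notMem hy]
          exact zero_le
    _ = _ := by
        rw [lintegral_add_right_eq_self (μ := (volume : Measure (EuclideanSpace ℝ (Fin d))))
          ((Metric.closedBall (0 : EuclideanSpace ℝ (Fin d)) ρ).indicator (fun t =>
            ENNReal.ofReal (Real.exp ⟪z, t⟫ * Real.exp (-(13 / 12) * ‖t‖ ^ 2)))) t₀,
          lintegral_indicator measurableSet_closedBall]

/-- If the moment generating function of `Z` is sub-Gaussian (with variance proxy `13 / 12`) on the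
ball of radius `2 s √d`, then `‖Z‖` exceeds `0.7 s √d` with exponentially small probability. -/
theorem measure_norm_ge_le {Ω : Type*} [MeasurableSpace Ω] (P : Measure Ω) [IsProbabilityMeasure P]
    {Z : Ω → EuclideanSpace ℝ (Fin d)} (hZ : Measurable Z) (hd : 0 < d) {s : ℝ} (hs : 12 ≤ s)
    (hmgf : ∀ t : EuclideanSpace ℝ (Fin d), ‖t‖ ≤ 2 * s * √d →
      ∫⁻ ω, ENNReal.ofReal (Real.exp ⟪Z ω, t⟫) ∂P ≤
        ENNReal.ofReal (Real.exp (13 / 24 * ‖t‖ ^ 2))) :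
    P {ω | 7 / 10 * (s * √d) ≤ ‖Z ω‖} ≤ ENNReal.ofReal (Real.exp (-(d * s ^ 2 / 10))) := by
  have hd0 : 0 < √(d : ℝ) := Real.sqrt_pos.2 (by exact_mod_cast hd)
  have hd1 : (1 : ℝ) ≤ d := by exact_mod_cast hd
  set r := 7 / 10 * (s * √d) with hr
  set ρ := 2 * s * √d with hρ
  -- Method of mixtures: `J` averages the exponential moments over all admissible directions at
  -- once. It is at least `c` when `‖Z‖ ≥ r`, its mean is bounded by Fubini, and Markov's inequality
  -- concludes. No net of directions is needed.
  set J : Ω → ℝ≥0∞ := fun ω => ∫⁻ t in Metric.closedBall (0 : EuclideanSpace ℝ (Fin d)) ρ,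
        ENNReal.ofReal (Real.exp ⟪Z ω, t⟫ * Real.exp (-(13 / 12) * ‖t‖ ^ 2)) with hJ
  set c := Real.exp (3 / 13 * r ^ 2) * (1 / 2 * (Real.pi / (13 / 12)) ^ (d / 2 : ℝ)) with hc
  have hcpos : 0 < c := by positivity
  have hr2 : r ^ 2 = 49 / 100 * (s ^ 2 * d) := by
    rw [hr, mul_pow, mul_pow, Real.sq_sqrt (by positivity)]
    norm_num
  have hjm : Measurable fun q : Ω × EuclideanSpace ℝ (Fin d) =>
      ENNReal.ofReal (Real.exp ⟪Z q.1, q.2⟫ * Real.exp (-(13 / 12) * ‖q.2‖ ^ 2)) := by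
    have : Measurable fun q : Ω × EuclideanSpace ℝ (Fin d) => ⟪Z q.1, q.2⟫ :=
      (hZ.comp measurable_fst).inner measurable_snd
    fun_prop
  have hJm : Measurable J := hjm.lintegral_prod_right'
  have h1 : ENNReal.ofReal c * P {ω | r ≤ ‖Z ω‖} ≤ ∫⁻ ω, J ω ∂P := by
    calc _ ≤ ENNReal.ofReal c * P {ω | ENNReal.ofReal c ≤ J ω} := by
          gcongr
          intro hω
          refine lintegral_exp_inner_lower hd ?_ ?_ hω
          · rw [hr]; nlinarith
          · rw [hr, hρ]; nlinarith
      _ ≤ _ := mul_meas_ge_le_lintegral hJm _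
  have h2 : ∫⁻ ω, J ω ∂P ≤ ENNReal.ofReal ((Real.pi / (13 / 24)) ^ (d / 2 : ℝ)) := by
    rw [hJ, lintegral_lintegral_swap hjm.aemeasurable]
    calc _ ≤ ∫⁻ t in Metric.closedBall (0 : EuclideanSpace ℝ (Fin d)) ρ,
          ENNReal.ofReal (Real.exp (-(13 / 24) * ‖t‖ ^ 2)) := by
          refine setLIntegral_mono (by fun_prop) fun t ht => ?_
          have : ∀ ω, ENNReal.ofReal (Real.exp ⟪Z ω, t⟫ * Real.exp (-(13 / 12) * ‖t‖ ^ 2))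
              = ENNReal.ofReal (Real.exp ⟪Z ω, t⟫) *
                ENNReal.ofReal (Real.exp (-(13 / 12) * ‖t‖ ^ 2)) := fun ω =>
            ENNReal.ofReal_mul (Real.exp_pos _).le
          simp_rw [this]
          rw [lintegral_mul_const' _ _ ENNReal.ofReal_ne_top]
          calc _ ≤ ENNReal.ofReal (Real.exp (13 / 24 * ‖t‖ ^ 2)) *
                ENNReal.ofReal (Real.exp (-(13 / 12) * ‖t‖ ^ 2)) := by
                gcongr
                exact hmgf t (by simpa using ht)
            _ = _ := by
                rw [← ENNReal.ofReal_mul (Real.exp_pos _).le, ← Real.exp_add]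
                congr 2
                ring
      _ ≤ ∫⁻ t : EuclideanSpace ℝ (Fin d), ENNReal.ofReal (Real.exp (-(13 / 24) * ‖t‖ ^ 2)) :=
          setLIntegral_le_lintegral _ _
      _ = _ := by
          rw [← integral_exp_neg_mul_sq_norm (by norm_num), ofReal_integral_eq_lintegral_ofReal
            (integrable_exp_neg_mul_sq_norm (by norm_num)) (ae_of_all _ fun y => by positivity)]
  have h3 : (Real.pi / (13 / 24)) ^ (d / 2 : ℝ) ≤ c * Real.exp (-(d * s ^ 2 / 10)) := by
    have h4 := gaussian_ratio_le (b := 13 / 12) (c := 13 / 24) (by norm_num) (by norm_num) d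
    have h5 : (2 : ℝ) ≤ Real.exp (7 / 10 * d) := by
      have : Real.log 2 ≤ 7 / 10 * d := by linarith [Real.log_two_lt_d9]
      exact (Real.log_le_iff_le_exp (by norm_num)).1 this
    -- The exponent `3r²/13 = 147 s²d/1300` exceeds `s²d/10` by more than `(1/2 + 7/10) d` when `s ≥
    -- 12`; this covers the ratio of normalizations and the factor 2.
    have h6 : Real.exp ((13 / 12 / (13 / 24) - 1) / 2 * d) ≤
        1 / 2 * (Real.exp (3 / 13 * r ^ 2) * Real.exp (-(d * s ^ 2 / 10))) := by
      have h7 : Real.exp ((13 / 12 / (13 / 24) - 1) / 2 * d) * 2 ≤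
          Real.exp (3 / 13 * r ^ 2) * Real.exp (-(d * s ^ 2 / 10)) := by
        calc _ ≤ Real.exp ((13 / 12 / (13 / 24) - 1) / 2 * d) * Real.exp (7 / 10 * d) := by gcongr
          _ ≤ _ := by
            rw [← Real.exp_add, ← Real.exp_add, Real.exp_le_exp, hr2]
            have hs2 : 144 ≤ s ^ 2 := by nlinarith
            norm_num
            nlinarith
      linarith
    calc _ ≤ _ := h4
      _ ≤ (1 / 2 * (Real.exp (3 / 13 * r ^ 2) * Real.exp (-(d * s ^ 2 / 10)))) *
          (Real.pi / (13 / 12)) ^ (d / 2 : ℝ) := by gcongr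
      _ = _ := by rw [hc]; ring
  have h8 : ENNReal.ofReal c * P {ω | r ≤ ‖Z ω‖} ≤
      ENNReal.ofReal c * ENNReal.ofReal (Real.exp (-(d * s ^ 2 / 10))) := by
    rw [← ENNReal.ofReal_mul hcpos.le]
    exact h1.trans (h2.trans (ENNReal.ofReal_le_ofReal h3))
  exact (ENNReal.mul_le_mul_iff_right (by simpa using hcpos) ENNReal.ofReal_ne_top).1 h8

end Concentration

/-! ### Third-order calculus around the minimizer of a convex loss -/

section LineDerivatives

variable {E : Type*} [NormedAddCommGroup E] [NormedSpace ℝ E] {K : E → ℝ} {D : Set E}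

lemma contDiffOn_fderiv_two (hD : IsOpen D) (hK : ContDiffOn ℝ 3 K D) :
    ContDiffOn ℝ 2 (fderiv ℝ K) D :=
  hK.fderiv_of_isOpen hD (by norm_num)

lemma contDiffOn_fderiv_fderiv_one (hD : IsOpen D) (hK : ContDiffOn ℝ 3 K D) :
    ContDiffOn ℝ 1 (fderiv ℝ (fderiv ℝ K)) D :=
  (contDiffOn_fderiv_two hD hK).fderiv_of_isOpen hD (by norm_num)

lemma hasDerivAt_line (x v : E) (t : ℝ) : HasDerivAt (fun t : ℝ => x + t • v) v t := by
  simpa using ((hasDerivAt_id t).smul_const v).const_add x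

lemma hasDerivAt_comp_line (hD : IsOpen D) (hK : ContDiffOn ℝ 3 K D) {x v : E} {t : ℝ}
    (h : x + t • v ∈ D) :
    HasDerivAt (fun t : ℝ => K (x + t • v)) (fderiv ℝ K (x + t • v) v) t :=
  ((hK.contDiffAt (hD.mem_nhds h)).differentiableAt (by norm_num)).hasFDerivAt.comp_hasDerivAt t
    (hasDerivAt_line x v t)

lemma hasDerivAt_fderiv_comp_line (hD : IsOpen D) (hK : ContDiffOn ℝ 3 K D) {x v : E} (u : E)
    {t : ℝ} (h : x + t • v ∈ D) :
    HasDerivAt (fun t : ℝ => fderiv ℝ K (x + t • v) u)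
      (fderiv ℝ (fderiv ℝ K) (x + t • v) v u) t := by
  have h1 := (((contDiffOn_fderiv_two hD hK).contDiffAt (hD.mem_nhds h)).differentiableAt
    (by norm_num)).hasFDerivAt.comp_hasDerivAt t (hasDerivAt_line x v t)
  exact (ContinuousLinearMap.apply ℝ ℝ u).hasFDerivAt.comp_hasDerivAt t h1

lemma hasDerivAt_fderiv_fderiv_comp_line (hD : IsOpen D) (hK : ContDiffOn ℝ 3 K D) {x v : E}
    (u w : E) {t : ℝ} (h : x + t • v ∈ D) :
    HasDerivAt (fun t : ℝ => fderiv ℝ (fderiv ℝ K) (x + t • v) u w)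
      (fderiv ℝ (fderiv ℝ (fderiv ℝ K)) (x + t • v) v u w) t := by
  have h1 := (((contDiffOn_fderiv_fderiv_one hD hK).contDiffAt (hD.mem_nhds h)).differentiableAt
    (by norm_num)).hasFDerivAt.comp_hasDerivAt t (hasDerivAt_line x v t)
  have h2 := (ContinuousLinearMap.apply ℝ (E →L[ℝ] ℝ) u).hasFDerivAt.comp_hasDerivAt t h1
  exact (ContinuousLinearMap.apply ℝ ℝ w).hasFDerivAt.comp_hasDerivAt t h2

lemma fderiv_fderiv_symm (hD : IsOpen D) (hK : ContDiffOn ℝ 3 K D) {x : E} (hx : x ∈ D) (u v : E) :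
    fderiv ℝ (fderiv ℝ K) x u v = fderiv ℝ (fderiv ℝ K) x v u :=
  (hK.contDiffAt (hD.mem_nhds hx)).isSymmSndFDerivAt (by simp; norm_num) u v

lemma fderiv_fderiv_fderiv_symm_left (hD : IsOpen D) (hK : ContDiffOn ℝ 3 K D) {x : E}
    (hx : x ∈ D) (u v w : E) :
    fderiv ℝ (fderiv ℝ (fderiv ℝ K)) x u v w = fderiv ℝ (fderiv ℝ (fderiv ℝ K)) x v u w := by
  have h := ((contDiffOn_fderiv_two hD hK).contDiffAt (hD.mem_nhds hx)).isSymmSndFDerivAt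
    (by simp) u v
  rw [h]

/-- Differentiates the symmetry of the Hessian along the line in direction `u`. -/
lemma fderiv_fderiv_fderiv_symm_right (hD : IsOpen D) (hK : ContDiffOn ℝ 3 K D) {x : E}
    (hx : x ∈ D) (u v w : E) :
    fderiv ℝ (fderiv ℝ (fderiv ℝ K)) x u v w = fderiv ℝ (fderiv ℝ (fderiv ℝ K)) x u w v := by
  have hx0 : x + (0 : ℝ) • u ∈ D := by simpa using hx
  have h1 := hasDerivAt_fderiv_fderiv_comp_line hD hK v w hx0
  have h2 := hasDerivAt_fderiv_fderiv_comp_line hD hK w v hx0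
  have h3 : (fun t : ℝ => fderiv ℝ (fderiv ℝ K) (x + t • u) v w) =ᶠ[nhds 0]
      fun t : ℝ => fderiv ℝ (fderiv ℝ K) (x + t • u) w v := by
    have : ∀ᶠ t : ℝ in nhds 0, x + t • u ∈ D :=
      (by fun_prop : ContinuousAt (fun t : ℝ => x + t • u) 0).eventually_mem (hD.mem_nhds hx0)
    filter_upwards [this] with t ht
    exact fderiv_fderiv_symm hD hK ht v w
  have h4 := (h2.congr_of_eventuallyEq h3).unique h1
  simpa using h4.symm

end LineDerivatives

/-! ### Bounds on symmetric multilinear forms from their diagonals. -/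

section Polarization

variable {E : Type*} [NormedAddCommGroup E] [InnerProductSpace ℝ E]

/-- Each norm is at most 2, so each cube is at most twice the square, and the squares sum to 4 by
the parallelogram law. -/
lemma norm_add_cube_add_norm_sub_cube_le {h u : E} (hh : ‖h‖ = 1) (hu : ‖u‖ = 1) :
    ‖h + u‖ ^ 3 + ‖h - u‖ ^ 3 ≤ 8 := by
  have h1 : ‖h + u‖ ≤ 2 := (norm_add_le _ _).trans (by rw [hh, hu]; norm_num)
  have h2 : ‖h - u‖ ≤ 2 := (norm_sub_le _ _).trans (by rw [hh, hu]; norm_num)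
  have h3 := parallelogram_law_with_norm ℝ h u
  rw [hh, hu] at h3
  nlinarith [mul_nonneg (sq_nonneg ‖h + u‖) (sub_nonneg.2 h1),
    mul_nonneg (sq_nonneg ‖h - u‖) (sub_nonneg.2 h2)]

/-- Polarization of a symmetric trilinear form with one argument repeated. -/
lemma trilinear_polarization {T : E →L[ℝ] E →L[ℝ] E →L[ℝ] ℝ}
    (h12 : ∀ u v w, T u v w = T v u w) (h23 : ∀ u v w, T u v w = T u w v) {τ : ℝ}
    (hT : ∀ u, T u u u ≤ τ * ‖u‖ ^ 3) (h u : E) :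
    |T h u u| ≤ 5 / 3 * τ * ‖h‖ * ‖u‖ ^ 2 := by
  have habs : ∀ u, |T u u u| ≤ τ * ‖u‖ ^ 3 := fun u => by
    refine abs_le'.2 ⟨hT u, ?_⟩
    have := hT (-u)
    simp only [map_neg, neg_apply, norm_neg, neg_neg] at this
    exact this
  have hunit : ∀ h u : E, ‖h‖ = 1 → ‖u‖ = 1 → |T h u u| ≤ 5 / 3 * τ := by
    intro h u hh hu
    -- On unit vectors the two cubes contribute at most `8τ` and the last term `2τ`, which gives
    -- `10/6 = 5/3`.
    have e : 6 * T h u u = T (h + u) (h + u) (h + u) + T (h - u) (h - u) (h - u)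
        - 2 * T h h h := by
      simp only [map_add, map_sub, add_apply, sub_apply]
      have e1 := h12 u h u
      have e2 := h23 u u h
      linarith [h12 u h h, h23 h u h, h12 u h u, h23 u u h]
    have hτ : 0 ≤ τ := by
      have := (abs_nonneg _).trans (habs h)
      rwa [hh, one_pow, mul_one] at this
    have b1 := habs (h + u)
    have b2 := habs (h - u)
    have b3 := habs h
    rw [hh, one_pow, mul_one] at b3
    have b4 := mul_le_mul_of_nonneg_left (norm_add_cube_add_norm_sub_cube_le hh hu) hτ
    have b5 : |6 * T h u u| ≤ 10 * τ := by
      rw [e, abs_le]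
      rw [abs_le] at b1 b2 b3
      constructor <;> linarith
    rw [abs_mul, abs_of_pos (by norm_num : (0 : ℝ) < 6)] at b5
    linarith
  rcases eq_or_ne h 0 with rfl | hh
  · simp
  rcases eq_or_ne u 0 with rfl | hu
  · simp
  have hh0 : 0 < ‖h‖ := norm_pos_iff.2 hh
  have hu0 : 0 < ‖u‖ := norm_pos_iff.2 hu
  have := hunit (‖h‖⁻¹ • h) (‖u‖⁻¹ • u) (by rw [norm_smul, norm_inv, norm_norm, inv_mul_cancel₀ hh0.ne'])
    (by rw [norm_smul, norm_inv, norm_norm, inv_mul_cancel₀ hu0.ne'])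
  simp only [map_smul, smul_apply, smul_eq_mul, abs_mul, abs_inv,
    abs_norm] at this
  have e : |T h u u| = ‖h‖ * ‖u‖ ^ 2 * (‖h‖⁻¹ * (‖u‖⁻¹ * (‖u‖⁻¹ * |T h u u|))) := by
    field_simp
  rw [e]
  calc _ ≤ ‖h‖ * ‖u‖ ^ 2 * (5 / 3 * τ) := by
        refine mul_le_mul_of_nonneg_left (le_of_eq_of_le ?_ this) (by positivity)
        ring
    _ = _ := by ring

/-- On unit vectors, polarize with `u ± v` and use the parallelogram law; then rescale. -/
lemma bilinear_polarization {B : E →L[ℝ] E →L[ℝ] ℝ} (hB : ∀ u v, B u v = B v u) {ε : ℝ}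
    (h : ∀ u, |B u u| ≤ ε * ‖u‖ ^ 2) (u v : E) : |B u v| ≤ ε * ‖u‖ * ‖v‖ := by
  have hunit : ∀ u v : E, ‖u‖ = 1 → ‖v‖ = 1 → |B u v| ≤ ε := by
    intro u v hu hv
    have e : 4 * B u v = B (u + v) (u + v) - B (u - v) (u - v) := by
      simp only [map_add, map_sub, add_apply, sub_apply]
      linarith [hB u v]
    have h3 := parallelogram_law_with_norm ℝ u v
    rw [hu, hv] at h3
    have b1 := h (u + v)
    have b2 := h (u - v)
    have b3 : |4 * B u v| ≤ 4 * ε := by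
      rw [e, abs_le]
      rw [abs_le] at b1 b2
      constructor <;> nlinarith
    rw [abs_mul, abs_of_pos (by norm_num : (0 : ℝ) < 4)] at b3
    linarith
  rcases eq_or_ne u 0 with rfl | hu
  · simp
  rcases eq_or_ne v 0 with rfl | hv
  · simp
  have hu0 : 0 < ‖u‖ := norm_pos_iff.2 hu
  have hv0 : 0 < ‖v‖ := norm_pos_iff.2 hv
  have := hunit (‖u‖⁻¹ • u) (‖v‖⁻¹ • v) (by rw [norm_smul, norm_inv, norm_norm, inv_mul_cancel₀ hu0.ne'])
    (by rw [norm_smul, norm_inv, norm_norm, inv_mul_cancel₀ hv0.ne'])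
  simp only [map_smul, smul_apply, smul_eq_mul, abs_mul, abs_inv,
    abs_norm] at this
  have e : |B u v| = ‖u‖ * ‖v‖ * (‖v‖⁻¹ * (‖u‖⁻¹ * |B u v|)) := by
    field_simp
  rw [e]
  calc _ ≤ ‖u‖ * ‖v‖ * ε := by
        refine mul_le_mul_of_nonneg_left (le_of_eq_of_le ?_ this) (by positivity)
        ring
    _ = _ := by ring

end Polarization

/-! ### One-dimensional Taylor bounds. -/

section Taylor

lemma nonpos_of_hasDerivAt_nonpos {φ φ' : ℝ → ℝ} (h0 : φ 0 ≤ 0)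
    (hd : ∀ t ∈ Set.Icc (0 : ℝ) 1, HasDerivAt φ (φ' t) t)
    (hn : ∀ t ∈ Set.Icc (0 : ℝ) 1, φ' t ≤ 0) : ∀ t ∈ Set.Icc (0 : ℝ) 1, φ t ≤ 0 := by
  have hanti : AntitoneOn φ (Set.Icc 0 1) := by
    refine antitoneOn_of_deriv_nonpos (convex_Icc 0 1)
      (fun t ht => (hd t ht).continuousAt.continuousWithinAt)
      (fun t ht => ((hd t (interior_subset ht)).differentiableAt).differentiableWithinAt)
      fun t ht => ?_
    rw [(hd t (interior_subset ht)).deriv]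
    exact hn t (interior_subset ht)
  exact fun t ht => (hanti ⟨le_rfl, zero_le_one⟩ ht ht.1).trans h0

/-- Integrates the bound on `g₃` three times: each remainder vanishes at 0 and its derivative is the
previous remainder, already known to be nonpositive. -/
lemma taylor_three_upper {g g₁ g₂ g₃ : ℝ → ℝ} {c : ℝ}
    (h1 : ∀ t ∈ Set.Icc (0 : ℝ) 1, HasDerivAt g (g₁ t) t)
    (h2 : ∀ t ∈ Set.Icc (0 : ℝ) 1, HasDerivAt g₁ (g₂ t) t)
    (h3 : ∀ t ∈ Set.Icc (0 : ℝ) 1, HasDerivAt g₂ (g₃ t) t)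
    (hc : ∀ t ∈ Set.Icc (0 : ℝ) 1, g₃ t ≤ c) : g 1 - g 0 - g₁ 0 - g₂ 0 / 2 ≤ c / 6 := by
  have k2 := nonpos_of_hasDerivAt_nonpos (φ := fun t => g₂ t - g₂ 0 - c * t) (by simp)
    (fun t ht => ((h3 t ht).sub_const (g₂ 0)).sub ((hasDerivAt_id t).const_mul c))
    (fun t ht => by have := hc t ht; simp only [mul_one]; linarith)
  have k1 := nonpos_of_hasDerivAt_nonpos
    (φ := fun t => g₁ t - g₁ 0 - g₂ 0 * t - c / 2 * t ^ 2) (by simp)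
    (fun t ht => (((h2 t ht).sub_const (g₁ 0)).sub ((hasDerivAt_id t).const_mul (g₂ 0))).sub
      ((hasDerivAt_pow 2 t).const_mul (c / 2)))
    (fun t ht => by have := k2 t ht; simp at this ⊢; linarith)
  have k0 := nonpos_of_hasDerivAt_nonpos
    (φ := fun t => g t - g 0 - g₁ 0 * t - g₂ 0 / 2 * t ^ 2 - c / 6 * t ^ 3) (by simp)
    (fun t ht => ((((h1 t ht).sub_const (g 0)).sub ((hasDerivAt_id t).const_mul (g₁ 0))).sub
      ((hasDerivAt_pow 2 t).const_mul (g₂ 0 / 2))).sub ((hasDerivAt_pow 3 t).const_mul (c / 6)))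
    (fun t ht => by have := k1 t ht; simp at this ⊢; linarith)
  have := k0 1 ⟨zero_le_one, le_rfl⟩
  simp at this
  linarith

lemma taylor_three {g g₁ g₂ g₃ : ℝ → ℝ} {c : ℝ}
    (h1 : ∀ t ∈ Set.Icc (0 : ℝ) 1, HasDerivAt g (g₁ t) t)
    (h2 : ∀ t ∈ Set.Icc (0 : ℝ) 1, HasDerivAt g₁ (g₂ t) t)
    (h3 : ∀ t ∈ Set.Icc (0 : ℝ) 1, HasDerivAt g₂ (g₃ t) t)
    (hc : ∀ t ∈ Set.Icc (0 : ℝ) 1, |g₃ t| ≤ c) : |g 1 - g 0 - g₁ 0 - g₂ 0 / 2| ≤ c / 6 := by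
  refine abs_le'.2 ⟨taylor_three_upper h1 h2 h3 fun t ht => (abs_le.1 (hc t ht)).2, ?_⟩
  have := taylor_three_upper (c := c) (fun t ht => (h1 t ht).neg) (fun t ht => (h2 t ht).neg)
    (fun t ht => (h3 t ht).neg) fun t ht => by have := (abs_le.1 (hc t ht)).1; linarith
  simp only [Pi.neg_apply] at this
  linarith

end Taylor

/-! ### The whitened loss: Taylor estimates and its minimizer. -/

section WhitenedLoss

variable {d : ℕ}

/-- The inner product as a continuous bilinear map. -/
noncomputable def innerBilin (d : ℕ) :
    EuclideanSpace ℝ (Fin d) →L[ℝ] EuclideanSpace ℝ (Fin d) →L[ℝ] ℝ :=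
  (innerₗ (EuclideanSpace ℝ (Fin d))).mkContinuous₂ 1 fun x y => by
    simpa using norm_inner_le_norm (𝕜 := ℝ) x y

@[simp]
lemma innerBilin_apply (x y : EuclideanSpace ℝ (Fin d)) : innerBilin d x y = ⟪x, y⟫ := rfl

/-- A convex `C³` loss `K` on an open convex set `D`, in coordinates in which its Hessian at the
origin is the identity, with a bound `τ` for its third derivative on a ball. -/
structure WhitenedLoss (s τ : ℝ) (D : Set (EuclideanSpace ℝ (Fin d)))
    (K : EuclideanSpace ℝ (Fin d) → ℝ) : Prop where
  dim_pos : 0 < d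
  s_ge : 12 ≤ s
  τ_nonneg : 0 ≤ τ
  τ_le : 2 * s * √d * τ ≤ 1 / 4
  isOpen : IsOpen D
  convexOn : ConvexOn ℝ D K
  contDiffOn : ContDiffOn ℝ 3 K D
  ball_subset : Metric.closedBall 0 (2 * s * √d) ⊆ D
  hessian : ∀ u, fderiv ℝ (fderiv ℝ K) 0 u u = ‖u‖ ^ 2
  third : ∀ x ∈ Metric.closedBall (0 : EuclideanSpace ℝ (Fin d)) (2 * s * √d), ∀ u,
    fderiv ℝ (fderiv ℝ (fderiv ℝ K)) x u u u ≤ τ * ‖u‖ ^ 3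

namespace WhitenedLoss

variable {s τ : ℝ} {D : Set (EuclideanSpace ℝ (Fin d))} {K : EuclideanSpace ℝ (Fin d) → ℝ}

lemma radius_pos (H : WhitenedLoss s τ D K) : 0 < s * √d := by
  have := H.s_ge
  have : 0 < √(d : ℝ) := Real.sqrt_pos.2 (by exact_mod_cast H.dim_pos)
  positivity

lemma abs_third_le (H : WhitenedLoss s τ D K) {x : EuclideanSpace ℝ (Fin d)}
    (hx : x ∈ Metric.closedBall 0 (2 * s * √d)) (u : EuclideanSpace ℝ (Fin d)) :
    |fderiv ℝ (fderiv ℝ (fderiv ℝ K)) x u u u| ≤ τ * ‖u‖ ^ 3 := by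
  refine abs_le'.2 ⟨H.third x hx u, ?_⟩
  have := H.third x hx (-u)
  simp only [map_neg, neg_apply, norm_neg, neg_neg] at this
  exact this

lemma smul_mem_closedBall {r : ℝ} {x : EuclideanSpace ℝ (Fin d)}
    (hx : x ∈ Metric.closedBall 0 r) {t : ℝ} (ht : t ∈ Set.Icc (0 : ℝ) 1) :
    (0 : EuclideanSpace ℝ (Fin d)) + t • x ∈ Metric.closedBall 0 r := by
  rw [zero_add, mem_closedBall_zero_iff, norm_smul, Real.norm_of_nonneg ht.1]
  rw [mem_closedBall_zero_iff] at hx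
  exact (mul_le_of_le_one_left (norm_nonneg _) ht.2).trans hx

/-- Third-order Taylor expansion at the origin. -/
lemma taylor (H : WhitenedLoss s τ D K) {x : EuclideanSpace ℝ (Fin d)}
    (hx : x ∈ Metric.closedBall 0 (2 * s * √d)) :
    |K x - K 0 - fderiv ℝ K 0 x - ‖x‖ ^ 2 / 2| ≤ τ * ‖x‖ ^ 3 / 6 := by
  have hm := fun t (ht : t ∈ Set.Icc (0 : ℝ) 1) => smul_mem_closedBall hx ht
  have := taylor_three
    (fun t ht => hasDerivAt_comp_line H.isOpen H.contDiffOn (H.ball_subset (hm t ht)))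
    (fun t ht => hasDerivAt_fderiv_comp_line H.isOpen H.contDiffOn x (H.ball_subset (hm t ht)))
    (fun t ht => hasDerivAt_fderiv_fderiv_comp_line H.isOpen H.contDiffOn x x
      (H.ball_subset (hm t ht)))
    (fun t ht => H.abs_third_le (hm t ht) x)
  simpa [H.hessian] using this

/-- Along the segment from the origin to `x`, the diagonal Hessian entry at `u` has derivative
`K'''[x, u, u]`, to which `trilinear_polarization` applies. -/
lemma abs_hessian_sub_le (H : WhitenedLoss s τ D K) {x : EuclideanSpace ℝ (Fin d)}
    (hx : x ∈ Metric.closedBall 0 (2 * s * √d)) (u : EuclideanSpace ℝ (Fin d)) :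
    |fderiv ℝ (fderiv ℝ K) x u u - ‖u‖ ^ 2| ≤ 5 / 3 * τ * (2 * s * √d) * ‖u‖ ^ 2 := by
  have hm := fun t (ht : t ∈ Set.Icc (0 : ℝ) 1) => smul_mem_closedBall hx ht
  have h := norm_image_sub_le_of_norm_deriv_le_segment_01'
    (fun t ht => (hasDerivAt_fderiv_fderiv_comp_line H.isOpen H.contDiffOn u u
      (H.ball_subset (hm t ht))).hasDerivWithinAt)
    (fun t ht => (trilinear_polarization (T := fderiv ℝ (fderiv ℝ (fderiv ℝ K)) (0 + t • x))
      (fderiv_fderiv_fderiv_symm_left H.isOpen H.contDiffOn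
        (H.ball_subset (hm t ⟨ht.1, ht.2.le⟩)))
      (fderiv_fderiv_fderiv_symm_right H.isOpen H.contDiffOn
        (H.ball_subset (hm t ⟨ht.1, ht.2.le⟩)))
      (H.third _ (hm t ⟨ht.1, ht.2.le⟩)) x u))
  simp only [zero_add, one_smul, zero_smul, H.hessian, Real.norm_eq_abs] at h
  refine h.trans ?_
  have h1 := H.τ_nonneg
  have hx' : ‖x‖ ≤ 2 * s * √d := by simpa using hx
  gcongr

lemma norm_hessian_sub_le (H : WhitenedLoss s τ D K) {x : EuclideanSpace ℝ (Fin d)}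
    (hx : x ∈ Metric.closedBall 0 (2 * s * √d)) :
    ‖fderiv ℝ (fderiv ℝ K) x - innerBilin d‖ ≤ 5 / 3 * τ * (2 * s * √d) := by
  have h0 : 0 ≤ 5 / 3 * τ * (2 * s * √d) := by
    have := H.τ_nonneg
    have := H.s_ge
    positivity
  have hb := bilinear_polarization (B := fderiv ℝ (fderiv ℝ K) x - innerBilin d)
    (ε := 5 / 3 * τ * (2 * s * √d))
    (fun u v => by
      simp only [sub_apply, innerBilin_apply]
      rw [fderiv_fderiv_symm H.isOpen H.contDiffOn (H.ball_subset hx), real_inner_comm])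
    (fun u => by
      simp only [sub_apply, innerBilin_apply, real_inner_self_eq_norm_sq]
      exact H.abs_hessian_sub_le hx u)
  refine ContinuousLinearMap.opNorm_le_bound _ h0 fun u => ?_
  exact ContinuousLinearMap.opNorm_le_bound _ (by positivity) fun v => hb u v

/-- The gradient minus the identity has derivative `∇²K - I`, bounded on the convex ball. This is
the main estimate on `K`: it gives strict growth at the minimizer and the term `ε‖y‖` in the
Gaussian comparison. -/
lemma norm_gradient_sub_le (H : WhitenedLoss s τ D K) {x x' : EuclideanSpace ℝ (Fin d)}
    (hx : x ∈ Metric.closedBall 0 (2 * s * √d)) (hx' : x' ∈ Metric.closedBall 0 (2 * s * √d)) :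
    ‖fderiv ℝ K x - fderiv ℝ K x' - innerBilin d (x - x')‖
      ≤ 5 / 3 * τ * (2 * s * √d) * ‖x - x'‖ := by
  have h := Convex.norm_image_sub_le_of_norm_hasFDerivWithin_le (𝕜 := ℝ)
    (f := fun x => fderiv ℝ K x - innerBilin d x)
    (f' := fun x => fderiv ℝ (fderiv ℝ K) x - innerBilin d)
    (s := Metric.closedBall 0 (2 * s * √d))
    (fun y hy => by
      have h1 := (((contDiffOn_fderiv_two H.isOpen H.contDiffOn).contDiffAt
        (H.isOpen.mem_nhds (H.ball_subset hy))).differentiableAt (by norm_num)).hasFDerivAt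
      exact (h1.sub (innerBilin d).hasFDerivAt).hasFDerivWithinAt)
    (fun y hy => H.norm_hessian_sub_le hy) (convex_closedBall _ _) hx' hx
  refine le_of_eq_of_le ?_ h
  congr 1
  rw [map_sub]
  abel

lemma slope_le (H : WhitenedLoss s τ D K) : 5 / 3 * τ * (2 * s * √d) ≤ 5 / 12 := by
  have := H.τ_le
  linarith

/-- If the gradient noise is small, then the tilted loss has a unique minimizer, which lies well
inside the ball on which the third derivative is controlled. -/
theorem exists_minimizer (H : WhitenedLoss s τ D K) (b : EuclideanSpace ℝ (Fin d))
    (hb : ∀ u, fderiv ℝ K 0 u - ⟪b, u⟫ ≥ -(7 / 10 * (s * √d) * ‖u‖)) :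
    ∃ x ∈ D, ‖x‖ ≤ 3 / 2 * (s * √d) ∧ fderiv ℝ K x = innerBilin d b ∧
      (∀ y ∈ D, K x - ⟪b, x⟫ ≤ K y - ⟪b, y⟫) ∧
      ∀ y ∈ D, K y - ⟪b, y⟫ ≤ K x - ⟪b, x⟫ → y = x := by
  have hr := H.radius_pos
  set ρ := s * √d with hρ
  have hρ2 : 2 * s * √d = 2 * ρ := by rw [hρ]; ring
  have hsub : Metric.closedBall (0 : EuclideanSpace ℝ (Fin d)) (3 / 2 * ρ) ⊆
      Metric.closedBall 0 (2 * s * √d) := Metric.closedBall_subset_closedBall (by linarith)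
  set Φ : EuclideanSpace ℝ (Fin d) → ℝ := fun y => K y - ⟪b, y⟫ with hΦ
  have hΦc : ContinuousOn Φ D := H.contDiffOn.continuousOn.sub (by fun_prop)
  have hconv : ConvexOn ℝ D Φ := by
    refine H.convexOn.sub ((innerBilin d b).toLinearMap.concaveOn H.convexOn.1)
  obtain ⟨x, hxB, hxmin⟩ := (isCompact_closedBall (0 : EuclideanSpace ℝ (Fin d))
    (3 / 2 * ρ)).exists_isMinOn ⟨0, by simp; positivity⟩
    (hΦc.mono (hsub.trans H.ball_subset))
  have hxD : x ∈ D := H.ball_subset (hsub hxB)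
  have hxn : ‖x‖ ≤ 3 / 2 * ρ := by simpa using hxB
  -- On the sphere of radius `3ρ/2` the increment from the origin is at least `(9/8 - 21/20 - 9/128)
  -- ρ²`, from the quadratic term, the gradient noise and the cubic remainder. This is just
  -- positive, so the minimum over the ball is interior.
  have hlt : ‖x‖ < 3 / 2 * ρ := by
    refine lt_of_le_of_ne hxn fun heq => ?_
    have h0 : Φ x ≤ Φ 0 := hxmin (by simp; positivity)
    have h1 := (abs_le.1 (H.taylor (hsub hxB))).1
    have h2 := hb x
    have h3 : τ * ρ ≤ 1 / 8 := by
      have := H.τ_le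
      rw [hρ2] at this
      linarith
    simp only [hΦ, inner_zero_right] at h0
    rw [heq] at h1 h2
    have h4 : τ * (3 / 2 * ρ) ^ 3 / 6 ≤ 9 / 16 * (1 / 8) * ρ ^ 2 := by
      have : τ * (3 / 2 * ρ) ^ 3 / 6 = 9 / 16 * (τ * ρ) * ρ ^ 2 := by ring
      rw [this]
      gcongr
    nlinarith [sq_pos_of_pos hr]
  have hloc : IsLocalMin Φ x := by
    have : Metric.closedBall (0 : EuclideanSpace ℝ (Fin d)) (3 / 2 * ρ) ∈ nhds x :=
      Filter.mem_of_superset (Metric.isOpen_ball.mem_nhds (by simpa using hlt))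
        Metric.ball_subset_closedBall
    exact hxmin.isLocalMin this
  have hmin : ∀ y ∈ D, Φ x ≤ Φ y :=
    IsMinOn.of_isLocalMinOn_of_convexOn hxD (hloc.on D) hconv
  have hgrad : fderiv ℝ K x = innerBilin d b := by
    have h1 := ((H.contDiffOn.contDiffAt (H.isOpen.mem_nhds hxD)).differentiableAt
      (by norm_num)).hasFDerivAt
    have h2 : HasFDerivAt Φ (fderiv ℝ K x - innerBilin d b) x := h1.sub (innerBilin d b).hasFDerivAt
    exact sub_eq_zero.1 (hloc.hasFDerivAt_eq_zero h2)
  refine ⟨x, hxD, hxn, hgrad, hmin, fun y hy hyx => ?_⟩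
  by_contra hne
  -- strict growth at `x` on a short segment towards `y`
  set v := y - x with hv
  have hv0 : 0 < ‖v‖ := norm_pos_iff.2 (sub_ne_zero.2 hne)
  -- A step of length at most `ρ/2` from `x` remains in the ball of radius `2ρ`, where the gradient
  -- estimate holds.
  obtain ⟨t, ht0, ht1, htv⟩ : ∃ t : ℝ, 0 < t ∧ t ≤ 1 ∧ t * ‖v‖ ≤ ρ / 2 := by
    refine ⟨min 1 (ρ / 2 / ‖v‖), by positivity, min_le_left _ _, ?_⟩
    calc _ ≤ ρ / 2 / ‖v‖ * ‖v‖ := by gcongr; exact min_le_right _ _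
      _ = _ := by field_simp
  set w := t • v with hw
  have hwn : ‖w‖ = t * ‖v‖ := by rw [hw, norm_smul, Real.norm_of_nonneg ht0.le]
  have hw0 : 0 < ‖w‖ := by rw [hwn]; positivity
  have hseg : ∀ r ∈ Set.Icc (0 : ℝ) 1, x + r • w ∈ Metric.closedBall 0 (2 * s * √d) := by
    intro r hr'
    rw [mem_closedBall_zero_iff, hρ2]
    calc _ ≤ ‖x‖ + ‖r • w‖ := norm_add_le _ _
      _ ≤ 3 / 2 * ρ + ρ / 2 := by
        rw [norm_smul, Real.norm_of_nonneg hr'.1]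
        refine add_le_add hxn ?_
        exact (mul_le_of_le_one_left (norm_nonneg _) hr'.2).trans (hwn ▸ htv)
      _ = _ := by ring
  have hgrow : 0 < Φ (x + w) - Φ x := by
    -- The slope in direction `w` increases at rate at least `(1 - 5/12)‖w‖² = 7/12 ‖w‖²`, hence
    -- quadratic growth with constant `7/24`.
    have h1 := nonpos_of_hasDerivAt_nonpos
      (φ := fun r : ℝ => (7 / 24) * ‖w‖ ^ 2 * r ^ 2 + (K x + r * ⟪b, w⟫) - K (x + r • w))
      (φ' := fun r => (7 / 24) * ‖w‖ ^ 2 * (2 * r) + ⟪b, w⟫ - fderiv ℝ K (x + r • w) w)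
      (by simp)
      (fun r hr' => by
        have e1 := hasDerivAt_comp_line H.isOpen H.contDiffOn (H.ball_subset (hseg r hr'))
        have e2 := ((hasDerivAt_pow 2 r).const_mul ((7 / 24) * ‖w‖ ^ 2))
        have e3 := ((hasDerivAt_id r).mul_const ⟪b, w⟫).const_add (K x)
        exact ((e2.add e3).sub e1).congr_deriv (by simp))
      (fun r hr' => by
        have h2 := H.norm_gradient_sub_le (hseg r hr') (hsub hxB)
        rw [add_sub_cancel_left, norm_smul, Real.norm_of_nonneg hr'.1] at h2
        have h3 := (ContinuousLinearMap.le_opNorm (fderiv ℝ K (x + r • w) - fderiv ℝ K x -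
          innerBilin d (r • w)) w).trans (mul_le_mul_of_nonneg_right h2 (norm_nonneg w))
        rw [hgrad] at h3
        simp only [sub_apply, innerBilin_apply, real_inner_smul_left,
          real_inner_self_eq_norm_sq, Real.norm_eq_abs] at h3
        have h4 := (abs_le.1 h3).1
        have h5 : 5 / 3 * τ * (2 * s * √d) * (r * ‖w‖) * ‖w‖ ≤ 5 / 12 * (r * ‖w‖) * ‖w‖ := by
          have := H.slope_le
          have := hr'.1
          gcongr
        show (7 / 24) * ‖w‖ ^ 2 * (2 * r) + ⟪b, w⟫ - fderiv ℝ K (x + r • w) w ≤ 0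
        nlinarith)
    have h2 := h1 1 ⟨zero_le_one, le_rfl⟩
    simp only [one_smul] at h2
    simp only [hΦ, inner_add_right]
    nlinarith [sq_pos_of_pos hw0]
  have hle : Φ (x + w) ≤ Φ x := by
    have e : x + w = (1 - t) • x + t • y := by
      rw [hw, hv, smul_sub, sub_smul, one_smul]
      abel
    rw [e]
    have := hconv.2 hxD hy (sub_nonneg.2 ht1) ht0.le (by ring)
    refine this.trans ?_
    simp only [smul_eq_mul]
    nlinarith
  linarith

end WhitenedLoss

end WhitenedLoss

/-! ### Integrals of exponentials of the norm. -/

section ExpNorm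

lemma integral_exp_neg_mul_abs {c : ℝ} (hc : 0 < c) :
    ∫ x : ℝ, Real.exp (-c * |x|) = 2 / c := by
  rw [integral_comp_abs (f := fun x => Real.exp (-c * x)), integral_exp_mul_Ioi (by linarith)]
  simp
  field_simp

lemma integrable_exp_neg_mul_abs {c : ℝ} (hc : 0 < c) :
    Integrable fun x : ℝ => Real.exp (-c * |x|) := by
  by_contra h
  have h1 := integral_undef h
  rw [integral_exp_neg_mul_abs hc] at h1
  have : 0 < 2 / c := by positivity
  linarith

variable {d : ℕ}

/-- By `‖y‖₁ ≤ √d ‖y‖₂` the radial exponential is dominated by a product of one-dimensional Laplace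
weights, whose integral is explicit. -/
lemma exp_neg_mul_norm_le (hd : 0 < d) {c : ℝ} (hc : 0 < c) (y : EuclideanSpace ℝ (Fin d)) :
    Real.exp (-c * ‖y‖) ≤ ∏ i, Real.exp (-(c / √d) * |y i|) := by
  have hd0 : 0 < √(d : ℝ) := Real.sqrt_pos.2 (by exact_mod_cast hd)
  rw [← Real.exp_sum, Real.exp_le_exp, ← Finset.mul_sum]
  have h1 : ∑ i, |y i| ≤ √d * ‖y‖ := by
    apply le_of_sq_le_sq _ (by positivity)
    rw [mul_pow, Real.sq_sqrt (by positivity), EuclideanSpace.real_norm_sq_eq]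
    have := sq_sum_le_card_mul_sum_sq (s := Finset.univ) (f := fun i => |y i|)
    simpa using this
  have h2 : c / √d * ∑ i, |y i| ≤ c / √d * (√d * ‖y‖) := by gcongr
  have h3 : c / √d * (√d * ‖y‖) = c * ‖y‖ := by field_simp
  linarith

lemma integrable_prod_exp_neg_mul_abs {c : ℝ} (hc : 0 < c) :
    Integrable (fun y : EuclideanSpace ℝ (Fin d) => ∏ i, Real.exp (-c * |y i|)) := by
  have h := Integrable.fintype_prod (μ := fun _ : Fin d => (volume : Measure ℝ))
    (f := fun _ x => Real.exp (-c * |x|)) fun _ => integrable_exp_neg_mul_abs hc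
  exact (PiLp.volume_preserving_ofLp (Fin d)).integrable_comp_of_integrable h

lemma integrable_exp_neg_mul_norm (hd : 0 < d) {c : ℝ} (hc : 0 < c) :
    Integrable fun y : EuclideanSpace ℝ (Fin d) => Real.exp (-c * ‖y‖) := by
  have hd0 : 0 < √(d : ℝ) := Real.sqrt_pos.2 (by exact_mod_cast hd)
  refine (integrable_prod_exp_neg_mul_abs (d := d) (div_pos hc hd0)).mono'
    (by fun_prop) (ae_of_all _ fun y => ?_)
  rw [Real.norm_of_nonneg (Real.exp_pos _).le]
  exact exp_neg_mul_norm_le hd hc y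

lemma integral_exp_neg_mul_norm_le (hd : 0 < d) {c : ℝ} (hc : 0 < c) :
    ∫ y : EuclideanSpace ℝ (Fin d), Real.exp (-c * ‖y‖) ≤ (2 * √d / c) ^ d := by
  have hd0 : 0 < √(d : ℝ) := Real.sqrt_pos.2 (by exact_mod_cast hd)
  calc _ ≤ ∫ y : EuclideanSpace ℝ (Fin d), ∏ i, Real.exp (-(c / √d) * |y i|) :=
        integral_mono (integrable_exp_neg_mul_norm hd hc)
          (integrable_prod_exp_neg_mul_abs (div_pos hc hd0)) (exp_neg_mul_norm_le hd hc)
    _ = ∫ y : Fin d → ℝ, ∏ i, Real.exp (-(c / √d) * |y i|) :=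
        (PiLp.volume_preserving_ofLp (Fin d)).integral_comp
          (MeasurableEquiv.toLp 2 (Fin d → ℝ)).symm.measurableEmbedding
          (fun y : Fin d → ℝ => ∏ i, Real.exp (-(c / √d) * |y i|))
    _ = (∫ x : ℝ, Real.exp (-(c / √d) * |x|)) ^ d := by
        rw [integral_fintype_prod_volume_eq_pow (fun x : ℝ => Real.exp (-(c / √d) * |x|))]
        simp
    _ = _ := by
        rw [integral_exp_neg_mul_abs (div_pos hc hd0)]
        congr 1
        field_simp

end ExpNorm

/-! ### The posterior weight centered at the minimizer. -/

section CenteredWeight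

variable {d : ℕ}

/-- The loss increment from `xhat`, with the linear part removed. -/
noncomputable def lossIncrement (K : EuclideanSpace ℝ (Fin d) → ℝ)
    (b xhat y : EuclideanSpace ℝ (Fin d)) : ℝ :=
  K (xhat + y) - K xhat - ⟪b, y⟫

/-- The unnormalized posterior weight in coordinates centered at the minimizer `xhat`. -/
noncomputable def centeredWeight (D : Set (EuclideanSpace ℝ (Fin d)))
    (K p : EuclideanSpace ℝ (Fin d) → ℝ) (b xhat y : EuclideanSpace ℝ (Fin d)) : ℝ :=
  ((xhat + ·) ⁻¹' D).indicator
    (fun y => p (xhat + y) / p xhat * Real.exp (-lossIncrement K b xhat y)) y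

namespace WhitenedLoss

variable {s τ : ℝ} {D : Set (EuclideanSpace ℝ (Fin d))} {K p : EuclideanSpace ℝ (Fin d) → ℝ}
  {b xhat : EuclideanSpace ℝ (Fin d)}

lemma add_mem_ball (hx : ‖xhat‖ ≤ 3 / 2 * (s * √d))
    {y : EuclideanSpace ℝ (Fin d)} (hy : y ∈ Metric.ball 0 (s * √d / 2)) :
    xhat + y ∈ Metric.ball 0 (2 * s * √d) := by
  rw [mem_ball_zero_iff] at hy ⊢
  calc _ ≤ ‖xhat‖ + ‖y‖ := norm_add_le _ _
    _ < 3 / 2 * (s * √d) + s * √d / 2 := by linarith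
    _ = _ := by ring

lemma add_mem_closedBall (hx : ‖xhat‖ ≤ 3 / 2 * (s * √d))
    {y : EuclideanSpace ℝ (Fin d)} (hy : ‖y‖ ≤ s * √d / 2) :
    xhat + y ∈ Metric.closedBall 0 (2 * s * √d) := by
  rw [mem_closedBall_zero_iff]
  calc _ ≤ ‖xhat‖ + ‖y‖ := norm_add_le _ _
    _ ≤ 3 / 2 * (s * √d) + s * √d / 2 := by linarith
    _ = _ := by ring

lemma xhat_mem (H : WhitenedLoss s τ D K) (hx : ‖xhat‖ ≤ 3 / 2 * (s * √d)) :
    xhat ∈ Metric.closedBall (0 : EuclideanSpace ℝ (Fin d)) (2 * s * √d) := by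
  have := add_mem_closedBall hx (y := 0) (by rw [norm_zero]; have := H.radius_pos; linarith)
  simpa using this

lemma hasFDerivAt_lossIncrement (H : WhitenedLoss s τ D K) {y : EuclideanSpace ℝ (Fin d)}
    (hy : xhat + y ∈ D) :
    HasFDerivAt (lossIncrement K b xhat) (fderiv ℝ K (xhat + y) - innerBilin d b) y := by
  have h1 : HasFDerivAt K (fderiv ℝ K (xhat + y)) (xhat + y) :=
    ((H.contDiffOn.contDiffAt (H.isOpen.mem_nhds hy)).differentiableAt
      (by norm_num)).hasFDerivAt
  have h2 : HasFDerivAt (fun y => K (xhat + y)) (fderiv ℝ K (xhat + y)) y := by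
    rw [hasFDerivAt_comp_add_left]
    exact h1
  exact (h2.sub_const (K xhat)).sub (innerBilin d b).hasFDerivAt

lemma norm_gradient_increment_le (H : WhitenedLoss s τ D K) (hx : ‖xhat‖ ≤ 3 / 2 * (s * √d))
    (hgrad : fderiv ℝ K xhat = innerBilin d b) {y : EuclideanSpace ℝ (Fin d)}
    (hy : ‖y‖ ≤ s * √d / 2) :
    ‖innerBilin d y - (fderiv ℝ K (xhat + y) - innerBilin d b)‖
      ≤ 5 / 3 * τ * (2 * s * √d) * ‖y‖ := by
  have h := H.norm_gradient_sub_le (add_mem_closedBall hx hy) (H.xhat_mem hx)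
  rw [add_sub_cancel_left, hgrad] at h
  rwa [← norm_neg, neg_sub]

/-- Lower bound of the loss increment on the ball around the minimizer. -/
lemma lossIncrement_ge (H : WhitenedLoss s τ D K) (hx : ‖xhat‖ ≤ 3 / 2 * (s * √d))
    (hgrad : fderiv ℝ K xhat = innerBilin d b) {y : EuclideanSpace ℝ (Fin d)}
    (hy : ‖y‖ ≤ s * √d / 2) :
    (1 / 2 - 5 / 3 * τ * (2 * s * √d)) * ‖y‖ ^ 2 ≤ lossIncrement K b xhat y := by
  have hle : ∀ z ∈ Metric.closedBall (0 : EuclideanSpace ℝ (Fin d)) ‖y‖, ‖z‖ ≤ ‖y‖ :=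
    fun z hz => by simpa using hz
  -- The gradient of `‖y‖²/2 - lossIncrement` is at most `ε‖y‖` on the ball of radius `‖y‖`, so this
  -- difference is at most `ε‖y‖²`.
  have h := Convex.norm_image_sub_le_of_norm_hasFDerivWithin_le (𝕜 := ℝ)
    (f := fun y => 1 / 2 * ‖y‖ ^ 2 - lossIncrement K b xhat y)
    (f' := fun y => innerBilin d y - (fderiv ℝ K (xhat + y) - innerBilin d b))
    (C := 5 / 3 * τ * (2 * s * √d) * ‖y‖)
    (s := Metric.closedBall 0 ‖y‖) (x := 0) (y := y)
    (fun z hz => by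
      have hz' := H.ball_subset (add_mem_closedBall hx ((hle z hz).trans hy))
      have h1 := ((hasStrictFDerivAt_norm_sq z).hasFDerivAt.const_mul (1 / 2 : ℝ))
      have h2 := (h1.sub (H.hasFDerivAt_lossIncrement (b := b) hz')).hasFDerivWithinAt
        (s := Metric.closedBall 0 ‖y‖)
      refine h2.congr_fderiv ?_
      congr 1
      ext u
      simp)
    (fun z hz => (H.norm_gradient_increment_le hx hgrad ((hle z hz).trans hy)).trans (by
      have := H.τ_nonneg
      have := H.s_ge
      have := hle z hz
      gcongr))
    (convex_closedBall _ _) (by simp) (by simp)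
  have h0 : lossIncrement K b xhat 0 = 0 := by simp [lossIncrement]
  simp only [h0, norm_zero, sub_zero] at h
  rw [Real.norm_eq_abs] at h
  have := (abs_le.1 h).2
  nlinarith

/-- Linear growth of the loss increment outside of the ball, by convexity. -/
lemma lossIncrement_ge_of_le (H : WhitenedLoss s τ D K) (hx : ‖xhat‖ ≤ 3 / 2 * (s * √d))
    (hgrad : fderiv ℝ K xhat = innerBilin d b) {y : EuclideanSpace ℝ (Fin d)}
    (hyD : xhat + y ∈ D) (hy : s * √d / 2 ≤ ‖y‖) :
    (1 / 2 - 5 / 3 * τ * (2 * s * √d)) * (s * √d / 2) * ‖y‖ ≤ lossIncrement K b xhat y := by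
  have hr := H.radius_pos
  have hy0 : 0 < ‖y‖ := by linarith
  set R := s * √d / 2 with hR
  have hR0 : 0 < R := by positivity
  -- Scaling by `t` puts `y` on the sphere of radius `R`, where the quadratic bound holds; convexity
  -- along the ray from `xhat` propagates it outwards.
  set t := R / ‖y‖ with ht
  have ht0 : 0 < t := by positivity
  have ht1 : t ≤ 1 := (div_le_one hy0).2 hy
  have htn : ‖t • y‖ = R := by
    rw [norm_smul, Real.norm_of_nonneg ht0.le, ht]
    field_simp
  have h1 := H.lossIncrement_ge hx hgrad (y := t • y) htn.le
  rw [htn] at h1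
  have hxD : xhat ∈ D := H.ball_subset (H.xhat_mem hx)
  have h2 := H.convexOn.2 hxD hyD (sub_nonneg.2 ht1) ht0.le (by ring)
  have e : (1 - t) • xhat + t • (xhat + y) = xhat + t • y := by
    rw [sub_smul, one_smul, smul_add]
    abel
  rw [e] at h2
  simp only [smul_eq_mul] at h2
  have h3 : lossIncrement K b xhat (t • y) ≤ t * lossIncrement K b xhat y := by
    unfold lossIncrement
    rw [real_inner_smul_right]
    linarith
  have h4 : (1 / 2 - 5 / 3 * τ * (2 * s * √d)) * R ^ 2 * ‖y‖ ≤
      R * lossIncrement K b xhat y := by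
    have h5 := h1.trans h3
    have e5 : t * lossIncrement K b xhat y = R * lossIncrement K b xhat y / ‖y‖ := by
      rw [ht]
      ring
    rw [e5, le_div_iff₀ hy0] at h5
    exact h5
  have h6 : R * ((1 / 2 - 5 / 3 * τ * (2 * s * √d)) * R * ‖y‖) ≤
      R * lossIncrement K b xhat y := by
    refine le_of_eq_of_le ?_ h4
    ring
  exact le_of_mul_le_mul_left h6 hR0

lemma lossIncrement_nonneg (H : WhitenedLoss s τ D K) (hx : ‖xhat‖ ≤ 3 / 2 * (s * √d))
    (hgrad : fderiv ℝ K xhat = innerBilin d b) {y : EuclideanSpace ℝ (Fin d)}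
    (hyD : xhat + y ∈ D) : 0 ≤ lossIncrement K b xhat y := by
  have hc : 0 ≤ 1 / 2 - 5 / 3 * τ * (2 * s * √d) := by
    have := H.slope_le
    linarith
  have hr := H.radius_pos
  rcases le_total ‖y‖ (s * √d / 2) with h | h
  · exact (by positivity : (0 : ℝ) ≤ _).trans (H.lossIncrement_ge hx hgrad h)
  · exact (by positivity : (0 : ℝ) ≤ _).trans (H.lossIncrement_ge_of_le hx hgrad hyD h)

lemma measurableSet_preimage (H : WhitenedLoss s τ D K) :
    MeasurableSet ((xhat + ·) ⁻¹' D) :=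
  (H.isOpen.preimage (by fun_prop)).measurableSet

lemma aestronglyMeasurable_centeredWeight (H : WhitenedLoss s τ D K) (hpm : Measurable p) :
    AEStronglyMeasurable (centeredWeight D K p b xhat) := by
  have hm := H.measurableSet_preimage (xhat := xhat)
  unfold centeredWeight
  rw [aestronglyMeasurable_indicator_iff hm]
  refine AEStronglyMeasurable.mul
    ((hpm.comp (measurable_const_add xhat)).div_const _).aestronglyMeasurable ?_
  refine ContinuousOn.aestronglyMeasurable (fun y hy => ?_) hm
  have := (H.hasFDerivAt_lossIncrement (b := b) (xhat := xhat) (y := y) hy).continuousAt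
  exact (Real.continuous_exp.continuousAt.comp this.neg).continuousWithinAt

lemma centeredWeight_nonneg (hp : ∀ x ∈ D, 0 ≤ p x) (hpx : 0 < p xhat)
    (y : EuclideanSpace ℝ (Fin d)) : 0 ≤ centeredWeight D K p b xhat y := by
  unfold centeredWeight
  refine Set.indicator_nonneg (fun y hy => ?_) y
  have := hp _ hy
  positivity

/-- A bounded prior leads to an integrable weight. -/
lemma integrable_centeredWeight (H : WhitenedLoss s τ D K) (hx : ‖xhat‖ ≤ 3 / 2 * (s * √d))
    (hgrad : fderiv ℝ K xhat = innerBilin d b) (hpm : Measurable p) (hp : ∀ x ∈ D, 0 ≤ p x)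
    (hpx : 0 < p xhat) {B : ℝ} (hB : ∀ x ∈ D, p x ≤ B) :
    Integrable (centeredWeight D K p b xhat) := by
  have hr := H.radius_pos
  have hc : 0 < 1 / 2 - 5 / 3 * τ * (2 * s * √d) := by
    have := H.slope_le
    linarith
  set c := (1 / 2 - 5 / 3 * τ * (2 * s * √d)) * (s * √d / 2) with hcdef
  have hcpos : 0 < c := by positivity
  have hB0 : 0 ≤ B := hpx.le.trans (hB xhat (H.ball_subset (H.xhat_mem hx)))
  refine ((integrable_exp_neg_mul_norm H.dim_pos hcpos).const_mul
    (B / p xhat * Real.exp (c * (s * √d / 2)))).mono'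
    (H.aestronglyMeasurable_centeredWeight hpm) (ae_of_all _ fun y => ?_)
  rw [Real.norm_of_nonneg (centeredWeight_nonneg hp hpx y)]
  by_cases hy : xhat + y ∈ D
  · rw [centeredWeight, Set.indicator_of_mem (by exact hy), mul_assoc, ← Real.exp_add]
    -- A single linear lower bound for both regions: inside the ball its left side is nonpositive.
    have h1 : c * ‖y‖ - c * (s * √d / 2) ≤ lossIncrement K b xhat y := by
      rcases le_total ‖y‖ (s * √d / 2) with h | h
      · have h2 := H.lossIncrement_nonneg hx hgrad hy
        have h3 : c * ‖y‖ ≤ c * (s * √d / 2) := by gcongr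
        linarith
      · have h2 := H.lossIncrement_ge_of_le hx hgrad hy h
        rw [← hcdef] at h2
        have : 0 ≤ c * (s * √d / 2) := by positivity
        linarith
    have := hB _ hy
    gcongr
    linarith
  · rw [centeredWeight, Set.indicator_of_notMem (by exact hy)]
    positivity

/-- Total variation bound for the whitened posterior, in coordinates centered at the minimizer. -/
theorem nearlyGaussian_centeredWeight (H : WhitenedLoss s τ D K)
    (hx : ‖xhat‖ ≤ 3 / 2 * (s * √d)) (hgrad : fderiv ℝ K xhat = innerBilin d b)
    (hpm : Measurable p) (hp : ∀ x ∈ D, 0 ≤ p x)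
    (hp1 : ContDiffOn ℝ 1 p (Metric.ball 0 (2 * s * √d)))
    (hp0 : ∀ x ∈ Metric.ball (0 : EuclideanSpace ℝ (Fin d)) (2 * s * √d), 0 < p x)
    {a : ℝ} (hpa : ∀ x ∈ Metric.ball (0 : EuclideanSpace ℝ (Fin d)) (2 * s * √d),
      ‖fderiv ℝ (fun x => Real.log (p x)) x‖ ≤ a) (ha : a ≤ 1 / 100)
    (hτ : s * τ * d ≤ 3 / 1000) {B : ℝ} (hB : ∀ x ∈ D, p x ≤ B) :
    NearlyGaussian s a (5 / 3 * τ * (2 * s * √d))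
      (fun y => Real.log (p (xhat + y)) - Real.log (p xhat)
        + (1 / 2 * ‖y‖ ^ 2 - lossIncrement K b xhat y))
      (centeredWeight D K p b xhat) := by
  have hr := H.radius_pos
  have hball := fun (y : EuclideanSpace ℝ (Fin d)) (hy : y ∈ Metric.ball 0 (s * √d / 2)) =>
    add_mem_ball hx hy
  have hxb : xhat ∈ Metric.ball (0 : EuclideanSpace ℝ (Fin d)) (2 * s * √d) := by
    have := hball 0 (by simpa using (by positivity : (0 : ℝ) < s * √d / 2))
    simpa using this
  have hballD := fun (y : EuclideanSpace ℝ (Fin d)) (hy : y ∈ Metric.ball 0 (s * √d / 2)) =>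
    H.ball_subset (Metric.ball_subset_closedBall (hball y hy))
  have hτ0 := H.τ_nonneg
  have hs := H.s_ge
  have hlog : ContDiffOn ℝ 1 (fun x => Real.log (p x)) (Metric.ball 0 (2 * s * √d)) :=
    hp1.log fun x hx => (hp0 x hx).ne'
  have hadd : ContDiff ℝ 1 fun y : EuclideanSpace ℝ (Fin d) => xhat + y :=
    contDiff_const.add contDiff_id
  refine
    { dim_pos := H.dim_pos
      s_ge := H.s_ge
      a_nonneg := (norm_nonneg _).trans (hpa xhat hxb)
      a_le := ha
      ε_nonneg := by positivity
      ε_le := ?_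
      contDiffOn := ?_
      map_zero := by simp [lossIncrement]
      norm_fderiv_le := fun y hy => ?_
      eq_exp := fun y hy => ?_
      nonneg := centeredWeight_nonneg hp (hp0 _ hxb)
      integrable := H.integrable_centeredWeight hx hgrad hpm hp (hp0 _ hxb) hB }
  -- Here `ε√d = 10/3 · sτd`, so the threshold `3/1000` on `sτd` gives `ε√d ≤ 1/100`.
  · have h1 : √(d : ℝ) * √d = d := Real.mul_self_sqrt (by positivity)
    have h2 : 5 / 3 * τ * (2 * s * √d) * √d = 10 / 3 * (s * τ * (√(d : ℝ) * √d)) := by ring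
    rw [h2, h1]
    linarith
  · refine ((hlog.comp hadd.contDiffOn hball).sub contDiffOn_const).add
      ((contDiffOn_const.mul (contDiff_norm_sq ℝ).contDiffOn).sub ?_)
    have hK : ContDiffOn ℝ 1 K D := H.contDiffOn.of_le (by norm_num)
    exact ((hK.comp hadd.contDiffOn hballD).sub contDiffOn_const).sub
      (innerBilin d b).contDiff.contDiffOn
  · have hyn : ‖y‖ ≤ s * √d / 2 := by
      rw [mem_ball_zero_iff] at hy
      exact hy.le
    have h1 : HasFDerivAt (fun y => Real.log (p (xhat + y)))
        (fderiv ℝ (fun x => Real.log (p x)) (xhat + y)) y := by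
      rw [hasFDerivAt_comp_add_left (f := fun x => Real.log (p x))]
      exact ((hlog.contDiffAt (Metric.isOpen_ball.mem_nhds (hball y hy))).differentiableAt
        one_ne_zero).hasFDerivAt
    have h2 : HasFDerivAt (fun y : EuclideanSpace ℝ (Fin d) => 1 / 2 * ‖y‖ ^ 2)
        (innerBilin d y) y := by
      refine ((hasStrictFDerivAt_norm_sq y).hasFDerivAt.const_mul (1 / 2 : ℝ)).congr_fderiv ?_
      ext u
      simp
    have h3 := (h1.sub_const (Real.log (p xhat))).add
      (h2.sub (H.hasFDerivAt_lossIncrement (b := b) (hballD y hy)))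
    have h4 : fderiv ℝ (fun y => Real.log (p (xhat + y)) - Real.log (p xhat)
        + (1 / 2 * ‖y‖ ^ 2 - lossIncrement K b xhat y)) y = _ := h3.fderiv
    rw [h4]
    exact (norm_add_le _ _).trans
      (add_le_add (hpa _ (hball y hy)) (H.norm_gradient_increment_le hx hgrad hyn))
  · rw [centeredWeight, Set.indicator_of_mem (by exact hballD y hy)]
    have e1 : Real.log (p (xhat + y)) - Real.log (p xhat) + (1 / 2 * ‖y‖ ^ 2 -
        lossIncrement K b xhat y) - ‖y‖ ^ 2 / 2
        = (Real.log (p (xhat + y)) - Real.log (p xhat)) + (-lossIncrement K b xhat y) := by ring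
    rw [e1, Real.exp_add, Real.exp_sub, Real.exp_log (hp0 _ (hball y hy)),
      Real.exp_log (hp0 _ hxb)]

end WhitenedLoss

end CenteredWeight

/-! ### Posterior mass away from the minimizer. -/

section CenteredWeightTail

variable {d : ℕ}

namespace WhitenedLoss

variable {s τ : ℝ} {D : Set (EuclideanSpace ℝ (Fin d))} {K p : EuclideanSpace ℝ (Fin d) → ℝ}
  {b xhat : EuclideanSpace ℝ (Fin d)}

/-- `log p` is `1/100`-Lipschitz on the ball and `xhat` has norm at most `3/2 s√d`. This replaces
the reference point `xhat` of the weight by the origin, to which the prior bound refers. -/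
lemma prior_ratio_le (H : WhitenedLoss s τ D K) (hx : ‖xhat‖ ≤ 3 / 2 * (s * √d))
    (hp1 : ContDiffOn ℝ 1 p (Metric.ball 0 (2 * s * √d)))
    (hp0 : ∀ x ∈ Metric.ball (0 : EuclideanSpace ℝ (Fin d)) (2 * s * √d), 0 < p x)
    {a : ℝ} (hpa : ∀ x ∈ Metric.ball (0 : EuclideanSpace ℝ (Fin d)) (2 * s * √d),
      ‖fderiv ℝ (fun x => Real.log (p x)) x‖ ≤ a) (ha : a ≤ 1 / 100) :
    p 0 / p xhat ≤ Real.exp (3 / 200 * (s * √d)) := by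
  have hr := H.radius_pos
  have h0 : (0 : EuclideanSpace ℝ (Fin d)) ∈ Metric.ball 0 (2 * s * √d) := by
    simp only [Metric.mem_ball, dist_self]
    linarith
  have hxb : xhat ∈ Metric.ball (0 : EuclideanSpace ℝ (Fin d)) (2 * s * √d) := by
    rw [mem_ball_zero_iff]
    linarith
  have hlog : ContDiffOn ℝ 1 (fun x => Real.log (p x)) (Metric.ball 0 (2 * s * √d)) :=
    hp1.log fun x hx => (hp0 x hx).ne'
  have h := Convex.norm_image_sub_le_of_norm_fderiv_le (𝕜 := ℝ)
    (f := fun x => Real.log (p x)) (s := Metric.ball 0 (2 * s * √d)) (x := xhat) (y := 0)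
    (fun x hx => (hlog.contDiffAt (Metric.isOpen_ball.mem_nhds hx)).differentiableAt one_ne_zero)
    hpa (convex_ball _ _) hxb h0
  rw [zero_sub, norm_neg, Real.norm_eq_abs, ← Real.log_div (hp0 _ h0).ne' (hp0 _ hxb).ne'] at h
  have hpos : 0 < p 0 / p xhat := div_pos (hp0 _ h0) (hp0 _ hxb)
  rw [← Real.log_le_iff_le_exp hpos]
  refine (le_abs_self _).trans (h.trans ?_)
  calc _ ≤ 1 / 100 * (3 / 2 * (s * √d)) := by gcongr
    _ = _ := by ring

/-- The mass of the posterior outside of the local ball. -/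
lemma tail_le (H : WhitenedLoss s τ D K)
    (hx : ‖xhat‖ ≤ 3 / 2 * (s * √d)) (hgrad : fderiv ℝ K xhat = innerBilin d b)
    (hpm : Measurable p) (hp : ∀ x ∈ D, 0 ≤ p x)
    (hp1 : ContDiffOn ℝ 1 p (Metric.ball 0 (2 * s * √d)))
    (hp0 : ∀ x ∈ Metric.ball (0 : EuclideanSpace ℝ (Fin d)) (2 * s * √d), 0 < p x)
    {a : ℝ} (hpa : ∀ x ∈ Metric.ball (0 : EuclideanSpace ℝ (Fin d)) (2 * s * √d),
      ‖fderiv ℝ (fun x => Real.log (p x)) x‖ ≤ a) (ha : a ≤ 1 / 100)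
    (hτ : s * τ * d ≤ 3 / 1000) {m : ℝ} (hm : ∀ x ∈ D, p x ≤ p 0 * Real.exp (d * m)) :
    ∫ y in (Metric.ball (0 : EuclideanSpace ℝ (Fin d)) (s * √d / 2))ᶜ,
        centeredWeight D K p b xhat y
      ≤ 2 * Real.exp (d * (m - (s / 12) ^ 2)) * nearlyGaussianMass d := by
  have hr := H.radius_pos
  have hs := H.s_ge
  have hd1 : (1 : ℝ) ≤ d := by exact_mod_cast H.dim_pos
  have hd0 : 0 < √(d : ℝ) := Real.sqrt_pos.2 (by linarith)
  have hdd : √(d : ℝ) * √d = d := Real.mul_self_sqrt (by positivity)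
  have hsqd : √(d : ℝ) ≤ d := by
    have : (1 : ℝ) ≤ √d := Real.one_le_sqrt.2 hd1
    nlinarith
  have hxb : xhat ∈ Metric.ball (0 : EuclideanSpace ℝ (Fin d)) (2 * s * √d) := by
    rw [mem_ball_zero_iff]
    linarith
  have hτ0 := H.τ_nonneg
  have hslope : 5 / 3 * τ * (2 * s * √d) ≤ 1 / 100 := by
    have h1 : 5 / 3 * τ * (2 * s * √d) ≤ 5 / 3 * τ * (2 * s * d) := by gcongr
    linarith
  have hint := H.integrable_centeredWeight hx hgrad hpm hp (hp0 _ hxb) hm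
  have hratio := H.prior_ratio_le hx hp1 hp0 hpa ha
  -- The linear growth rate is at least `49/200 s√d`. The share `29/200 s√d`, with `‖y‖ ≥ s√d/2`,
  -- yields the factor `exp(-29/400 s²d)`; the share `c` is kept for integrability.
  set c := 1 / 10 * (s * √d) with hc
  have hc0 : 0 < c := by positivity
  have ie := integrable_exp_neg_mul_norm H.dim_pos hc0
  have hpt : ∀ y ∈ (Metric.ball (0 : EuclideanSpace ℝ (Fin d)) (s * √d / 2))ᶜ,
      centeredWeight D K p b xhat y ≤ Real.exp (3 / 200 * (s * √d)) * Real.exp (d * m) *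
        Real.exp (-(29 / 400 * (s ^ 2 * d))) * Real.exp (-c * ‖y‖) := by
    intro y hy
    have hyn : s * √d / 2 ≤ ‖y‖ := by simpa using hy
    by_cases hyD : xhat + y ∈ D
    · rw [centeredWeight, Set.indicator_of_mem (by exact hyD), mul_assoc _ (Real.exp (-(29 / 400 *
        (s ^ 2 * d)))), ← Real.exp_add (-(29 / 400 * (s ^ 2 * d)))]
      have h1 := H.lossIncrement_ge_of_le hx hgrad hyD hyn
      have h2 : p (xhat + y) / p xhat ≤ Real.exp (3 / 200 * (s * √d)) * Real.exp (d * m) := by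
        calc _ ≤ p 0 * Real.exp (d * m) / p xhat := by
              have := hp0 _ hxb
              gcongr
              exact hm _ hyD
          _ = p 0 / p xhat * Real.exp (d * m) := by ring
          _ ≤ _ := by gcongr
      have h3 : 29 / 400 * (s ^ 2 * d) + c * ‖y‖ ≤ lossIncrement K b xhat y := by
        have h4 : 49 / 100 * (s * √d / 2) * ‖y‖ ≤
            (1 / 2 - 5 / 3 * τ * (2 * s * √d)) * (s * √d / 2) * ‖y‖ := by
          gcongr
          linarith
        have h5 : 29 / 200 * (s * √d) * (s * √d / 2) ≤ 29 / 200 * (s * √d) * ‖y‖ := by gcongr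
        have h6 : 29 / 200 * (s * √d) * (s * √d / 2) = 29 / 400 * (s ^ 2 * (√(d : ℝ) * √d)) := by
          ring
        rw [h6, hdd] at h5
        have h7 : c * ‖y‖ = 1 / 10 * (s * √d) * ‖y‖ := by rw [hc]
        linarith
      exact mul_le_mul h2 (Real.exp_le_exp.2 (by linarith)) (Real.exp_pos _).le (by positivity)
    · rw [centeredWeight, Set.indicator_of_notMem (by exact hyD)]
      positivity
  have hmono := setIntegral_mono_on hint.integrableOn (ie.const_mul
    (Real.exp (3 / 200 * (s * √d)) * Real.exp (d * m) *
      Real.exp (-(29 / 400 * (s ^ 2 * d))))).integrableOn measurableSet_ball.compl hpt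
  have hfull := setIntegral_le_integral (s := (Metric.ball (0 : EuclideanSpace ℝ (Fin d))
    (s * √d / 2))ᶜ) (ie.const_mul (Real.exp (3 / 200 * (s * √d)) * Real.exp (d * m) *
      Real.exp (-(29 / 400 * (s ^ 2 * d))))) (ae_of_all _ fun y => by positivity)
  refine hmono.trans (hfull.trans ?_)
  rw [integral_const_mul]
  have h7 : ∫ y : EuclideanSpace ℝ (Fin d), Real.exp (-c * ‖y‖) ≤
      (Real.pi / (103 / 200)) ^ (d / 2 : ℝ) := by
    refine (integral_exp_neg_mul_norm_le H.dim_pos hc0).trans ?_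
    -- The quotient is `20/s ≤ 20/12`, and `(5/3)² = 25/9` is below `π/(103/200)`.
    have h8 : 2 * √d / c ≤ 5 / 3 := by
      rw [div_le_iff₀ hc0, hc]
      nlinarith
    calc (2 * √d / c) ^ d ≤ (5 / 3) ^ d := by gcongr
      _ = ((5 / 3 : ℝ) ^ (2 : ℝ)) ^ (d / 2 : ℝ) := by
          rw [← Real.rpow_mul (by norm_num), ← Real.rpow_natCast]
          congr 1
          ring
      _ ≤ _ := by
          gcongr
          rw [le_div_iff₀ (by norm_num)]
          norm_num
          linarith [Real.pi_gt_three]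
  calc _ ≤ Real.exp (3 / 200 * (s * √d)) * Real.exp (d * m) *
        Real.exp (-(29 / 400 * (s ^ 2 * d))) * (Real.pi / (103 / 200)) ^ (d / 2 : ℝ) := by gcongr
    _ = Real.exp (3 / 200 * (s * √d) + d * m + -(29 / 400 * (s ^ 2 * d))) *
        (Real.pi / (103 / 200)) ^ (d / 2 : ℝ) := by rw [Real.exp_add, Real.exp_add]
    _ ≤ Real.exp (d * (m - (s / 12) ^ 2) + -(d / 200)) *
        (Real.pi / (103 / 200)) ^ (d / 2 : ℝ) := by
        refine mul_le_mul_of_nonneg_right (Real.exp_le_exp.2 ?_) (by positivity)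
        have h9 : 3 / 200 * (s * √d) ≤ 3 / 200 * (s * d) := by gcongr
        have h10 : 3 / 200 * s + 1 / 200 ≤ (29 / 400 - 1 / 144) * s ^ 2 := by nlinarith
        have h11 := mul_le_mul_of_nonneg_right h10 (by linarith : (0 : ℝ) ≤ d)
        linarith
    _ = _ := by
        unfold nearlyGaussianMass
        rw [Real.exp_add]
        ring

end WhitenedLoss

/-- Total variation bound for the whitened posterior. -/
theorem exists_centeredWeight_tv_le : ∃ C : ℝ, 0 < C ∧
    ∀ (d : ℕ) (s τ a m : ℝ) (D : Set (EuclideanSpace ℝ (Fin d)))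
      (K p : EuclideanSpace ℝ (Fin d) → ℝ) (b xhat : EuclideanSpace ℝ (Fin d)),
      WhitenedLoss s τ D K → ‖xhat‖ ≤ 3 / 2 * (s * √d) → fderiv ℝ K xhat = innerBilin d b →
      Measurable p → (∀ x ∈ D, 0 ≤ p x) →
      ContDiffOn ℝ 1 p (Metric.ball 0 (2 * s * √d)) →
      (∀ x ∈ Metric.ball (0 : EuclideanSpace ℝ (Fin d)) (2 * s * √d), 0 < p x) →
      (∀ x ∈ Metric.ball (0 : EuclideanSpace ℝ (Fin d)) (2 * s * √d),
        ‖fderiv ℝ (fun x => Real.log (p x)) x‖ ≤ a) →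
      a ≤ 1 / 100 → s * τ * d ≤ 3 / 1000 →
      (∀ x ∈ D, p x ≤ p 0 * Real.exp (d * m)) →
      0 < ∫ y, centeredWeight D K p b xhat y ∧
      ∀ A : Set (EuclideanSpace ℝ (Fin d)), MeasurableSet A →
        |(∫ y in A, centeredWeight D K p b xhat y) / (∫ y, centeredWeight D K p b xhat y)
            - (stdGaussian (EuclideanSpace ℝ (Fin d))).real A|
          ≤ C * (a + s * τ * d + Real.exp (d * (m - (s / 12) ^ 2))) := by
  obtain ⟨C, hC, h⟩ := exists_nearlyGaussian_tv_le
  refine ⟨4 * C, by positivity, ?_⟩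
  intro d s τ a m D K p b xhat H hx hgrad hpm hp hp1 hp0 hpa ha hτ hm
  have hN := H.nearlyGaussian_centeredWeight hx hgrad hpm hp hp1 hp0 hpa ha hτ hm
  obtain ⟨h1, h2⟩ := h d s a _ _ _ _ hN (H.tail_le hx hgrad hpm hp hp1 hp0 hpa ha hτ hm)
  refine ⟨h1, fun A hA => (h2 A hA).trans ?_⟩
  have hr := H.radius_pos
  have h0 : (0 : EuclideanSpace ℝ (Fin d)) ∈ Metric.ball 0 (2 * s * √d) := by
    simp only [Metric.mem_ball, dist_self]
    linarith
  -- At the origin the prior bound reads `p 0 ≤ p 0 * exp(d m)`. Since then `d m ≥ 0`, the cutoff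
  -- error `exp(-d(s/12)²)` is absorbed by the tail term.
  have hm0 : 0 ≤ d * m := by
    have h3 := hm 0 (H.ball_subset (Metric.ball_subset_closedBall h0))
    have h4 := hp0 0 h0
    exact Real.one_le_exp_iff.1 ((le_mul_iff_one_le_right h4).1 h3)
  have h5 : Real.exp (-(d * (s / 12) ^ 2)) ≤ Real.exp (d * (m - (s / 12) ^ 2)) := by
    apply Real.exp_le_exp.2
    linarith
  have h6 : 5 / 3 * τ * (2 * s * √d) * √d = 10 / 3 * (s * τ * d) := by
    have : √(d : ℝ) * √d = d := Real.mul_self_sqrt (by positivity)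
    calc _ = 10 / 3 * (s * τ * (√(d : ℝ) * √d)) := by ring
      _ = _ := by rw [this]
  rw [h6]
  have h7 := hN.a_nonneg
  have h8 : 0 ≤ s * τ * d := by
    have := H.τ_nonneg
    have := H.s_ge
    positivity
  have h9 := Real.exp_pos (d * (m - (s / 12) ^ 2))
  calc _ ≤ C * (4 * (a + s * τ * d + Real.exp (d * (m - (s / 12) ^ 2)))) :=
        mul_le_mul_of_nonneg_left (by linarith) hC.le
    _ = _ := by ring

end CenteredWeightTail

/-! ### Smoothness of the Laplace transform -/

section Laplace

variable {k : ℕ} {μ : Measure (EuclideanSpace ℝ (Fin k))}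

/-- `f` grows slower than every exponential. -/
def SubexponentialGrowth {E F : Type*} [Norm E] [Norm F] (f : E → F) : Prop :=
  ∀ r : ℝ, 0 < r → ∃ c : ℝ, 0 ≤ c ∧ ∀ y, ‖f y‖ ≤ c * Real.exp (r * ‖y‖)

lemma mem_naturalSpace_iff {ω : EuclideanSpace ℝ (Fin k)} :
    ω ∈ naturalSpace μ ↔ Integrable (fun y => Real.exp ⟪ω, y⟫) μ := by
  have hm : AEStronglyMeasurable (fun y => Real.exp ⟪ω, y⟫) μ :=
    (by fun_prop : Continuous fun y => Real.exp ⟪ω, y⟫).aestronglyMeasurable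
  rw [← lintegral_ofReal_ne_top_iff_integrable hm (ae_of_all _ fun y => (Real.exp_pos _).le),
    naturalSpace, Set.mem_ofPred_eq, lt_top_iff_ne_top]

/-- Reduces exponentials of the norm to exponentials of linear forms, by `‖y‖ ≤ k max |yᵢ|` and
`exp|x| ≤ exp x + exp(-x)`. The summand 1 covers `k = 0`. -/
lemma exp_mul_norm_le {r : ℝ} (hr : 0 ≤ r) (y : EuclideanSpace ℝ (Fin k)) :
    Real.exp (r * ‖y‖) ≤ 1 + ∑ i, (Real.exp (r * k * y i) + Real.exp (-(r * k * y i))) := by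
  have h0 : ∀ i, 0 ≤ Real.exp (r * k * y i) + Real.exp (-(r * k * y i)) := fun i => by positivity
  rcases isEmpty_or_nonempty (Fin k) with h | h
  · have : y = 0 := Subsingleton.elim _ _
    simp [this]
  obtain ⟨i, hi⟩ := Finite.exists_max fun i => |y i|
  have h1 : ‖y‖ ≤ k * |y i| := by
    refine abs_le_of_sq_le_sq' ?_ (by positivity) |>.2
    have hk : (1 : ℝ) ≤ k := by exact_mod_cast Fin.pos i
    calc ‖y‖ ^ 2 = ∑ j, |y j| ^ 2 := by
          rw [EuclideanSpace.norm_sq_eq]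
          rfl
      _ ≤ ∑ _j : Fin k, |y i| ^ 2 :=
          Finset.sum_le_sum fun j _ => pow_le_pow_left₀ (abs_nonneg _) (hi j) 2
      _ = k * |y i| ^ 2 := by simp
      _ ≤ k * (k * |y i| ^ 2) := by
          gcongr
          exact le_mul_of_one_le_left (by positivity) hk
      _ = _ := by ring
  have h2 : Real.exp (r * k * |y i|) ≤ Real.exp (r * k * y i) + Real.exp (-(r * k * y i)) := by
    rcases abs_cases (y i) with ⟨h, _⟩ | ⟨h, _⟩ <;> rw [h]
    · linarith [Real.exp_pos (-(r * k * y i))]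
    · rw [mul_neg]
      linarith [Real.exp_pos (r * k * y i)]
  calc Real.exp (r * ‖y‖) ≤ Real.exp (r * k * |y i|) := by
        apply Real.exp_le_exp.2
        rw [mul_assoc]
        exact mul_le_mul_of_nonneg_left h1 hr
    _ ≤ _ := h2
    _ ≤ _ := Finset.single_le_sum (f := fun i => Real.exp (r * k * y i) + Real.exp (-(r * k * y i)))
        (fun i _ => h0 i) (Finset.mem_univ i)
    _ ≤ _ := by linarith

/-- Openness puts the finitely many points `ω ± rk eᵢ` in the natural space for small `r`;
`exp_mul_norm_le` then supplies an integrable majorant. -/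
lemma exists_integrable_exp_norm (hΩ : IsOpen (naturalSpace μ)) {ω : EuclideanSpace ℝ (Fin k)}
    (hω : ω ∈ naturalSpace μ) :
    ∃ r : ℝ, 0 < r ∧ Integrable (fun y => Real.exp (⟪ω, y⟫ + r * ‖y‖)) μ := by
  obtain ⟨ε, hε, hb⟩ := Metric.isOpen_iff.1 hΩ ω hω
  have hk : (0 : ℝ) ≤ k := k.cast_nonneg
  refine ⟨ε / (2 * (k + 1)), by positivity, ?_⟩
  set r := ε / (2 * (k + 1)) with hr
  have hr0 : 0 < r := by positivity
  have hrk : r * k < ε := by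
    rw [hr, div_mul_eq_mul_div, div_lt_iff₀ (by positivity)]
    nlinarith
  have hi : ∀ (σ : ℝ) (i : Fin k), |σ| = 1 →
      Integrable (fun y => Real.exp (⟪ω, y⟫ + σ * (r * k * y i))) μ := by
    intro σ i hσ
    have h1 : ω + EuclideanSpace.single i (σ * (r * k)) ∈ naturalSpace μ := by
      apply hb
      simp only [Metric.mem_ball, dist_self_add_left, PiLp.norm_single, norm_mul,
        Real.norm_eq_abs, hσ, one_mul]
      rwa [abs_of_pos hr0, abs_of_nonneg hk]
    refine (mem_naturalSpace_iff.1 h1).congr (ae_of_all _ fun y => ?_)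
    simp only [inner_add_left, EuclideanSpace.inner_single_left]
    simp
    ring
  have hbd : Integrable (fun y => Real.exp ⟪ω, y⟫ + ∑ i : Fin k,
      (Real.exp (⟪ω, y⟫ + 1 * (r * k * y i)) + Real.exp (⟪ω, y⟫ + (-1) * (r * k * y i)))) μ :=
    (mem_naturalSpace_iff.1 hω).add
      (integrable_finsetSum _ fun i _ => (hi 1 i (by simp)).add (hi (-1) i (by simp)))
  refine hbd.mono' (by fun_prop : Continuous _).aestronglyMeasurable (ae_of_all _ fun y => ?_)
  rw [Real.norm_eq_abs, Real.abs_exp, Real.exp_add]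
  refine (mul_le_mul_of_nonneg_left (exp_mul_norm_le hr0.le y) (Real.exp_pos _).le).trans ?_
  rw [mul_add, mul_one, Finset.mul_sum]
  apply le_of_eq
  congr 1
  refine Finset.sum_congr rfl fun i _ => ?_
  rw [mul_add, ← Real.exp_add, ← Real.exp_add, one_mul, neg_one_mul]

/-- Each differentiation under the integral brings down a factor `y`; the class is stable because
`‖y‖ ≤ (2/r) exp(r‖y‖/2)`. -/
lemma SubexponentialGrowth.smulRight {F : Type*} [NormedAddCommGroup F] [NormedSpace ℝ F]
    {f : EuclideanSpace ℝ (Fin k) → F} (hf : SubexponentialGrowth f) :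
    SubexponentialGrowth fun y => (innerSL ℝ y).smulRight (f y) := by
  intro r hr
  obtain ⟨c, hc0, hc⟩ := hf (r / 2) (by positivity)
  refine ⟨2 / r * c, by positivity, fun y => ?_⟩
  rw [ContinuousLinearMap.norm_smulRight_apply, innerSL_apply_norm]
  have h1 : ‖y‖ ≤ 2 / r * Real.exp (r / 2 * ‖y‖) := by
    have h2 := Real.add_one_le_exp (r / 2 * ‖y‖)
    rw [div_mul_eq_mul_div, le_div_iff₀ hr]
    linarith
  calc ‖y‖ * ‖f y‖ ≤ (2 / r * Real.exp (r / 2 * ‖y‖)) * (c * Real.exp (r / 2 * ‖y‖)) :=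
        mul_le_mul h1 (hc y) (norm_nonneg _) (by positivity)
    _ = 2 / r * c * (Real.exp (r / 2 * ‖y‖) * Real.exp (r / 2 * ‖y‖)) := by ring
    _ = 2 / r * c * Real.exp (r * ‖y‖) := by
        rw [← Real.exp_add]
        ring_nf

lemma exists_dominating (hΩ : IsOpen (naturalSpace μ)) {F : Type*} [NormedAddCommGroup F]
    [NormedSpace ℝ F] {f : EuclideanSpace ℝ (Fin k) → F}
    (hf : SubexponentialGrowth f) {ω : EuclideanSpace ℝ (Fin k)} (hω : ω ∈ naturalSpace μ) :
    ∃ (ε : ℝ) (g : EuclideanSpace ℝ (Fin k) → ℝ), 0 < ε ∧ Integrable g μ ∧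
      ∀ y, ∀ ω' ∈ Metric.ball ω ε, ‖Real.exp ⟪ω', y⟫ • f y‖ ≤ g y := by
  obtain ⟨r, hr, hi⟩ := exists_integrable_exp_norm hΩ hω
  obtain ⟨c, hc0, hc⟩ := hf (r / 2) (by positivity)
  refine ⟨r / 2, _, by positivity, hi.const_mul c, fun y ω' hω' => ?_⟩
  rw [norm_smul, Real.norm_eq_abs, Real.abs_exp]
  have h1 : ⟪ω', y⟫ ≤ ⟪ω, y⟫ + r / 2 * ‖y‖ := by
    have h2 : ⟪ω' - ω, y⟫ ≤ ‖ω' - ω‖ * ‖y‖ := real_inner_le_norm _ _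
    rw [inner_sub_left] at h2
    have h3 : ‖ω' - ω‖ ≤ r / 2 := by
      rw [← dist_eq_norm]
      exact hω'.le
    have := mul_le_mul_of_nonneg_right h3 (norm_nonneg y)
    linarith
  calc Real.exp ⟪ω', y⟫ * ‖f y‖ ≤ Real.exp (⟪ω, y⟫ + r / 2 * ‖y‖) * (c * Real.exp (r / 2 * ‖y‖)) :=
        mul_le_mul (Real.exp_le_exp.2 h1) (hc y) (norm_nonneg _) (Real.exp_pos _).le
    _ = c * (Real.exp (⟪ω, y⟫ + r / 2 * ‖y‖) * Real.exp (r / 2 * ‖y‖)) := by ring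
    _ = c * Real.exp (⟪ω, y⟫ + r * ‖y‖) := by
        rw [← Real.exp_add]
        ring_nf

lemma hasFDerivAt_integral_exp_smul (hΩ : IsOpen (naturalSpace μ)) {F : Type*}
    [NormedAddCommGroup F] [NormedSpace ℝ F]
    {f : EuclideanSpace ℝ (Fin k) → F} (hfc : Continuous f) (hf : SubexponentialGrowth f)
    {ω : EuclideanSpace ℝ (Fin k)} (hω : ω ∈ naturalSpace μ) :
    HasFDerivAt (fun ω => ∫ y, Real.exp ⟪ω, y⟫ • f y ∂μ)
      (∫ y, Real.exp ⟪ω, y⟫ • (innerSL ℝ y).smulRight (f y) ∂μ) ω := by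
  obtain ⟨ε, g, hε, hg, hb⟩ := exists_dominating hΩ hf.smulRight hω
  obtain ⟨ε', g', hε', hg', hb'⟩ := exists_dominating hΩ hf hω
  have hsm : Continuous fun y : EuclideanSpace ℝ (Fin k) => (innerSL ℝ y).smulRight (f y) := by
    fun_prop
  have : SecondCountableTopologyEither (EuclideanSpace ℝ (Fin k))
      (EuclideanSpace ℝ (Fin k) →L[ℝ] F) := secondCountableTopologyEither_of_left _ _
  refine hasFDerivAt_integral_of_dominated_of_fderiv_le (bound := g)
    (F' := fun ω y => Real.exp ⟪ω, y⟫ • (innerSL ℝ y).smulRight (f y))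
    (Metric.ball_mem_nhds ω hε) ?_ ?_ ?_ ?_ hg ?_
  · exact Filter.Eventually.of_forall fun ω' => (by fun_prop : Continuous _).aestronglyMeasurable
  · exact hg'.mono' (by fun_prop : Continuous _).aestronglyMeasurable
      (ae_of_all _ fun y => hb' y ω (Metric.mem_ball_self hε'))
  · exact (by fun_prop : Continuous _).aestronglyMeasurable
  · exact ae_of_all _ hb
  · refine ae_of_all _ fun y ω' _ => ?_
    have h1 : HasFDerivAt (fun ω : EuclideanSpace ℝ (Fin k) => ⟪ω, y⟫) (innerSL ℝ y) ω' := by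
      have := (innerSL ℝ y).hasFDerivAt (x := ω')
      refine this.congr_of_eventuallyEq (Filter.Eventually.of_forall fun z => ?_)
      simp [real_inner_comm]
    refine (h1.exp.smul_const (f y)).congr_fderiv ?_
    ext v
    simp [mul_smul]

/-- The target space is quantified inside the induction because the derivative is an integral of the
same form with values in continuous linear maps into `F`. -/
lemma contDiffOn_integral_exp_smul (hΩ : IsOpen (naturalSpace μ)) (m : ℕ) :
    ∀ {F : Type} [NormedAddCommGroup F] [NormedSpace ℝ F]
    {f : EuclideanSpace ℝ (Fin k) → F} (_ : Continuous f) (_ : SubexponentialGrowth f),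
    ContDiffOn ℝ m (fun ω => ∫ y, Real.exp ⟪ω, y⟫ • f y ∂μ) (naturalSpace μ) := by
  induction m with
  | zero =>
    intro F _ _ f hfc hf
    rw [Nat.cast_zero, contDiffOn_zero]
    exact fun ω hω => (hasFDerivAt_integral_exp_smul hΩ hfc hf hω).continuousAt.continuousWithinAt
  | succ m ih =>
    intro F _ _ f hfc hf
    rw [Nat.cast_add, Nat.cast_one, contDiffOn_succ_iff_fderiv_of_isOpen hΩ]
    refine ⟨fun ω hω => (hasFDerivAt_integral_exp_smul hΩ hfc hf
      hω).differentiableAt.differentiableWithinAt, by simp, ?_⟩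
    refine (ih (f := fun y => (innerSL ℝ y).smulRight (f y)) (by fun_prop) hf.smulRight).congr ?_
    exact fun ω hω => (hasFDerivAt_integral_exp_smul hΩ hfc hf hω).fderiv

end Laplace

/-! ### Regular minimal exponential families -/

section ExponentialFamily

variable {k : ℕ} {μ : Measure (EuclideanSpace ℝ (Fin k))} {ω v : EuclideanSpace ℝ (Fin k)}

lemma IsRegularMinimal.ne_zero (h : IsRegularMinimal μ) (hk : 0 < k) : μ ≠ 0 := by
  rintro rfl
  refine h.minimal (EuclideanSpace.single ⟨0, hk⟩ 1) 0 (fun h0 => ?_) (by simp)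
  have := congrArg (fun x : EuclideanSpace ℝ (Fin k) => x ⟨0, hk⟩) h0
  simp at this

lemma exp_logPartition (hμ : μ ≠ 0) (hω : ω ∈ naturalSpace μ) :
    Real.exp (logPartition μ ω) = ∫ y, Real.exp ⟪ω, y⟫ ∂μ := by
  have : NeZero μ := ⟨hμ⟩
  exact Real.exp_log (integral_exp_pos (mem_naturalSpace_iff.1 hω))

lemma contDiffOn_logPartition (hΩ : IsOpen (naturalSpace μ)) (hμ : μ ≠ 0) :
    ContDiffOn ℝ 3 (logPartition μ) (naturalSpace μ) := by
  have h1 : SubexponentialGrowth fun _ : EuclideanSpace ℝ (Fin k) => (1 : ℝ) := by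
    intro r hr
    refine ⟨1, zero_le_one, fun y => ?_⟩
    rw [norm_one, one_mul]
    exact Real.one_le_exp (by positivity)
  have h2 := contDiffOn_integral_exp_smul hΩ 3 continuous_const h1
  simp only [smul_eq_mul, mul_one] at h2
  refine h2.log fun ω hω => ?_
  rw [← exp_logPartition hμ hω]
  exact (Real.exp_pos _).ne'

/-- Hölder's inequality in pointwise form: convexity of `exp` is applied to the normalized exponents
`⟪ωᵢ, y⟫ - ψᵢ`, whose exponentials integrate to 1. -/
lemma convex_naturalSpace_and_logPartition_le (hμ : μ ≠ 0) {ω₁ ω₂ : EuclideanSpace ℝ (Fin k)}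
    (h₁ : ω₁ ∈ naturalSpace μ) (h₂ : ω₂ ∈ naturalSpace μ) {a b : ℝ} (ha : 0 ≤ a) (hb : 0 ≤ b)
    (hab : a + b = 1) :
    a • ω₁ + b • ω₂ ∈ naturalSpace μ ∧
      logPartition μ (a • ω₁ + b • ω₂) ≤ a * logPartition μ ω₁ + b * logPartition μ ω₂ := by
  set ψ₁ := logPartition μ ω₁
  set ψ₂ := logPartition μ ω₂
  have hle : ∀ y, Real.exp ⟪a • ω₁ + b • ω₂, y⟫ ≤ Real.exp (a * ψ₁ + b * ψ₂) *
      (a * Real.exp (-ψ₁) * Real.exp ⟪ω₁, y⟫ + b * Real.exp (-ψ₂) * Real.exp ⟪ω₂, y⟫) := by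
    intro y
    have h := convexOn_exp.2 (Set.mem_univ (⟪ω₁, y⟫ - ψ₁)) (Set.mem_univ (⟪ω₂, y⟫ - ψ₂)) ha hb hab
    simp only [smul_eq_mul] at h
    have e : Real.exp ⟪a • ω₁ + b • ω₂, y⟫ = Real.exp (a * ψ₁ + b * ψ₂) *
        Real.exp (a * (⟪ω₁, y⟫ - ψ₁) + b * (⟪ω₂, y⟫ - ψ₂)) := by
      rw [← Real.exp_add, inner_add_left, real_inner_smul_left, real_inner_smul_left]
      ring_nf
    rw [e]
    refine mul_le_mul_of_nonneg_left (h.trans (le_of_eq ?_)) (Real.exp_pos _).le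
    rw [sub_eq_add_neg, sub_eq_add_neg, Real.exp_add, Real.exp_add]
    ring
  have hi₁ := (mem_naturalSpace_iff.1 h₁).const_mul (a * Real.exp (-ψ₁))
  have hi₂ := (mem_naturalSpace_iff.1 h₂).const_mul (b * Real.exp (-ψ₂))
  have hi := (hi₁.add hi₂).const_mul (Real.exp (a * ψ₁ + b * ψ₂))
  have hmem : a • ω₁ + b • ω₂ ∈ naturalSpace μ := by
    rw [mem_naturalSpace_iff]
    refine hi.mono' (by fun_prop : Continuous _).aestronglyMeasurable (ae_of_all _ fun y => ?_)
    rw [Real.norm_eq_abs, Real.abs_exp]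
    exact hle y
  refine ⟨hmem, ?_⟩
  rw [← Real.exp_le_exp, exp_logPartition hμ hmem]
  refine (integral_mono (mem_naturalSpace_iff.1 hmem) hi hle).trans (le_of_eq ?_)
  simp only [Pi.add_apply]
  rw [integral_const_mul, integral_add hi₁ hi₂, integral_const_mul, integral_const_mul,
    ← exp_logPartition hμ h₁, ← exp_logPartition hμ h₂, mul_assoc a, mul_assoc b,
    ← Real.exp_add, ← Real.exp_add, neg_add_cancel, neg_add_cancel, Real.exp_zero, mul_one,
    mul_one, hab, mul_one]

lemma convexOn_logPartition (hμ : μ ≠ 0) : ConvexOn ℝ (naturalSpace μ) (logPartition μ) :=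
  ⟨fun _ h₁ _ h₂ _ _ ha hb hab => (convex_naturalSpace_and_logPartition_le hμ h₁ h₂ ha hb hab).1,
    fun _ h₁ _ h₂ _ _ ha hb hab => (convex_naturalSpace_and_logPartition_le hμ h₁ h₂ ha hb hab).2⟩

lemma lintegral_exp_expFamily (hμ : μ ≠ 0) (h : ω + v ∈ naturalSpace μ) :
    ∫⁻ y, ENNReal.ofReal (Real.exp ⟪v, y⟫) ∂expFamily μ ω
      = ENNReal.ofReal (Real.exp (logPartition μ (ω + v) - logPartition μ ω)) := by
  have hm : ∀ f : EuclideanSpace ℝ (Fin k) → ℝ, Continuous f →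
      Measurable fun y => ENNReal.ofReal (Real.exp (f y)) := fun f hf => by
    have := hf.measurable
    fun_prop
  rw [expFamily, lintegral_withDensity_eq_lintegral_mul _ (hm _ (by fun_prop)) (hm _ (by fun_prop))]
  have h1 : ∀ y, ENNReal.ofReal (Real.exp (⟪ω, y⟫ - logPartition μ ω)) *
      ENNReal.ofReal (Real.exp ⟪v, y⟫) =
      ENNReal.ofReal (Real.exp (-logPartition μ ω)) * ENNReal.ofReal (Real.exp ⟪ω + v, y⟫) := by
    intro y
    rw [← ENNReal.ofReal_mul (Real.exp_pos _).le, ← ENNReal.ofReal_mul (Real.exp_pos _).le,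
      ← Real.exp_add, ← Real.exp_add, inner_add_left]
    ring_nf
  simp only [Pi.mul_apply, h1]
  rw [lintegral_const_mul _ (hm _ (by fun_prop)), ← ofReal_integral_eq_lintegral_ofReal
    (mem_naturalSpace_iff.1 h) (ae_of_all _ fun y => (Real.exp_pos _).le),
    ← exp_logPartition hμ h, ← ENNReal.ofReal_mul (Real.exp_pos _).le, ← Real.exp_add]
  ring_nf

lemma isProbabilityMeasure_expFamily (hμ : μ ≠ 0) (hω : ω ∈ naturalSpace μ) :
    IsProbabilityMeasure (expFamily μ ω) := by
  constructor
  have := lintegral_exp_expFamily hμ (ω := ω) (v := 0) (by simpa using hω)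
  simpa using this

/-- The density is everywhere positive. This carries almost sure statements under the family back to
`μ`, where minimality is formulated. -/
lemma absolutelyContinuous_expFamily : μ ≪ expFamily μ ω := by
  refine withDensity_absolutelyContinuous' ?_ (ae_of_all _ fun y => ?_)
  · exact Measurable.aemeasurable (by fun_prop)
  · simp [Real.exp_pos]

lemma cgf_expFamily (hμ : μ ≠ 0) {t : ℝ} (h : ω + t • v ∈ naturalSpace μ) :
    Integrable (fun y => Real.exp (t * ⟪v, y⟫)) (expFamily μ ω) ∧
      cgf (fun y => ⟪v, y⟫) (expFamily μ ω) t = logPartition μ (ω + t • v) - logPartition μ ω := by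
  have h1 := lintegral_exp_expFamily hμ h
  simp only [real_inner_smul_left] at h1
  have hm : AEStronglyMeasurable (fun y => Real.exp (t * ⟪v, y⟫)) (expFamily μ ω) :=
    (by fun_prop : Continuous fun y => Real.exp (t * ⟪v, y⟫)).aestronglyMeasurable
  refine ⟨?_, ?_⟩
  · rw [← lintegral_ofReal_ne_top_iff_integrable hm (ae_of_all _ fun y => (Real.exp_pos _).le), h1]
    exact ENNReal.ofReal_ne_top
  · rw [cgf, mgf, integral_eq_lintegral_of_nonneg_ae (ae_of_all _ fun y => (Real.exp_pos _).le) hm,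
      h1, ENNReal.toReal_ofReal (Real.exp_pos _).le, Real.log_exp]

/-- The cumulant generating function of `⟪v, y⟫` is an increment of `logPartition`, so this second
derivative is a variance. If it vanished, `⟪v, y⟫` would be almost surely constant, against
minimality. -/
lemma fderiv_fderiv_logPartition_pos (h : IsRegularMinimal μ) (hk : 0 < k)
    (hω : ω ∈ naturalSpace μ) (hv : v ≠ 0) :
    0 < fderiv ℝ (fderiv ℝ (logPartition μ)) ω v v := by
  have hμ := h.ne_zero hk
  have hΩ := h.isOpen_naturalSpace
  have hP := isProbabilityMeasure_expFamily hμ hω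
  have hψ := contDiffOn_logPartition hΩ hμ
  set X : EuclideanSpace ℝ (Fin k) → ℝ := fun y => ⟪v, y⟫
  have hnear : ∀ᶠ t : ℝ in nhds 0, ω + t • v ∈ naturalSpace μ := by
    have hc : Continuous fun t : ℝ => ω + t • v := by fun_prop
    exact hc.continuousAt.eventually_mem (hΩ.mem_nhds (by simpa using hω))
  have h0 : (0 : ℝ) ∈ interior (integrableExpSet X (expFamily μ ω)) := by
    rw [mem_interior_iff_mem_nhds]
    filter_upwards [hnear] with t ht using (cgf_expFamily hμ ht).1
  have hcgf : cgf X (expFamily μ ω) =ᶠ[nhds 0]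
      fun t => logPartition μ (ω + t • v) - logPartition μ ω := by
    filter_upwards [hnear] with t ht using (cgf_expFamily hμ ht).2
  have hd : iteratedDeriv 2 (cgf X (expFamily μ ω)) 0
      = fderiv ℝ (fderiv ℝ (logPartition μ)) ω v v := by
    rw [iteratedDeriv_succ, iteratedDeriv_one]
    have h1 : deriv (cgf X (expFamily μ ω)) =ᶠ[nhds 0]
        fun t => fderiv ℝ (logPartition μ) (ω + t • v) v := by
      filter_upwards [hcgf.eventuallyEq_nhds, hnear] with t ht htΩ
      rw [ht.deriv_eq]
      exact ((hasDerivAt_comp_line hΩ hψ htΩ).sub_const _).deriv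
    rw [h1.deriv_eq]
    have h2 := (hasDerivAt_fderiv_comp_line hΩ hψ (x := ω) (v := v) v (t := 0)
      (by simpa using hω)).deriv
    simpa using h2
  have hm2 := memLp_tilted_mul h0 2
  have hvar := variance_tilted_mul h0
  simp only [zero_mul, tilted_const, hd] at hm2 hvar
  rw [← hvar]
  refine lt_of_le_of_ne (variance_nonneg _ _) fun hz => ?_
  have hX : AEMeasurable X (expFamily μ ω) :=
    (by fun_prop : Continuous fun y => ⟪v, y⟫).aemeasurable
  have hev : evariance X (expFamily μ ω) = 0 := by
    rw [← hm2.ofReal_variance_eq, ← hz, ENNReal.ofReal_zero]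
  exact h.minimal v _ hv (absolutelyContinuous_expFamily.ae_le ((evariance_eq_zero_iff hX).1 hev))

end ExponentialFamily

/-! ### Fisher information and whitening -/

section Diagonal

variable {E : Type*} [NormedAddCommGroup E] [NormedSpace ℝ E] (f : E → ℝ) (x v : E)

lemma iteratedFDeriv_two_diag :
    iteratedFDeriv ℝ 2 f x (fun _ => v) = fderiv ℝ (fderiv ℝ f) x v v :=
  iteratedFDeriv_two_apply f x _

lemma iteratedFDeriv_three_diag :
    iteratedFDeriv ℝ 3 f x (fun _ => v) = fderiv ℝ (fderiv ℝ (fderiv ℝ f)) x v v v := by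
  rw [iteratedFDeriv_succ_apply_right, iteratedFDeriv_two_apply]
  rfl

end Diagonal

lemma dotProduct_hessianMatrix_mulVec {k : ℕ} (f : EuclideanSpace ℝ (Fin k) → ℝ)
    (ω u w : EuclideanSpace ℝ (Fin k)) :
    u.ofLp ⬝ᵥ (hessianMatrix f ω *ᵥ w.ofLp) = fderiv ℝ (fderiv ℝ f) ω u w := by
  have hs : ∀ z : EuclideanSpace ℝ (Fin k), z = ∑ i, z i • EuclideanSpace.single i (1 : ℝ) := by
    intro z
    ext j
    simp [Finset.sum_apply, Pi.single_apply]
  conv_rhs => rw [hs u, hs w]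
  simp only [map_sum, map_smul, sum_apply, smul_apply, smul_eq_mul,
    dotProduct, Matrix.mulVec, hessianMatrix, Matrix.of_apply, iteratedFDeriv_two_apply,
    Matrix.cons_val_zero, Matrix.cons_val_one, Finset.mul_sum]
  rw [Finset.sum_comm]
  refine Finset.sum_congr rfl fun i _ => Finset.sum_congr rfl fun j _ => ?_
  ring

namespace GLM

variable {d k n : ℕ} (M : GLM d k n)

/-- The linear predictor as a continuous linear map. -/
noncomputable def predictorL (i : Fin n) :
    EuclideanSpace ℝ (Fin d) →L[ℝ] EuclideanSpace ℝ (Fin k) :=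
  LinearMap.toContinuousLinearMap
    { toFun := M.predictor i
      map_add' := fun x y => by simp [predictor, Matrix.mulVec_add]
      map_smul' := fun c x => by simp [predictor, Matrix.mulVec_smul] }

lemma predictorL_apply (i : Fin n) (θ : EuclideanSpace ℝ (Fin d)) :
    M.predictorL i θ = M.predictor i θ := rfl

lemma dotProduct_fisher_mulVec (θ u w : EuclideanSpace ℝ (Fin d)) :
    u.ofLp ⬝ᵥ (M.fisher θ *ᵥ w.ofLp) = (n : ℝ)⁻¹ * ∑ i,
      fderiv ℝ (fderiv ℝ (logPartition M.base)) (M.predictor i θ)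
        (M.predictor i u) (M.predictor i w) := by
  rw [fisher, Matrix.smul_mulVec, dotProduct_smul, Matrix.sum_mulVec, dotProduct_sum, smul_eq_mul]
  congr 1
  refine Finset.sum_congr rfl fun i _ => ?_
  rw [← dotProduct_hessianMatrix_mulVec, ← Matrix.mulVec_mulVec, ← Matrix.mulVec_mulVec,
    Matrix.dotProduct_mulVec, ← Matrix.mulVec_transpose]
  rfl

variable {M}

/-- If all predictors of `u` vanish, `u` is orthogonal to every column, hence to everything in their
span, including itself. -/
lemma ColumnsSpan.exists_predictor_ne_zero (h : M.ColumnsSpan) {u : EuclideanSpace ℝ (Fin d)}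
    (hu : u ≠ 0) : ∃ i, M.predictor i u ≠ 0 := by
  by_contra! hz
  have h1 : ∀ v : Fin d → ℝ, u.ofLp ⬝ᵥ v = 0 := by
    intro v
    have hv : v ∈ Submodule.span ℝ (Set.range fun p : Fin n × Fin k => (M.X p.1).col p.2) := by
      rw [h]
      trivial
    induction hv using Submodule.span_induction with
    | mem x hx =>
      obtain ⟨⟨i, j⟩, rfl⟩ := hx
      have h2 := congrArg (fun z : EuclideanSpace ℝ (Fin k) => z j) (hz i)
      simp only [predictor, Matrix.mulVec, dotProduct, Matrix.transpose_apply] at h2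
      simp only [dotProduct, Matrix.col]
      simpa [mul_comm] using h2
    | zero => simp
    | add x y _ _ hx hy => rw [dotProduct_add, hx, hy, add_zero]
    | smul c x _ hx => rw [dotProduct_smul, hx, smul_zero]
  apply hu
  ext j
  have := dotProduct_self_eq_zero.1 (h1 u.ofLp)
  simp [this]

lemma ColumnsSpan.pos (h : M.ColumnsSpan) (hd : 0 < d) : 0 < k := by
  have hu : (EuclideanSpace.single ⟨0, hd⟩ 1 : EuclideanSpace ℝ (Fin d)) ≠ 0 := by
    intro h0
    have := congrArg (fun x : EuclideanSpace ℝ (Fin d) => x ⟨0, hd⟩) h0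
    simp at this
  obtain ⟨i, hi⟩ := h.exists_predictor_ne_zero hu
  rcases Nat.eq_zero_or_pos k with rfl | hk
  · exact absurd (Subsingleton.elim _ _) hi
  · exact hk

lemma posDef_fisher (hd : 0 < d) (hn : 0 < n) (hM : IsRegularMinimal M.base) (h : M.ColumnsSpan)
    {θ : EuclideanSpace ℝ (Fin d)} (hθ : θ ∈ M.paramSpace) : (M.fisher θ).PosDef := by
  have hk := h.pos hd
  have hψ := contDiffOn_logPartition hM.isOpen_naturalSpace (hM.ne_zero hk)
  have hsymm : ∀ u w : Fin d → ℝ, u ⬝ᵥ (M.fisher θ *ᵥ w) = w ⬝ᵥ (M.fisher θ *ᵥ u) := by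
    intro u w
    have h1 := M.dotProduct_fisher_mulVec θ (WithLp.toLp 2 u) (WithLp.toLp 2 w)
    have h2 := M.dotProduct_fisher_mulVec θ (WithLp.toLp 2 w) (WithLp.toLp 2 u)
    simp only at h1 h2
    rw [h1, h2]
    congr 1
    exact Finset.sum_congr rfl fun i _ =>
      fderiv_fderiv_symm hM.isOpen_naturalSpace hψ (hθ i) _ _
  refine Matrix.PosDef.of_dotProduct_mulVec_pos ?_ fun u hu => ?_
  · ext i j
    have := hsymm (Pi.single i 1) (Pi.single j 1)
    simpa using this.symm
  · have hu' : WithLp.toLp 2 u ≠ (0 : EuclideanSpace ℝ (Fin d)) := by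
      simpa using hu
    have h1 := M.dotProduct_fisher_mulVec θ (WithLp.toLp 2 u) (WithLp.toLp 2 u)
    simp only at h1
    rw [star_trivial, h1]
    have hnn : ∀ i, 0 ≤ fderiv ℝ (fderiv ℝ (logPartition M.base)) (M.predictor i θ)
        (M.predictor i (WithLp.toLp 2 u)) (M.predictor i (WithLp.toLp 2 u)) := by
      intro i
      rcases eq_or_ne (M.predictor i (WithLp.toLp 2 u)) 0 with h0 | h0
      · rw [h0, map_zero]
      · exact (fderiv_fderiv_logPartition_pos hM hk (hθ i) h0).le
    obtain ⟨i, hi⟩ := h.exists_predictor_ne_zero hu'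
    refine mul_pos (by positivity) (Finset.sum_pos' (fun i _ => hnn i) ⟨i, Finset.mem_univ i, ?_⟩)
    exact fderiv_fderiv_logPartition_pos hM hk (hθ i) hi

end GLM

open scoped MatrixOrder ComplexOrder in
/-- Coordinates in which the quadratic form of `c • F` is the identity. -/
lemma exists_whitening {d : ℕ} {F : Matrix (Fin d) (Fin d) ℝ} (hF : F.PosDef) {c : ℝ} (hc : 0 < c) :
    ∃ A : EuclideanSpace ℝ (Fin d) ≃L[ℝ] EuclideanSpace ℝ (Fin d),
      (∀ x, A x = Matrix.toEuclideanCLM (𝕜 := ℝ) (CFC.sqrt (c • F)⁻¹) x) ∧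
      ∀ u w, (A u).ofLp ⬝ᵥ (F *ᵥ (A w).ofLp) = c⁻¹ * ⟪u, w⟫ := by
  have hcF : (c • F).PosDef := hF.smul hc
  have hS : ((c • F)⁻¹).PosDef := hcF.inv
  set R := CFC.sqrt (c • F)⁻¹ with hR
  have hRR : R * R = (c • F)⁻¹ := CFC.sqrt_mul_sqrt_self _ hS.posSemidef.nonneg
  have hRT : Rᵀ = R := by
    have h1 : R.PosSemidef := Matrix.nonneg_iff_posSemidef.1 (CFC.sqrt_nonneg _)
    have := h1.isHermitian.eq
    simpa using this
  have hu : IsUnit (c • F).det := hcF.det_pos.ne'.isUnit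
  have h1 : R * (R * (c • F)) = 1 := by
    rw [← mul_assoc, hRR, Matrix.nonsing_inv_mul _ hu]
  have h2 : R * (c • F) * R = 1 := mul_eq_one_comm.1 h1
  set T := Matrix.toEuclideanCLM (n := Fin d) (𝕜 := ℝ) with hT
  have hinv1 : T (R * (c • F)) * T R = 1 := by rw [← map_mul, h2, map_one]
  have hinv2 : T R * T (R * (c • F)) = 1 := by rw [← map_mul, h1, map_one]
  -- The map is given by the same matrix square root as in `multivariateGaussian`, so the target
  -- Gaussian is literally the image of the standard one under an affine map with linear part `A`.
  refine ⟨ContinuousLinearEquiv.equivOfInverse (T R) (T (R * (c • F)))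
    (fun x => congrArg (fun L => L x) hinv1) (fun x => congrArg (fun L => L x) hinv2),
    fun x => rfl, fun u w => ?_⟩
  have h3 : ∀ z, (T R z).ofLp = R *ᵥ z.ofLp := fun z => Matrix.ofLp_toEuclideanCLM R z
  change (T R u).ofLp ⬝ᵥ (F *ᵥ (T R w).ofLp) = _
  have h4 : R * F * R = c⁻¹ • (1 : Matrix (Fin d) (Fin d) ℝ) := by
    rw [← h2, Matrix.mul_smul, Matrix.smul_mul, smul_smul, inv_mul_cancel₀ hc.ne', one_smul]
  have h5 : R *ᵥ u.ofLp = u.ofLp ᵥ* R := by rw [← Matrix.vecMul_transpose, hRT]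
  rw [h3, h3, h5, ← Matrix.dotProduct_mulVec, Matrix.mulVec_mulVec, Matrix.mulVec_mulVec, h4,
    Matrix.smul_mulVec, Matrix.one_mulVec, dotProduct_smul, smul_eq_mul,
    EuclideanSpace.inner_eq_star_dotProduct, star_trivial, dotProduct_comm]

/-! ### The loss of a generalized linear model in whitened coordinates -/

section SumOfAffineCompositions

variable {ι E F : Type*} [Fintype ι] [NormedAddCommGroup E] [NormedSpace ℝ E]
  [NormedAddCommGroup F] [NormedSpace ℝ F] {ψ : F → ℝ} {Ω : Set F} {c : ι → F} {L : ι → E →L[ℝ] F}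

lemma isOpen_forall_affine_mem (hΩ : IsOpen Ω) : IsOpen {x | ∀ i, c i + L i x ∈ Ω} := by
  simp only [Set.ofPred_forall]
  exact isOpen_iInter_of_finite fun i => hΩ.preimage (by fun_prop)

lemma contDiffOn_sum_affine (hψ : ContDiffOn ℝ 3 ψ Ω) :
    ContDiffOn ℝ 3 (fun x => ∑ i, ψ (c i + L i x)) {x | ∀ i, c i + L i x ∈ Ω} := by
  refine ContDiffOn.sum fun i _ => hψ.comp ?_ fun x hx => hx i
  exact (contDiff_const.add (L i).contDiff).contDiffOn

lemma convexOn_sum_affine (hψ : ConvexOn ℝ Ω ψ) :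
    ConvexOn ℝ {x | ∀ i, c i + L i x ∈ Ω} (fun x => ∑ i, ψ (c i + L i x)) := by
  have e : ∀ (x y : E) (a b : ℝ), a + b = 1 → ∀ i,
      c i + L i (a • x + b • y) = a • (c i + L i x) + b • (c i + L i y) := by
    intro x y a b hab i
    rw [map_add, map_smul, map_smul, smul_add, smul_add, add_add_add_comm, ← add_smul, hab,
      one_smul]
  refine ⟨fun x hx y hy a b ha hb hab i => ?_, fun x hx y hy a b ha hb hab => ?_⟩
  · rw [e x y a b hab]
    exact hψ.1 (hx i) (hy i) ha hb hab
  · rw [smul_eq_mul, smul_eq_mul, Finset.mul_sum, Finset.mul_sum, ← Finset.sum_add_distrib]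
    refine Finset.sum_le_sum fun i _ => ?_
    rw [e x y a b hab]
    exact hψ.2 (hx i) (hy i) ha hb hab

lemma fderiv_sum_affine (hΩ : IsOpen Ω) (hψ : ContDiffOn ℝ 3 ψ Ω) {x : E}
    (hx : ∀ i, c i + L i x ∈ Ω) (u : E) :
    fderiv ℝ (fun x => ∑ i, ψ (c i + L i x)) x u
      = ∑ i, fderiv ℝ ψ (c i + L i x) (L i u) := by
  have h : ∀ i ∈ Finset.univ, HasFDerivAt (fun x => ψ (c i + L i x))
      ((fderiv ℝ ψ (c i + L i x)).comp (L i)) x := fun i _ =>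
    ((hψ.contDiffAt (hΩ.mem_nhds (hx i))).differentiableAt (by norm_num)).hasFDerivAt.comp x
      ((L i).hasFDerivAt.const_add (c i))
  rw [(HasFDerivAt.fun_sum h).fderiv, sum_apply]
  rfl

lemma eventually_line_mem (hΩ : IsOpen Ω) {x : E} (hx : ∀ i, c i + L i x ∈ Ω) (u : E) :
    ∀ᶠ t : ℝ in nhds 0, x + t • u ∈ {x | ∀ i, c i + L i x ∈ Ω} := by
  have hc : Continuous fun t : ℝ => x + t • u := by fun_prop
  exact hc.continuousAt.eventually_mem ((isOpen_forall_affine_mem hΩ).mem_nhds (by simpa using hx))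

/-- Only diagonal values are needed, so it suffices to differentiate the first-order formula along
the line in direction `u` and to use uniqueness of derivatives. -/
lemma fderiv_fderiv_sum_affine (hΩ : IsOpen Ω) (hψ : ContDiffOn ℝ 3 ψ Ω) {x : E}
    (hx : ∀ i, c i + L i x ∈ Ω) (u : E) :
    fderiv ℝ (fderiv ℝ fun x => ∑ i, ψ (c i + L i x)) x u u
      = ∑ i, fderiv ℝ (fderiv ℝ ψ) (c i + L i x) (L i u) (L i u) := by
  have h1 := hasDerivAt_fderiv_comp_line (isOpen_forall_affine_mem hΩ)
    (contDiffOn_sum_affine (c := c) (L := L) hψ) (x := x) (v := u) u (t := 0) (by simpa using hx)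
  have h2 : HasDerivAt (fun t : ℝ => ∑ i, fderiv ℝ ψ (c i + L i x + t • L i u) (L i u))
      (∑ i, fderiv ℝ (fderiv ℝ ψ) (c i + L i x + (0 : ℝ) • L i u) (L i u) (L i u)) 0 :=
    HasDerivAt.fun_sum fun i _ => hasDerivAt_fderiv_comp_line hΩ hψ _ (by simpa using hx i)
  have h3 := h2.congr_of_eventuallyEq (f₁ := fun t : ℝ =>
    fderiv ℝ (fun x => ∑ i, ψ (c i + L i x)) (x + t • u) u) (by
      filter_upwards [eventually_line_mem hΩ hx u] with t ht
      rw [fderiv_sum_affine hΩ hψ ht]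
      simp only [map_add, map_smul, add_assoc])
  simpa using h1.unique h3

lemma fderiv_fderiv_fderiv_sum_affine (hΩ : IsOpen Ω) (hψ : ContDiffOn ℝ 3 ψ Ω) {x : E}
    (hx : ∀ i, c i + L i x ∈ Ω) (u : E) :
    fderiv ℝ (fderiv ℝ (fderiv ℝ fun x => ∑ i, ψ (c i + L i x))) x u u u
      = ∑ i, fderiv ℝ (fderiv ℝ (fderiv ℝ ψ)) (c i + L i x) (L i u) (L i u) (L i u) := by
  have h1 := hasDerivAt_fderiv_fderiv_comp_line (isOpen_forall_affine_mem hΩ)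
    (contDiffOn_sum_affine (c := c) (L := L) hψ) (x := x) (v := u) u u (t := 0)
    (by simpa using hx)
  have h2 : HasDerivAt
      (fun t : ℝ => ∑ i, fderiv ℝ (fderiv ℝ ψ) (c i + L i x + t • L i u) (L i u) (L i u))
      (∑ i, fderiv ℝ (fderiv ℝ (fderiv ℝ ψ)) (c i + L i x + (0 : ℝ) • L i u)
        (L i u) (L i u) (L i u)) 0 :=
    HasDerivAt.fun_sum fun i _ =>
      hasDerivAt_fderiv_fderiv_comp_line hΩ hψ _ _ (by simpa using hx i)
  have h3 := h2.congr_of_eventuallyEq (f₁ := fun t : ℝ =>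
    fderiv ℝ (fderiv ℝ fun x => ∑ i, ψ (c i + L i x)) (x + t • u) u u) (by
      filter_upwards [eventually_line_mem hΩ hx u] with t ht
      rw [fderiv_fderiv_sum_affine hΩ hψ ht]
      simp only [map_add, map_smul, add_assoc])
  simpa using h1.unique h3

end SumOfAffineCompositions

lemma lintegral_pi_prod {ι E : Type*} [Fintype ι] [MeasurableSpace E] (P : ι → Measure E)
    [∀ i, IsProbabilityMeasure (P i)] {f : ι → E → ℝ≥0∞} (hf : ∀ i, Measurable (f i)) :
    ∫⁻ y, ∏ i, f i (y i) ∂Measure.pi P = ∏ i, ∫⁻ y, f i y ∂P i := by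
  refine (lintegral_prod_eq_prod_lintegral_of_indepFun (μ := Measure.pi P) Finset.univ
    (fun i (y : ι → E) => f i (y i)) (iIndepFun_pi fun i => (hf i).aemeasurable)
    fun i => (hf i).comp (measurable_pi_apply i)).trans ?_
  exact Finset.prod_congr rfl fun i _ => (measurePreserving_eval P i).lintegral_comp (hf i)

namespace GLM

variable {d k n : ℕ} (M : GLM d k n) (θstar : EuclideanSpace ℝ (Fin d))
  (A : EuclideanSpace ℝ (Fin d) ≃L[ℝ] EuclideanSpace ℝ (Fin d))

/-- The linear predictor in the coordinates `θ = θ* + A x`. -/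
noncomputable def localPredictor (i : Fin n) :
    EuclideanSpace ℝ (Fin d) →L[ℝ] EuclideanSpace ℝ (Fin k) :=
  (M.predictorL i).comp A.toContinuousLinearMap

/-- The parameter domain in the coordinates `θ = θ* + A x`. -/
def localDomain : Set (EuclideanSpace ℝ (Fin d)) :=
  {x | ∀ i, M.predictor i θstar + M.localPredictor A i x ∈ naturalSpace M.base}

/-- The sum of the log-partition functions in the coordinates `θ = θ* + A x`. -/
noncomputable def localLoss (x : EuclideanSpace ℝ (Fin d)) : ℝ :=
  ∑ i, logPartition M.base (M.predictor i θstar + M.localPredictor A i x)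

/-- The vector of the linear part of the log likelihood in the coordinates `θ = θ* + A x`. -/
noncomputable def localScore (Y : Fin n → EuclideanSpace ℝ (Fin k)) : EuclideanSpace ℝ (Fin d) :=
  ∑ i, ContinuousLinearMap.adjoint (M.localPredictor A i) (Y i)

lemma predictor_add (i : Fin n) (x : EuclideanSpace ℝ (Fin d)) :
    M.predictor i (θstar + A x)
      = M.predictor i θstar + M.localPredictor A i x := by
  rw [← predictorL_apply, map_add]
  rfl

lemma mem_localDomain {x : EuclideanSpace ℝ (Fin d)} :
    x ∈ M.localDomain θstar A ↔ θstar + A x ∈ M.paramSpace := by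
  simp only [localDomain, paramSpace, Set.mem_ofPred_eq, predictor_add]

lemma inner_localScore (Y : Fin n → EuclideanSpace ℝ (Fin k)) (x : EuclideanSpace ℝ (Fin d)) :
    ⟪M.localScore A Y, x⟫ = ∑ i, ⟪Y i, M.localPredictor A i x⟫ := by
  simp only [localScore, sum_inner, ContinuousLinearMap.adjoint_inner_left]

lemma negLogLik_add (Y : Fin n → EuclideanSpace ℝ (Fin k)) (x : EuclideanSpace ℝ (Fin d)) :
    M.negLogLik Y (θstar + A x) = (n : ℝ)⁻¹ *
      (M.localLoss θstar A x - ⟪M.localScore A Y, x⟫ - ∑ i, ⟪Y i, M.predictor i θstar⟫) := by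
  simp only [negLogLik, predictor_add, inner_localScore, localLoss, inner_add_right,
    Finset.sum_sub_distrib, Finset.sum_add_distrib]
  ring

lemma measurable_localScore : Measurable (M.localScore A) := by
  unfold localScore
  fun_prop

variable {M θstar A}

/-- The moment generating function of the label average. -/
lemma lintegral_exp_localScore (hμ : M.base ≠ 0) (hθ : θstar ∈ M.paramSpace)
    {x : EuclideanSpace ℝ (Fin d)} (hx : x ∈ M.localDomain θstar A) :
    ∫⁻ Y, ENNReal.ofReal (Real.exp ⟪M.localScore A Y, x⟫) ∂M.labelLaw θstar
      = ENNReal.ofReal (Real.exp (M.localLoss θstar A x - M.localLoss θstar A 0)) := by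
  have hP : ∀ i, IsProbabilityMeasure (expFamily M.base (M.predictor i θstar)) :=
    fun i => isProbabilityMeasure_expFamily hμ (hθ i)
  have hm : ∀ v : EuclideanSpace ℝ (Fin k), Measurable fun y : EuclideanSpace ℝ (Fin k) =>
      ENNReal.ofReal (Real.exp ⟪v, y⟫) := by
    intro v
    have : Measurable fun y : EuclideanSpace ℝ (Fin k) => ⟪v, y⟫ :=
      (by fun_prop : Continuous _).measurable
    fun_prop
  have hprod : ∀ v : Fin n → EuclideanSpace ℝ (Fin k),
      ∫⁻ Y, ∏ i, ENNReal.ofReal (Real.exp ⟪v i, Y i⟫) ∂M.labelLaw θstar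
        = ∏ i, ∫⁻ y, ENNReal.ofReal (Real.exp ⟪v i, y⟫)
          ∂expFamily M.base (M.predictor i θstar) := by
    intro v
    exact lintegral_pi_prod _ fun i => hm (v i)
  have h1 : ∀ Y, ENNReal.ofReal (Real.exp ⟪M.localScore A Y, x⟫)
      = ∏ i, ENNReal.ofReal (Real.exp ⟪M.localPredictor A i x, Y i⟫) := by
    intro Y
    rw [inner_localScore, Real.exp_sum, ENNReal.ofReal_prod_of_nonneg fun i _ => (Real.exp_pos _).le]
    exact Finset.prod_congr rfl fun i _ => by rw [real_inner_comm]
  rw [lintegral_congr h1, hprod,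
    Finset.prod_congr rfl fun i _ => lintegral_exp_expFamily hμ (hx i),
    ← ENNReal.ofReal_prod_of_nonneg fun i _ => (Real.exp_pos _).le, ← Real.exp_sum,
    Finset.sum_sub_distrib]
  simp only [localLoss, map_zero, add_zero]

end GLM

/-! ### The model in whitened coordinates: loss, score event and estimator. -/

namespace GLM

variable {d k n : ℕ} {M : GLM d k n} {θstar : EuclideanSpace ℝ (Fin d)}
  {A : EuclideanSpace ℝ (Fin d) ≃L[ℝ] EuclideanSpace ℝ (Fin d)} {s : ℝ}

/-- `A` turns `n` times the Fisher information into the identity. -/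
def IsWhitening (M : GLM d k n) (θstar : EuclideanSpace ℝ (Fin d))
    (A : EuclideanSpace ℝ (Fin d) ≃L[ℝ] EuclideanSpace ℝ (Fin d)) : Prop :=
  ∀ u w, (A u).ofLp ⬝ᵥ (M.fisher θstar *ᵥ (A w).ofLp) = (n : ℝ)⁻¹ * ⟪u, w⟫

lemma IsWhitening.weightedNorm_eq (hA : M.IsWhitening θstar A) (x : EuclideanSpace ℝ (Fin d)) :
    weightedNorm (M.fisher θstar) (A x) = ‖x‖ / √n := by
  rw [weightedNorm, hA, real_inner_self_eq_norm_sq, Real.sqrt_mul (by positivity),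
    Real.sqrt_sq (norm_nonneg _), Real.sqrt_inv, div_eq_mul_inv, mul_comm]

lemma IsWhitening.add_mem_nbhd_iff (hA : M.IsWhitening θstar A) (hn : 0 < n)
    {x : EuclideanSpace ℝ (Fin d)} : θstar + A x ∈ M.nbhd θstar s ↔ ‖x‖ ≤ s * √d := by
  have hn0 : (0 : ℝ) < √n := Real.sqrt_pos.2 (by exact_mod_cast hn)
  rw [nbhd, Set.mem_ofPred_eq, add_sub_cancel_left, hA.weightedNorm_eq,
    Real.sqrt_div (by positivity), ← mul_div_assoc, div_le_div_iff_of_pos_right hn0]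

lemma delta3_ne_top (hd : 0 < d) (hn : 0 < n) (hs : 12 ≤ s)
    (h3 : ENNReal.ofReal (2 * s) * M.delta3 θstar (2 * s) * ENNReal.ofReal √((d : ℝ) / n)
      ≤ ENNReal.ofReal (1 / 4)) : M.delta3 θstar (2 * s) ≠ ∞ := by
  intro h
  have hd0 : (0 : ℝ) < √((d : ℝ) / n) := by positivity
  rw [h, ENNReal.mul_top (by simp; linarith), ENNReal.top_mul (by simpa using hd0)] at h3
  exact absurd h3 (by simp)

/-- In whitened coordinates the denominator of `delta3` is `(‖u‖²/n)^{3/2} = ‖u‖³/(n√n)`. The factor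
`1/n` of the numerator cancels and `1/√n` remains. -/
lemma sum_fderiv_three_le (hn : 0 < n) (hA : M.IsWhitening θstar A)
    (h3 : M.delta3 θstar s ≠ ∞) {x : EuclideanSpace ℝ (Fin d)} (hx : ‖x‖ ≤ s * √d)
    (u : EuclideanSpace ℝ (Fin d)) :
    ∑ i, fderiv ℝ (fderiv ℝ (fderiv ℝ (logPartition M.base)))
      (M.predictor i (θstar + A x)) (M.predictor i (A u)) (M.predictor i (A u))
      (M.predictor i (A u)) ≤ (M.delta3 θstar s).toReal / √n * ‖u‖ ^ 3 := by
  rcases eq_or_ne u 0 with rfl | hu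
  · have : ∀ i, M.predictor i 0 = 0 := fun i => (M.predictorL i).map_zero
    simp [this]
  have hn0 : (0 : ℝ) < n := by exact_mod_cast hn
  have hu0 : 0 < ‖u‖ := norm_pos_iff.2 hu
  have hle := le_iSup₂_of_le (f := fun θ (_ : θ ∈ M.nbhd θstar s) =>
    ⨆ (u : EuclideanSpace ℝ (Fin d)) (_ : u ≠ 0), ENNReal.ofReal
      (((n : ℝ)⁻¹ * ∑ i, iteratedFDeriv ℝ 3 (logPartition M.base) (M.predictor i θ)
          (fun _ => M.predictor i u)) /
        ((n : ℝ)⁻¹ * ∑ i, iteratedFDeriv ℝ 2 (logPartition M.base) (M.predictor i θstar)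
          (fun _ => M.predictor i u)) ^ (3 / 2 : ℝ)))
    (θstar + A x) ((hA.add_mem_nbhd_iff hn).2 hx)
    (le_iSup₂_of_le (A u) (by simpa using hu) le_rfl)
  change _ ≤ M.delta3 θstar s at hle
  simp only [iteratedFDeriv_two_diag, iteratedFDeriv_three_diag] at hle
  rw [← M.dotProduct_fisher_mulVec, hA, real_inner_self_eq_norm_sq,
    ← ENNReal.ofReal_toReal h3, ENNReal.ofReal_le_ofReal_iff ENNReal.toReal_nonneg] at hle
  have hpow : ((n : ℝ)⁻¹ * ‖u‖ ^ 2) ^ (3 / 2 : ℝ) = (n * √n)⁻¹ * ‖u‖ ^ 3 := by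
    have e : (n : ℝ)⁻¹ * ‖u‖ ^ 2 = (‖u‖ / √n) ^ (2 : ℝ) := by
      rw [Real.rpow_two, div_pow, Real.sq_sqrt hn0.le]
      ring
    rw [e, ← Real.rpow_mul (by positivity), show (2 : ℝ) * (3 / 2) = (3 : ℕ) by norm_num,
      Real.rpow_natCast, div_pow, pow_succ (√(n : ℝ)), Real.sq_sqrt hn0.le]
    ring
  rw [hpow, div_le_iff₀ (by positivity)] at hle
  have h4 := mul_le_mul_of_nonneg_left hle hn0.le
  rw [mul_inv_cancel_left₀ hn0.ne'] at h4
  refine h4.trans (le_of_eq ?_)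
  field_simp

lemma isOpen_localDomain (hΩ : IsOpen (naturalSpace M.base)) : IsOpen (M.localDomain θstar A) :=
  isOpen_forall_affine_mem (c := fun i => M.predictor i θstar)
    (L := M.localPredictor A) hΩ

lemma convexOn_localLoss (hμ : M.base ≠ 0) :
    ConvexOn ℝ (M.localDomain θstar A) (M.localLoss θstar A) :=
  convexOn_sum_affine (c := fun i => M.predictor i θstar)
    (L := M.localPredictor A) (convexOn_logPartition hμ)

lemma contDiffOn_localLoss (hΩ : IsOpen (naturalSpace M.base)) (hμ : M.base ≠ 0) :
    ContDiffOn ℝ 3 (M.localLoss θstar A) (M.localDomain θstar A) :=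
  contDiffOn_sum_affine (c := fun i => M.predictor i θstar)
    (L := M.localPredictor A) (contDiffOn_logPartition hΩ hμ)

lemma whitenedLoss (hd : 0 < d) (hn : 0 < n) (hM : IsRegularMinimal M.base) (hcol : M.ColumnsSpan)
    (hθ : θstar ∈ M.paramSpace) (hA : M.IsWhitening θstar A) (hs : 12 ≤ s)
    (hsub : M.nbhd θstar (2 * s) ⊆ M.paramSpace)
    (h3 : ENNReal.ofReal (2 * s) * M.delta3 θstar (2 * s) * ENNReal.ofReal √((d : ℝ) / n)
      ≤ ENNReal.ofReal (1 / 4)) :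
    WhitenedLoss s ((M.delta3 θstar (2 * s)).toReal / √n) (M.localDomain θstar A)
      (M.localLoss θstar A) := by
  have hμ := hM.ne_zero (hcol.pos hd)
  have hΩ := hM.isOpen_naturalSpace
  have hψ := contDiffOn_logPartition hΩ hμ
  have h3t := delta3_ne_top hd hn hs h3
  have hn0 : (0 : ℝ) < n := by exact_mod_cast hn
  have hball : Metric.closedBall 0 (2 * s * √d) ⊆ M.localDomain θstar A := by
    intro x hx
    rw [mem_localDomain]
    exact hsub ((hA.add_mem_nbhd_iff hn).2 (by simpa using hx))
  have h0 : (0 : EuclideanSpace ℝ (Fin d)) ∈ M.localDomain θstar A := by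
    simpa [mem_localDomain] using hθ
  refine ⟨hd, hs, by positivity, ?_, isOpen_localDomain hΩ,
    convexOn_localLoss hμ, contDiffOn_localLoss hΩ hμ, hball, fun u => ?_,
    fun x hx u => ?_⟩
  · have h4 := ENNReal.toReal_mono ENNReal.ofReal_ne_top h3
    rw [ENNReal.toReal_mul, ENNReal.toReal_mul, ENNReal.toReal_ofReal (by linarith),
      ENNReal.toReal_ofReal (by positivity), ENNReal.toReal_ofReal (by norm_num),
      Real.sqrt_div (by positivity)] at h4
    refine (le_of_eq ?_).trans h4
    ring
  · have h4 := fderiv_fderiv_sum_affine (c := fun i => M.predictor i θstar)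
      (L := M.localPredictor A) hΩ hψ h0 u
    simp only [map_zero, add_zero] at h4
    have h5 := M.dotProduct_fisher_mulVec θstar (A u) (A u)
    rw [hA, real_inner_self_eq_norm_sq] at h5
    exact h4.trans (mul_left_cancel₀ (inv_ne_zero hn0.ne') h5).symm
  · have h4 := fderiv_fderiv_fderiv_sum_affine (c := fun i => M.predictor i θstar)
      (L := M.localPredictor A) hΩ hψ (hball hx) u
    have h5 := sum_fderiv_three_le hn hA h3t (by simpa using hx) u
    simp only [predictor_add] at h5
    exact h4.le.trans h5

/-- The gradient at the origin of the loss in whitened coordinates. -/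
noncomputable def localGradient (M : GLM d k n) (θstar : EuclideanSpace ℝ (Fin d))
    (A : EuclideanSpace ℝ (Fin d) ≃L[ℝ] EuclideanSpace ℝ (Fin d)) : EuclideanSpace ℝ (Fin d) :=
  (InnerProductSpace.toDual ℝ _).symm (fderiv ℝ (M.localLoss θstar A) 0)

lemma inner_localGradient (u : EuclideanSpace ℝ (Fin d)) :
    ⟪M.localGradient θstar A, u⟫ = fderiv ℝ (M.localLoss θstar A) 0 u := by
  rw [localGradient, InnerProductSpace.toDual_symm_apply]

/-- The labels for which the score is not too large. -/
def scoreEvent (M : GLM d k n) (θstar : EuclideanSpace ℝ (Fin d))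
    (A : EuclideanSpace ℝ (Fin d) ≃L[ℝ] EuclideanSpace ℝ (Fin d)) (s : ℝ) :
    Set (Fin n → EuclideanSpace ℝ (Fin k)) :=
  {Y | ‖M.localScore A Y - M.localGradient θstar A‖ < 7 / 10 * (s * √d)}

lemma measurableSet_scoreEvent : MeasurableSet (M.scoreEvent θstar A s) :=
  measurableSet_lt (((M.measurable_localScore A).sub_const _).norm) measurable_const

/-- The log moment generating function of the centered score is the second-order remainder of
`localLoss` at 0. The third-order Taylor bound makes it at most `(1/2 + 1/24)‖t‖² = 13/24 ‖t‖²`, as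
`measure_norm_ge_le` requires. -/
lemma labelLaw_scoreEvent_ge (hμ : M.base ≠ 0) (hθ : θstar ∈ M.paramSpace) {τ : ℝ}
    (H : WhitenedLoss s τ (M.localDomain θstar A) (M.localLoss θstar A)) :
    ENNReal.ofReal (1 - Real.exp (-(d * s ^ 2 / 10)))
      ≤ M.labelLaw θstar (M.scoreEvent θstar A s) := by
  have hP : ∀ i, IsProbabilityMeasure (expFamily M.base (M.predictor i θstar)) :=
    fun i => isProbabilityMeasure_expFamily hμ (hθ i)
  have hPL : IsProbabilityMeasure (M.labelLaw θstar) := by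
    unfold labelLaw
    infer_instance
  have hmgf : ∀ t : EuclideanSpace ℝ (Fin d), ‖t‖ ≤ 2 * s * √d →
      ∫⁻ Y, ENNReal.ofReal (Real.exp ⟪M.localScore A Y - M.localGradient θstar A, t⟫)
        ∂M.labelLaw θstar ≤ ENNReal.ofReal (Real.exp (13 / 24 * ‖t‖ ^ 2)) := by
    intro t ht
    have htb : t ∈ Metric.closedBall 0 (2 * s * √d) := by simpa using ht
    have h1 : ∀ Y, ENNReal.ofReal (Real.exp ⟪M.localScore A Y - M.localGradient θstar A, t⟫)
        = ENNReal.ofReal (Real.exp (-fderiv ℝ (M.localLoss θstar A) 0 t)) *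
          ENNReal.ofReal (Real.exp ⟪M.localScore A Y, t⟫) := by
      intro Y
      rw [← ENNReal.ofReal_mul (Real.exp_pos _).le, ← Real.exp_add, inner_sub_left,
        inner_localGradient]
      ring_nf
    rw [lintegral_congr h1, lintegral_const_mul' _ _ ENNReal.ofReal_ne_top,
      lintegral_exp_localScore hμ hθ (H.ball_subset htb), ← ENNReal.ofReal_mul (Real.exp_pos _).le,
      ← Real.exp_add]
    refine ENNReal.ofReal_le_ofReal (Real.exp_le_exp.2 ?_)
    have h2 := (abs_le.1 (H.taylor htb)).2
    have h3 : τ * ‖t‖ ^ 3 ≤ 1 / 4 * ‖t‖ ^ 2 := by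
      calc τ * ‖t‖ ^ 3 = ‖t‖ * τ * ‖t‖ ^ 2 := by ring
        _ ≤ 1 / 4 * ‖t‖ ^ 2 := by
          refine mul_le_mul_of_nonneg_right ?_ (by positivity)
          exact (mul_le_mul_of_nonneg_right ht H.τ_nonneg).trans H.τ_le
    linarith
  have h1 := measure_norm_ge_le (P := M.labelLaw θstar)
    ((M.measurable_localScore A).sub_const (M.localGradient θstar A)) H.dim_pos H.s_ge hmgf
  have h2 : M.scoreEvent θstar A s
      = {Y | 7 / 10 * (s * √d) ≤ ‖M.localScore A Y - M.localGradient θstar A‖}ᶜ := by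
    ext Y
    simp [scoreEvent]
  rw [h2, prob_compl_eq_one_sub (by
    exact measurableSet_le measurable_const ((M.measurable_localScore A).sub_const _).norm),
    ENNReal.ofReal_sub _ (Real.exp_pos _).le, ENNReal.ofReal_one]
  exact tsub_le_tsub_left h1 1

/-- The maximum likelihood estimator in whitened coordinates. -/
lemma exists_local_minimizer (hn : 0 < n) {τ : ℝ}
    (H : WhitenedLoss s τ (M.localDomain θstar A) (M.localLoss θstar A))
    {Y : Fin n → EuclideanSpace ℝ (Fin k)} (hY : Y ∈ M.scoreEvent θstar A s) :
    ∃ x ∈ M.localDomain θstar A, ‖x‖ ≤ 3 / 2 * (s * √d) ∧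
      fderiv ℝ (M.localLoss θstar A) x = innerBilin d (M.localScore A Y) ∧
      M.IsMLE Y (θstar + A x) ∧ ∀ θ, M.IsMLE Y θ → θ = θstar + A x := by
  obtain ⟨x, hxD, hx, hgrad, hmin, huniq⟩ := H.exists_minimizer (M.localScore A Y) fun u => by
    rw [← inner_localGradient, ge_iff_le, ← inner_sub_left]
    have h1 := real_inner_le_norm (M.localScore A Y - M.localGradient θstar A) u
    have h2 := mul_le_mul_of_nonneg_right (le_of_lt hY) (norm_nonneg u)
    rw [inner_sub_left] at h1 ⊢
    linarith
  have hni : (0 : ℝ) < (n : ℝ)⁻¹ := by positivity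
  have hθ : ∀ θ, θstar + A (A.symm (θ - θstar)) = θ := by simp
  refine ⟨x, hxD, hx, hgrad, ⟨(M.mem_localDomain θstar A).1 hxD, fun θ h => ?_⟩, fun θ h => ?_⟩
  · rw [← hθ θ] at h ⊢
    rw [negLogLik_add, negLogLik_add]
    have := hmin _ ((M.mem_localDomain θstar A).2 h)
    exact mul_le_mul_of_nonneg_left (by linarith) hni.le
  · have h1 := h.2 _ ((M.mem_localDomain θstar A).1 hxD)
    have h2 := h.1
    rw [← hθ θ] at h1 h2
    rw [negLogLik_add, negLogLik_add] at h1
    have h3 := le_of_mul_le_mul_left h1 hni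
    rw [← hθ θ, huniq _ ((M.mem_localDomain θstar A).2 h2) (by linarith)]

end GLM

/-! ### The posterior in whitened coordinates -/

section ChangeOfVariables

variable {E : Type*} [NormedAddCommGroup E] [NormedSpace ℝ E] [MeasurableSpace E] [BorelSpace E]
  [FiniteDimensional ℝ E]

/-- The Jacobian factor stays anonymous because it cancels when the posterior is normalized. -/
lemma exists_lintegral_comp_affine (μ : Measure E) [μ.IsAddHaarMeasure] (θ : E) (A : E ≃L[ℝ] E) :
    ∃ c : ℝ≥0∞, c ≠ 0 ∧ c ≠ ∞ ∧ ∀ (g : E → ℝ≥0∞) {S : Set E}, MeasurableSet S →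
      ∫⁻ x in S, g x ∂μ = c * ∫⁻ y in (fun y => θ + A y) ⁻¹' S, g (θ + A y) ∂μ := by
  have hdet : LinearMap.det (A.toLinearEquiv : E →ₗ[ℝ] E) ≠ 0 :=
    A.toLinearEquiv.isUnit_det'.ne_zero
  set κ := ENNReal.ofReal |(LinearMap.det (A.toLinearEquiv : E →ₗ[ℝ] E))⁻¹|
  have hκ0 : κ ≠ 0 := by simpa [κ] using hdet
  have hκt : κ ≠ ∞ := ENNReal.ofReal_ne_top
  have hemb : MeasurableEmbedding fun y => θ + A y :=
    (A.toHomeomorph.trans (Homeomorph.addLeft θ)).measurableEmbedding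
  have hmap : μ.map (fun y => θ + A y) = κ • μ := by
    have h1 : μ.map (fun y => A y) = κ • μ := Measure.map_linearMap_addHaar_eq_smul_addHaar μ hdet
    have h2 := Measure.map_map (μ := μ) (measurable_const_add θ) A.continuous.measurable
    simp only [Function.comp_def] at h2
    rw [← h2, h1, Measure.map_smul, map_add_left_eq_self]
  refine ⟨κ⁻¹, by simpa using hκt, by simpa using hκ0, fun g S hS => ?_⟩
  have h3 : ∫⁻ x in S, g x ∂(κ • μ) = ∫⁻ y in (fun y => θ + A y) ⁻¹' S, g (θ + A y) ∂μ := by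
    rw [← hmap, hemb.restrict_map, hemb.lintegral_map]
  rw [← h3, Measure.restrict_smul, lintegral_smul_measure, smul_eq_mul,
    ENNReal.inv_mul_cancel_left' (by simp [hκ0]) (by simp [hκt])]

end ChangeOfVariables

lemma tvDistance_le_one {α : Type*} [MeasurableSpace α] (P Q : Measure α) [IsProbabilityMeasure P]
    [IsProbabilityMeasure Q] : tvDistance P Q ≤ 1 := by
  refine iSup₂_le fun S _ => ?_
  rw [ENNReal.ofReal_le_one, abs_sub_le_iff]
  have h1 := measureReal_nonneg (μ := P) (s := S)
  have h2 := measureReal_nonneg (μ := Q) (s := S)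
  have h3 := measureReal_le_one (μ := P) (s := S)
  have h4 := measureReal_le_one (μ := Q) (s := S)
  constructor <;> linarith

namespace WhitenedLoss

variable {d : ℕ} {s τ : ℝ} {D : Set (EuclideanSpace ℝ (Fin d))}
  {K p : EuclideanSpace ℝ (Fin d) → ℝ} {b xhat : EuclideanSpace ℝ (Fin d)}

lemma integral_centeredWeight_pos (H : WhitenedLoss s τ D K) (hx : ‖xhat‖ ≤ 3 / 2 * (s * √d))
    (hp : ∀ x ∈ D, 0 ≤ p x)
    (hp0 : ∀ x ∈ Metric.ball (0 : EuclideanSpace ℝ (Fin d)) (2 * s * √d), 0 < p x)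
    (hi : Integrable (centeredWeight D K p b xhat)) :
    0 < ∫ y, centeredWeight D K p b xhat y := by
  have hr := H.radius_pos
  have hpx : 0 < p xhat := by
    have := hp0 _ (add_mem_ball hx (Metric.mem_ball_self (by positivity : 0 < s * √d / 2)))
    rwa [add_zero] at this
  rw [integral_pos_iff_support_of_nonneg (centeredWeight_nonneg hp hpx) hi]
  refine (Metric.measure_ball_pos volume (0 : EuclideanSpace ℝ (Fin d))
    (by positivity : 0 < s * √d / 2)).trans_le (measure_mono fun y hy => ?_)
  have h1 := add_mem_ball hx hy
  have h2 := H.ball_subset (Metric.ball_subset_closedBall h1)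
  have h3 := hp0 _ h1
  rw [Function.mem_support, centeredWeight, Set.indicator_of_mem (by exact h2)]
  positivity

end WhitenedLoss

namespace GLM

variable {d k n : ℕ} {M : GLM d k n} {θstar xhat : EuclideanSpace ℝ (Fin d)}
  {A : EuclideanSpace ℝ (Fin d) ≃L[ℝ] EuclideanSpace ℝ (Fin d)} {s : ℝ}
  {prior : EuclideanSpace ℝ (Fin d) → ℝ} {Y : Fin n → EuclideanSpace ℝ (Fin k)}

/-- The posterior weight in whitened coordinates centered at the estimator. -/
noncomputable def localWeight (M : GLM d k n) (θstar : EuclideanSpace ℝ (Fin d))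
    (A : EuclideanSpace ℝ (Fin d) ≃L[ℝ] EuclideanSpace ℝ (Fin d))
    (prior : EuclideanSpace ℝ (Fin d) → ℝ) (Y : Fin n → EuclideanSpace ℝ (Fin k))
    (xhat : EuclideanSpace ℝ (Fin d)) : EuclideanSpace ℝ (Fin d) → ℝ :=
  centeredWeight (M.localDomain θstar A) (M.localLoss θstar A) (fun x => prior (θstar + A x))
    (M.localScore A Y) xhat

/-- The negative log likelihood times `n` differs from its value at the center exactly by
`lossIncrement`, so a constant factors out of the posterior density. -/
lemma indicator_posteriorDensity (hn : 0 < n) (hpx : 0 < prior (θstar + A xhat))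
    (y : EuclideanSpace ℝ (Fin d)) :
    M.paramSpace.indicator (fun θ =>
        ENNReal.ofReal (Real.exp (-(n : ℝ) * M.negLogLik Y θ) * prior θ)) (θstar + A xhat + A y)
      = ENNReal.ofReal (Real.exp (-(n : ℝ) * M.negLogLik Y (θstar + A xhat)) *
          prior (θstar + A xhat)) * ENNReal.ofReal (M.localWeight θstar A prior Y xhat y) := by
  have hn0 : (n : ℝ) ≠ 0 := by exact_mod_cast hn.ne'
  have e : θstar + A xhat + A y = θstar + A (xhat + y) := by rw [map_add, add_assoc]
  rw [localWeight, centeredWeight]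
  by_cases hy : xhat + y ∈ M.localDomain θstar A
  · rw [e, Set.indicator_of_mem ((M.mem_localDomain θstar A).1 hy),
      Set.indicator_of_mem (by exact hy), ← ENNReal.ofReal_mul (by positivity)]
    congr 1
    have h1 : -(n : ℝ) * M.negLogLik Y (θstar + A (xhat + y))
        = -(n : ℝ) * M.negLogLik Y (θstar + A xhat)
          + -lossIncrement (M.localLoss θstar A) (M.localScore A Y) xhat y := by
      rw [negLogLik_add, negLogLik_add, lossIncrement, inner_add_right]
      field_simp
      ring
    rw [h1, Real.exp_add]
    field_simp
  · rw [e, Set.indicator_of_notMem (fun h => hy ((M.mem_localDomain θstar A).2 h)),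
      Set.indicator_of_notMem (by exact hy), ENNReal.ofReal_zero, mul_zero]

lemma exists_unnormalizedPosterior_eq (hn : 0 < n) (hΘ : MeasurableSet M.paramSpace)
    (hpx : 0 < prior (θstar + A xhat)) :
    ∃ c : ℝ≥0∞, c ≠ 0 ∧ c ≠ ∞ ∧ ∀ {S : Set (EuclideanSpace ℝ (Fin d))}, MeasurableSet S →
      M.unnormalizedPosterior prior Y S
        = c * ∫⁻ y in (fun y => θstar + A xhat + A y) ⁻¹' S,
          ENNReal.ofReal (M.localWeight θstar A prior Y xhat y) := by
  obtain ⟨c, hc0, hct, hc⟩ := exists_lintegral_comp_affine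
    (volume : Measure (EuclideanSpace ℝ (Fin d))) (θstar + A xhat) A
  have hw : 0 < Real.exp (-(n : ℝ) * M.negLogLik Y (θstar + A xhat)) * prior (θstar + A xhat) := by
    positivity
  refine ⟨_, mul_ne_zero hc0 (ENNReal.ofReal_pos.2 hw).ne',
    ENNReal.mul_ne_top hct ENNReal.ofReal_ne_top, fun {S} hS => ?_⟩
  rw [unnormalizedPosterior, ← withDensity_indicator hΘ, withDensity_apply _ hS, hc _ hS]
  simp only [indicator_posteriorDensity hn hpx]
  rw [lintegral_const_mul' _ _ ENNReal.ofReal_ne_top, mul_assoc]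

/-- The likelihood is at most its value at the estimator, so an integrable prior gives a finite
total mass. -/
lemma unnormalizedPosterior_univ_lt_top (hprior : IntegrableOn prior M.paramSpace)
    (hΘ : MeasurableSet M.paramSpace) {θhat : EuclideanSpace ℝ (Fin d)}
    (hmle : M.IsMLE Y θhat) (hp : ∀ θ ∈ M.paramSpace, 0 ≤ prior θ) :
    M.unnormalizedPosterior prior Y Set.univ < ∞ := by
  rw [unnormalizedPosterior, withDensity_apply _ MeasurableSet.univ, Measure.restrict_univ]
  have h1 : Integrable (fun θ => Real.exp (-(n : ℝ) * M.negLogLik Y θhat) * prior θ)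
      (volume.restrict M.paramSpace) := hprior.const_mul _
  refine (setLIntegral_mono' hΘ fun θ hθ => ?_).trans_lt h1.lintegral_lt_top
  refine ENNReal.ofReal_le_ofReal (mul_le_mul_of_nonneg_right (Real.exp_le_exp.2 ?_) (hp θ hθ))
  have := mul_le_mul_of_nonneg_left (hmle.2 θ hθ) (Nat.cast_nonneg (α := ℝ) n)
  linarith

/-- The posterior is the image of the normalized weight under the affine chart. -/
lemma posterior_apply (hn : 0 < n) (hΘ : MeasurableSet M.paramSpace)
    (hpx : 0 < prior (θstar + A xhat)) (hi : Integrable (M.localWeight θstar A prior Y xhat))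
    (hw : 0 ≤ M.localWeight θstar A prior Y xhat)
    (hpos : 0 < ∫ y, M.localWeight θstar A prior Y xhat y)
    {S : Set (EuclideanSpace ℝ (Fin d))} (hS : MeasurableSet S) :
    M.posterior prior Y S = ENNReal.ofReal
      ((∫ y in (fun y => θstar + A xhat + A y) ⁻¹' S, M.localWeight θstar A prior Y xhat y) /
        ∫ y, M.localWeight θstar A prior Y xhat y) := by
  obtain ⟨c, hc0, hct, hc⟩ := exists_unnormalizedPosterior_eq (Y := Y) hn hΘ hpx
  rw [posterior, Measure.smul_apply, smul_eq_mul, hc MeasurableSet.univ, hc hS, Set.preimage_univ,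
    Measure.restrict_univ, ENNReal.ofReal_div_of_pos hpos,
    ofReal_integral_eq_lintegral_ofReal hi (ae_of_all _ hw),
    ofReal_integral_eq_lintegral_ofReal hi.integrableOn (ae_of_all _ hw), mul_comm,
    ← div_eq_mul_inv, ENNReal.mul_div_mul_left _ _ hc0 hct]

open scoped MatrixOrder in
/-- The Gaussian approximation is the image of the standard Gaussian under the affine chart. -/
lemma multivariateGaussian_real_apply (hA : ∀ x, A x
      = Matrix.toEuclideanCLM (𝕜 := ℝ) (CFC.sqrt ((n : ℝ) • M.fisher θstar)⁻¹) x)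
    (θhat : EuclideanSpace ℝ (Fin d)) {S : Set (EuclideanSpace ℝ (Fin d))} (hS : MeasurableSet S) :
    (multivariateGaussian θhat ((n : ℝ) • M.fisher θstar)⁻¹).real S
      = (stdGaussian (EuclideanSpace ℝ (Fin d))).real ((fun y => θhat + A y) ⁻¹' S) := by
  have e : (fun x => θhat + Matrix.toEuclideanCLM (𝕜 := ℝ)
      (CFC.sqrt ((n : ℝ) • M.fisher θstar)⁻¹) x) = fun y => θhat + A y := by
    funext y
    rw [hA]
  rw [multivariateGaussian, e, map_measureReal_apply (by fun_prop) hS]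

end GLM

/-! ### Prior regularity and the prior bound in whitened coordinates. -/

namespace GLM

variable {d k n : ℕ} {M : GLM d k n} {θstar xhat : EuclideanSpace ℝ (Fin d)}
  {A : EuclideanSpace ℝ (Fin d) ≃L[ℝ] EuclideanSpace ℝ (Fin d)} {s : ℝ}
  {prior : EuclideanSpace ℝ (Fin d) → ℝ}

lemma regular_of_delta01_ne_top (h : M.delta01 prior θstar s ≠ ∞) :
    ContDiffOn ℝ 1 prior (M.nbhd θstar s) ∧ ∀ θ ∈ M.nbhd θstar s, 0 < prior θ := by
  by_contra hc
  exact h (if_neg hc)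

lemma weightedDualNorm_le_delta01 (h : M.delta01 prior θstar s ≠ ∞)
    {θ : EuclideanSpace ℝ (Fin d)} (hθ : θ ∈ M.nbhd θstar s) :
    weightedDualNorm (M.fisher θstar)
      (fderivWithin ℝ (fun θ' => Real.log (prior θ')) (M.nbhd θstar s) θ)
        ≤ M.delta01 prior θstar s := by
  rw [delta01, if_pos (regular_of_delta01_ne_top h)]
  exact le_iSup₂_of_le θ hθ le_rfl

/-- In the interior of the neighborhood the derivative within the set, used in `delta01`, is the
ordinary derivative. -/
lemma IsWhitening.nbhd_mem_nhds (hA : M.IsWhitening θstar A) (hn : 0 < n)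
    {x : EuclideanSpace ℝ (Fin d)} (hx : ‖x‖ < s * √d) :
    M.nbhd θstar s ∈ nhds (θstar + A x) := by
  have hc : Continuous fun θ => A.symm (θ - θstar) := by fun_prop
  have h1 : ∀ᶠ θ in nhds (θstar + A x), ‖A.symm (θ - θstar)‖ < s * √d :=
    (hc.norm.continuousAt).eventually_lt continuousAt_const (by simpa using hx)
  filter_upwards [h1] with θ hθ
  have := (hA.add_mem_nbhd_iff hn (s := s)).2 hθ.le
  simpa using this

/-- For a unit vector `u`, the vector `A (√n • u)` has weighted norm 1; this is where the factor
`1/√n` comes from. -/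
lemma IsWhitening.norm_fderiv_log_prior_le (hA : M.IsWhitening θstar A) (hn : 0 < n)
    (h : M.delta01 prior θstar s ≠ ∞) {x : EuclideanSpace ℝ (Fin d)} (hx : ‖x‖ < s * √d) :
    ‖fderiv ℝ (fun x => Real.log (prior (θstar + A x))) x‖
      ≤ (M.delta01 prior θstar s).toReal / √n := by
  obtain ⟨h1, h2⟩ := regular_of_delta01_ne_top h
  have hn0 : (0 : ℝ) < √n := Real.sqrt_pos.2 (by exact_mod_cast hn)
  have hnh := hA.nbhd_mem_nhds hn hx
  have hmem : θstar + A x ∈ M.nbhd θstar s := mem_of_mem_nhds hnh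
  have hle := weightedDualNorm_le_delta01 h hmem
  rw [fderivWithin_of_mem_nhds hnh] at hle
  have hdiff : DifferentiableAt ℝ (fun θ => Real.log (prior θ)) (θstar + A x) :=
    (h1.contDiffAt hnh).differentiableAt one_ne_zero |>.log (h2 _ hmem).ne'
  have hcomp : HasFDerivAt (fun x => Real.log (prior (θstar + A x)))
      ((fderiv ℝ (fun θ => Real.log (prior θ)) (θstar + A x)).comp A.toContinuousLinearMap) x :=
    HasFDerivAt.comp (g := fun θ => Real.log (prior θ)) x hdiff.hasFDerivAt
      (A.hasFDerivAt.const_add θstar)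
  rw [hcomp.fderiv]
  have hunit : ∀ u : EuclideanSpace ℝ (Fin d), ‖u‖ = 1 →
      fderiv ℝ (fun θ => Real.log (prior θ)) (θstar + A x) (A u)
        ≤ (M.delta01 prior θstar s).toReal / √n := by
    intro u hu
    have h3 : weightedNorm (M.fisher θstar) (A (√n • u)) = 1 := by
      rw [hA.weightedNorm_eq, norm_smul, hu, mul_one, Real.norm_of_nonneg hn0.le,
        div_self hn0.ne']
    have h4 := (le_iSup₂ (f := fun (u : EuclideanSpace ℝ (Fin d))
      (_ : weightedNorm (M.fisher θstar) u = 1) =>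
        ENNReal.ofReal (fderiv ℝ (fun θ => Real.log (prior θ)) (θstar + A x) u)) _ h3).trans hle
    rw [← ENNReal.ofReal_toReal h, ENNReal.ofReal_le_ofReal_iff ENNReal.toReal_nonneg, map_smul,
      map_smul, smul_eq_mul] at h4
    rwa [le_div_iff₀ hn0, mul_comm]
  refine ContinuousLinearMap.opNorm_le_of_unit_norm (by positivity) fun u hu => ?_
  rw [Real.norm_eq_abs, abs_le']
  refine ⟨hunit u hu, ?_⟩
  have := hunit (-u) (by rwa [norm_neg])
  simpa using this

/-- The supremum is at least 1, as `θstar` is admissible, and finite by assumption. Its logarithm is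
therefore real and exponentiates back to a bound on the prior. -/
lemma exists_M0_eq (hd : 0 < d) (hθ : θstar ∈ M.paramSpace) (hpos : 0 < prior θstar)
    (h : M.M0 prior θstar ≠ ⊤) :
    ∃ m : ℝ, M.M0 prior θstar = (m : EReal) ∧
      ∀ θ ∈ M.paramSpace, prior θ ≤ prior θstar * Real.exp (d * m) := by
  have hd0 : (0 : ℝ) < d := by exact_mod_cast hd
  set S : ℝ≥0∞ := ⨆ (θ : EuclideanSpace ℝ (Fin d)) (_ : θ ∈ M.paramSpace),
    ENNReal.ofReal (prior θ / prior θstar) with hS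
  have hle : ∀ θ ∈ M.paramSpace, ENNReal.ofReal (prior θ / prior θstar) ≤ S :=
    fun θ hθ => le_iSup₂_of_le θ hθ le_rfl
  have hS1 : 1 ≤ S := by
    have := hle _ hθ
    rwa [div_self hpos.ne', ENNReal.ofReal_one] at this
  have hM0 : M.M0 prior θstar = (((d : ℝ)⁻¹ : ℝ) : EReal) * ENNReal.log S := rfl
  have hSt : S ≠ ∞ := by
    intro hSt
    apply h
    rw [hM0, hSt, ENNReal.log_top, EReal.coe_mul_top_of_pos (by positivity)]
  have hS0 : 0 < S.toReal := ENNReal.toReal_pos (by positivity) hSt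
  refine ⟨(d : ℝ)⁻¹ * Real.log S.toReal, ?_, fun θ hθ' => ?_⟩
  · rw [hM0, ENNReal.log_pos_real' hS0, EReal.coe_mul]
  · rw [mul_inv_cancel_left₀ hd0.ne', Real.exp_log hS0]
    have := hle θ hθ'
    rw [ENNReal.ofReal_le_iff_le_toReal hSt, div_le_iff₀ hpos] at this
    rwa [mul_comm]

end GLM

/-! ### Assembly of the main theorem. -/

theorem proposition4p3 :
    ∃ C : ℝ, 0 < C ∧
      ∀ (d k n : ℕ) (M : GLM d k n) (θstar : EuclideanSpace ℝ (Fin d))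
        (prior : EuclideanSpace ℝ (Fin d) → ℝ) (s : ℝ),
        0 < d →
        0 < n →
        IsRegularMinimal M.base →
        M.ColumnsSpan →
        θstar ∈ M.paramSpace →
        Measurable prior →
        (∀ θ ∈ M.paramSpace, 0 ≤ prior θ) →
        -- a proper prior, or an improper one with a bounded density
        (IntegrableOn prior M.paramSpace ∨ BddAbove (prior '' M.paramSpace)) →
        12 ≤ s →
        M.nbhd θstar (2 * s) ⊆ M.paramSpace →
        ENNReal.ofReal (2 * s) * M.delta3 θstar (2 * s) * ENNReal.ofReal √((d : ℝ) / n)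
          ≤ ENNReal.ofReal (1 / 4) →
        M.delta01 prior θstar (2 * s) ≤ ENNReal.ofReal (√((n : ℝ) * d) / 6) →
        ∃ E : Set (Fin n → EuclideanSpace ℝ (Fin k)),
          MeasurableSet E ∧
          ENNReal.ofReal (1 - Real.exp (-(d * s ^ 2 / 10))) ≤ M.labelLaw θstar E ∧
          ∀ Y ∈ E, ∃ θhat : EuclideanSpace ℝ (Fin d),
            M.IsMLE Y θhat ∧
            (∀ θ, M.IsMLE Y θ → θ = θhat) ∧
            IsProbabilityMeasure (M.posterior prior Y) ∧
            tvDistance (M.posterior prior Y)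
                (multivariateGaussian θhat ((n : ℝ) • M.fisher θstar)⁻¹)
              ≤ ENNReal.ofReal C *
                (M.delta01 prior θstar (2 * s) / ENNReal.ofReal √(n : ℝ)
                  + ENNReal.ofReal s * M.delta3 θstar (2 * s) * ENNReal.ofReal ((d : ℝ) / √(n : ℝ))
                  + EReal.exp ((d : EReal) * (M.M0 prior θstar - (((s / 12) ^ 2 : ℝ) : EReal)))) := by
  obtain ⟨C, hC, htv⟩ := exists_centeredWeight_tv_le
  refine ⟨C + 1000, by positivity, ?_⟩
  intro d k n M θstar prior s hd hn hM hcol hθ hpm hp hprior hs hsub h3 h1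
  have hn0 : (0 : ℝ) < n := by exact_mod_cast hn
  have hd0 : (0 : ℝ) < d := by exact_mod_cast hd
  have hμ := hM.ne_zero (hcol.pos hd)
  obtain ⟨A, hAeq, hA⟩ := exists_whitening (GLM.posDef_fisher hd hn hM hcol hθ) hn0
  have hA : M.IsWhitening θstar A := hA
  have H := GLM.whitenedLoss hd hn hM hcol hθ hA hs hsub h3
  have h1t : M.delta01 prior θstar (2 * s) ≠ ∞ := ne_top_of_le_ne_top ENNReal.ofReal_ne_top h1
  have h3t := GLM.delta3_ne_top hd hn hs h3
  obtain ⟨hreg, hpos⟩ := GLM.regular_of_delta01_ne_top h1t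
  have hΘ : MeasurableSet M.paramSpace := by
    have : IsOpen M.paramSpace := by
      have h2 : M.paramSpace = ⋂ i, M.predictorL i ⁻¹' naturalSpace M.base := by
        ext θ
        simp [GLM.paramSpace, GLM.predictorL_apply]
      rw [h2]
      exact isOpen_iInter_of_finite fun i =>
        hM.isOpen_naturalSpace.preimage (M.predictorL i).continuous
    exact this.measurableSet
  refine ⟨M.scoreEvent θstar A s, GLM.measurableSet_scoreEvent, GLM.labelLaw_scoreEvent_ge hμ hθ H,
    fun Y hY => ?_⟩
  obtain ⟨xhat, hxD, hx, hgrad, hmle, huniq⟩ := GLM.exists_local_minimizer hn H hY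
  set p : EuclideanSpace ℝ (Fin d) → ℝ := fun x => prior (θstar + A x) with hpdef
  have hpm' : Measurable p := hpm.comp (by fun_prop)
  have hp' : ∀ x ∈ M.localDomain θstar A, 0 ≤ p x :=
    fun x hx => hp _ ((M.mem_localDomain θstar A).1 hx)
  have hball : ∀ x ∈ Metric.ball (0 : EuclideanSpace ℝ (Fin d)) (2 * s * √d),
      θstar + A x ∈ M.nbhd θstar (2 * s) := fun x hx =>
    (hA.add_mem_nbhd_iff hn).2 (mem_ball_zero_iff.1 hx).le
  have hp0 : ∀ x ∈ Metric.ball (0 : EuclideanSpace ℝ (Fin d)) (2 * s * √d), 0 < p x :=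
    fun x hx => hpos _ (hball x hx)
  have hr := H.radius_pos
  have hpx : 0 < p xhat := hp0 xhat (by rw [mem_ball_zero_iff]; linarith)
  have hw : ∀ y, 0 ≤ M.localWeight θstar A prior Y xhat y :=
    WhitenedLoss.centeredWeight_nonneg hp' hpx
  -- For an integrable prior the boundedness of the likelihood suffices; for a bounded prior the
  -- linear growth of the loss does.
  have hi : Integrable (M.localWeight θstar A prior Y xhat) := by
    rcases hprior with h | ⟨B, hB⟩
    · obtain ⟨c, hc0, hct, hc⟩ := GLM.exists_unnormalizedPosterior_eq (Y := Y) hn hΘ hpx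
      have h4 := GLM.unnormalizedPosterior_univ_lt_top h hΘ hmle hp
      rw [hc MeasurableSet.univ, Set.preimage_univ, Measure.restrict_univ] at h4
      have hwm : AEStronglyMeasurable (M.localWeight θstar A prior Y xhat) :=
        H.aestronglyMeasurable_centeredWeight hpm'
      rw [← lintegral_ofReal_ne_top_iff_integrable hwm (ae_of_all _ hw)]
      exact fun h5 => by simp [h5, ENNReal.mul_top hc0] at h4
    · exact H.integrable_centeredWeight hx hgrad hpm' hp' hpx (B := B) fun x hx =>
        hB ⟨_, (M.mem_localDomain θstar A).1 hx, rfl⟩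
  have hipos : 0 < ∫ y, M.localWeight θstar A prior Y xhat y :=
    H.integral_centeredWeight_pos hx hp' hp0 hi
  have hpost : ∀ {S : Set (EuclideanSpace ℝ (Fin d))}, MeasurableSet S → M.posterior prior Y S = _ :=
    fun hS => GLM.posterior_apply hn hΘ hpx hi hw hipos hS
  have hprob : IsProbabilityMeasure (M.posterior prior Y) := by
    constructor
    rw [hpost MeasurableSet.univ, Set.preimage_univ, Measure.restrict_univ]
    exact ENNReal.ofReal_eq_one.2 (div_self hipos.ne')
  refine ⟨θstar + A xhat, hmle, huniq, hprob, ?_⟩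
  -- For a prior unbounded on the parameter space the right-hand side is infinite; only the
  -- existence of the posterior has content there.
  by_cases hM0 : M.M0 prior θstar = ⊤
  · have h5 : (d : EReal) * (M.M0 prior θstar - (((s / 12) ^ 2 : ℝ) : EReal)) = ⊤ := by
      rw [hM0, EReal.top_sub_coe]
      exact EReal.coe_mul_top_of_pos hd0
    rw [h5, EReal.exp_top, add_top, ENNReal.mul_top (by simp; positivity)]
    exact le_top
  obtain ⟨m, hm, hpm0⟩ := GLM.exists_M0_eq hd hθ
    (hpos _ (by simpa using hball 0 (by simpa using (by positivity : 0 < 2 * s * √d)))) hM0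
  set a := (M.delta01 prior θstar (2 * s)).toReal / √n with ha
  set τ := (M.delta3 θstar (2 * s)).toReal / √n with hτ
  have ha0 : 0 ≤ a := by positivity
  have hτ0 : 0 ≤ s * τ * d := by positivity
  have hrhs : M.delta01 prior θstar (2 * s) / ENNReal.ofReal √(n : ℝ)
      + ENNReal.ofReal s * M.delta3 θstar (2 * s) * ENNReal.ofReal ((d : ℝ) / √(n : ℝ))
      + EReal.exp ((d : EReal) * (M.M0 prior θstar - (((s / 12) ^ 2 : ℝ) : EReal)))
      = ENNReal.ofReal (a + s * τ * d + Real.exp (d * (m - (s / 12) ^ 2))) := by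
    rw [ENNReal.ofReal_add (by positivity) (Real.exp_pos _).le, ENNReal.ofReal_add ha0 hτ0, hm]
    congr 1
    · congr 1
      · rw [ha, ENNReal.ofReal_div_of_pos (by positivity), ENNReal.ofReal_toReal h1t]
      · rw [← ENNReal.ofReal_toReal h3t, ← ENNReal.ofReal_mul (by linarith),
          ← ENNReal.ofReal_mul (by positivity), hτ]
        congr 1
        ring
  rw [hrhs, ← ENNReal.ofReal_mul (by positivity)]
  have hexp := Real.exp_pos (d * (m - (s / 12) ^ 2))
  -- If a threshold fails, the sum of error terms is at least `3/1000`; the summand 1000 in the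
  -- constant then makes the bound exceed 1.
  by_cases hsmall : a ≤ 1 / 100 ∧ s * τ * d ≤ 3 / 1000
  · obtain ⟨_, htv⟩ := htv d s τ a m _ _ p _ xhat H hx hgrad hpm' hp'
      (hreg.comp (contDiff_const.add A.contDiff).contDiffOn hball) hp0
      (fun x hx => hA.norm_fderiv_log_prior_le hn h1t (mem_ball_zero_iff.1 hx)) hsmall.1 hsmall.2
      fun x hx => by
        have := hpm0 _ ((M.mem_localDomain θstar A).1 hx)
        simpa [hpdef] using this
    refine iSup₂_le fun S hS => ENNReal.ofReal_le_ofReal ?_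
    have hS' : MeasurableSet ((fun y => θstar + A xhat + A y) ⁻¹' S) := hS.preimage (by fun_prop)
    rw [GLM.multivariateGaussian_real_apply hAeq _ hS, measureReal_def, hpost hS,
      ENNReal.toReal_ofReal (div_nonneg (integral_nonneg hw) hipos.le)]
    refine (htv _ hS').trans (mul_le_mul_of_nonneg_right (by linarith) (by positivity))
  · refine (tvDistance_le_one _ _).trans (ENNReal.one_le_ofReal.2 ?_)
    have h6 : 3 / 1000 ≤ a + s * τ * d + Real.exp (d * (m - (s / 12) ^ 2)) := by
      rw [not_and_or, not_le, not_le] at hsmall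
      rcases hsmall with h | h <;> linarith
    nlinarith
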